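/- Let $p\ge 1$ be an integer and $\beta,h,\bar\beta,\bar h\in\mathbb R$, $\beta>0$. Put $f_{\beta,h}(a)=\beta(2a-1)^p+h(2a-1)$, $I(a)=-a\log a-(1-a)\log(1-a)$, $A=f_{\beta,h}+I$ and $B=f_{\bar\beta,\bar h}$ on $[0,1]$. For $\omega\in\{-1,1\}^n$ let $M_n=\omega_1+\dots+\omega_n$ and $\bar\omega_+=|\{i:\omega_i=1\}|/n$. Let $\mu_n^r$ and $\mu_n^s$ be the Gibbs measures on $\{-1,1\}^n$ with $\mu_n^r(\omega)\propto\exp\big(nf_{\beta,h}(\bar\omega_+)+\sqrt n\,B(\bar\omega_+)\big)$ and $\mu_n^s(\omega)\propto\exp\big(nf_{\beta,h}(\bar\omega_+)+n^{1/4}B(\bar\omega_+)\big)$. Let $R_1$ be the set of $(\beta,h)$, $\beta>0$, for which $A$ has a unique maximizer $a_*$ on $[0,1]$, with $a_*\in(0,1)$ and $A''(a_*)\neq0$; $R_2$ the set of those for which $A$ has at least two maximizers; $R_3$ the set of those for which $A$ has a unique maximizer $a_*$, with $a_*\in(0,1)$ and $A''(a_*)=0$. A point $a\in(0,1)$ is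 $2m$-regular if $A^{(k)}(a)=0$ for $1\le k\le 2m-1$ and $A^{(2m)}(a)<0$. Let $d_W(\mu,\nu)=\sup|\int g\,d\mu-\int g\,d\nu|$ over all $1$-Lipschitz $g:\mathbb R\to\mathbb R$. The constants $c>0$, $C$ below do not depend on $n$. For a $2$-regular $a$, write $N_a$ for the normal law with mean $-2B'(a)/A''(a)$ and variance $-4/A''(a)$. **Theorem.** (i) If $(\beta,h)\in R_1$, then $a_*$ is $2$-regular and, under $\mu_n^r$: for every $\delta>0$ there is $c>0$ with $\mu_n^r(|M_n/n-(2a_*-1)|>\delta)\le e^{-cn}$ for all large $n$; $M_n/n\to 2a_*-1$ in law; for every integer $l\ge0$ there is $C$ with $\mathbb E|M_n/n-(2a_*-1)|^l\le Cn^{-l/2}$ for all $n\ge1$; and there is $C$ with $$d_W\Big(\mathcal L\Big(\tfrac{M_n-n(2a_*-1)}{\sqrt n}\Big),N_{a_*}\Big)\le \frac{C}{\sqrt n}\qquad(n\ge1).$$ (ii) If $(\beta,h)\in R_2$, then $A$ has finitely many maximizers $a_1<\dots<a_k$; all lie in $(0,1)$ and are $2$-regular. Let $J=\{1,\dots,k\}$,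 $J_1=\{j\in J:B(a_j)=\max_{i\in J}B(a_i)\}$, and for $j\in J_1$ let $p_j=w_j/\sum_{i\in J_1}w_i$, where $w_j=(a_j(1-a_j))^{-1/2}\int_{\mathbb R}\exp\big(\tfrac12A''(a_j)x^2+B'(a_j)x\big)dx$. Under $\mu_n^r$: * for every $\delta>0$ there is $c>0$ such that, for all large $n$, $\mu_n^r\big(\forall j\in J:\ |M_n/n-(2a_j-1)|>\delta\big)\le e^{-cn}$ and, for some such $c$, $\mu_n^r\big(\forall j\in J_1:\ |M_n/n-(2a_j-1)|>\delta\big)\le e^{-c\sqrt n}$; * $M_n/n$ converges in law to $\sum_{j\in J_1}p_j\,\delta_{2a_j-1}$; * if $j\in J$, $\delta>0$ and $\delta<|(2a_i-1)-(2a_j-1)|$ for all $i\ne j$, then with $E_n=\{|M_n/n-(2a_j-1)|\le\delta\}$ one has, for all large $n$: $|\mu_n^r(E_n)-p_j|\le C(\log n)^3/\sqrt n$ if $j\in J_1$; $\mathbb E\big[|M_n/n-(2a_j-1)|^l\,\big|\,E_n\big]\le C_l\,n^{-l/2}$ for every integer $l\ge0$; and $$d_W\Big(\mathcal L\Big(\tfrac{M_n-n(2a_j-1)}{\sqrt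 n}\,\Big|\,E_n\Big),N_{a_j}\Big)\le\frac{C}{\sqrt n}.$$ (iii) If $(\beta,h)\in R_3$, then $a_*$ is $4$-regular and there is $C$ such that, under $\mu_n^s$, for all $n\ge1$, $$d_W\Big(\mathcal L\Big(\tfrac{M_n-n(2a_*-1)}{n^{3/4}}\Big),\mathcal L(Y)\Big)\le C\,n^{-1/4},$$ where $Y$ has density proportional to $\exp\big(\tfrac{c_*x^4}{16}+\tfrac{b_*x}{2}\big)$, $c_*=A^{(4)}(a_*)/24$, $b_*=B'(a_*)$. -/

import Mathlib

open MeasureTheory ProbabilityTheory Filter Topology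

namespace PSpin

/-- The configuration space `{-1, 1}^n`; `true` encodes the spin `+1`, `false` the spin `-1`. -/
abbrev Config (n : ℕ) : Type := Fin n → Bool

/-- The value `±1` of a spin. -/
def spin (b : Bool) : ℝ := if b then 1 else -1

/-- The (total) magnetization `M_n(ω) = ω_1 + … + ω_n`. -/
def magnetization {n : ℕ} (ω : Config n) : ℝ := ∑ i, spin (ω i)

/-- The fraction of positive spins, `#{i : ω_i = 1} / n`. -/
noncomputable def plusFraction {n : ℕ} (ω : Config n) : ℝ :=
  ((Finset.univ.filter fun i => ω i = true).card : ℝ) / n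

/-- The Gibbs measure on `{-1, 1}^n` with Hamiltonian `H`: `μ(ω) = exp (H ω) / Z`. -/
noncomputable def gibbs {n : ℕ} (H : Config n → ℝ) : Measure (Config n) :=
  ∑ ω, ENNReal.ofReal (Real.exp (H ω) / ∑ η, Real.exp (H η)) • Measure.dirac ω

/-- `f_{β,h}(a) = β (2a - 1)^p + h (2a - 1)`. -/
def energy (p : ℕ) (β h a : ℝ) : ℝ := β * (2 * a - 1) ^ p + h * (2 * a - 1)

/-- `A = f_{β,h} + I`, with `I(a) = - a log a - (1 - a) log (1 - a)` the entropy. -/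
noncomputable def freeEnergy (p : ℕ) (β h a : ℝ) : ℝ := energy p β h a + Real.binEntropy a

/-- The set of global maximizers of `A` on `[0, 1]`. -/
def maximizers (p : ℕ) (β h : ℝ) : Set ℝ :=
  {a | a ∈ Set.Icc (0 : ℝ) 1 ∧ IsMaxOn (freeEnergy p β h) (Set.Icc 0 1) a}

/-- `a` is a `2m`-regular point of `A`: the derivatives of orders `1, …, 2m - 1` vanish at `a` and
the derivative of order `2m` is negative. -/
def IsRegular (A : ℝ → ℝ) (m : ℕ) (a : ℝ) : Prop :=
  (∀ k, 1 ≤ k → k < 2 * m → iteratedDeriv k A a = 0) ∧ iteratedDeriv (2 * m) A a < 0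

/-- The regular region `R₁`: `A` has a unique maximizer, it lies in `(0, 1)`, and `A''` does not
vanish there (the latter separates `R₁` from the special points `R₃`). -/
def regularRegion (p : ℕ) : Set (ℝ × ℝ) :=
  {θ | 0 < θ.1 ∧ ∃ a ∈ Set.Ioo (0 : ℝ) 1, maximizers p θ.1 θ.2 = {a} ∧
    iteratedDeriv 2 (freeEnergy p θ.1 θ.2) a ≠ 0}

/-- The critical curve `R₂`: `A` has at least two maximizers. -/
def criticalCurve (p : ℕ) : Set (ℝ × ℝ) :=
  {θ | 0 < θ.1 ∧ (maximizers p θ.1 θ.2).Nontrivial}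

/-- The special points `R₃`: `A` has a unique maximizer, it lies in `(0, 1)`, and `A''` vanishes
there. -/
def specialPoints (p : ℕ) : Set (ℝ × ℝ) :=
  {θ | 0 < θ.1 ∧ ∃ a ∈ Set.Ioo (0 : ℝ) 1, maximizers p θ.1 θ.2 = {a} ∧
    iteratedDeriv 2 (freeEnergy p θ.1 θ.2) a = 0}

/-- `μ_n^r`: the Gibbs measure of `n f_{β,h} + √n f_{β',h'}`. -/
noncomputable def gibbsR (p : ℕ) (β h β' h' : ℝ) (n : ℕ) : Measure (Config n) :=
  gibbs fun ω => (n : ℝ) * energy p β h (plusFraction ω)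
    + √(n : ℝ) * energy p β' h' (plusFraction ω)

/-- `μ_n^s`: the Gibbs measure of `n f_{β,h} + n^{1/4} f_{β',h'}`. -/
noncomputable def gibbsS (p : ℕ) (β h β' h' : ℝ) (n : ℕ) : Measure (Config n) :=
  gibbs fun ω => (n : ℝ) * energy p β h (plusFraction ω)
    + (n : ℝ) ^ (1 / 4 : ℝ) * energy p β' h' (plusFraction ω)

/-- The Wasserstein distance `sup |∫ f dμ - ∫ f dν|` over all `1`-Lipschitz functions `f`. -/
noncomputable def wassersteinDist (μ ν : Measure ℝ) : ENNReal :=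
  ⨆ (f : ℝ → ℝ) (_ : LipschitzWith 1 f), ENNReal.ofReal |(∫ x, f x ∂μ) - ∫ x, f x ∂ν|

/-- The Gaussian limit law at a maximizer `a`, i.e. the normal law with density proportional to
`exp (A''(a) x² / 8 + B'(a) x / 2)`, where `B = f_{β',h'}`. -/
noncomputable def cltLaw (p : ℕ) (β h β' h' a : ℝ) : Measure ℝ :=
  gaussianReal (-2 * deriv (energy p β' h') a / iteratedDeriv 2 (freeEnergy p β h) a)
    (Real.toNNReal (-4 / iteratedDeriv 2 (freeEnergy p β h) a))

open Classical in
/-- The points of `s` at which `B` is largest. -/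
noncomputable def dominant (B : ℝ → ℝ) (s : Finset ℝ) : Finset ℝ :=
  s.filter fun a => ∀ b ∈ s, B b ≤ B a

/-- The unnormalized weight `(a (1 - a))^{-1/2} ∫ exp (A''(a) x² / 2 + B'(a) x) dx`. -/
noncomputable def weight (p : ℕ) (β h β' h' a : ℝ) : ℝ :=
  (√(a * (1 - a)))⁻¹ *
    ∫ x : ℝ, Real.exp (iteratedDeriv 2 (freeEnergy p β h) a / 2 * x ^ 2
      + deriv (energy p β' h') a * x)

/-- The weight of `a`, normalized over the finite set `t`. -/
noncomputable def prob (p : ℕ) (β h β' h' : ℝ) (t : Finset ℝ) (a : ℝ) : ℝ :=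
  weight p β h β' h' a / ∑ b ∈ t, weight p β h β' h' b

end PSpin

/-! ### Stirling's formula with a rate, and binomial coefficients -/

namespace PSpin

/-! Everything is Laplace's method on a lattice. The fraction `x = k / n` of plus spins has weight
`n.choose k * exp (n f + t B)`, and Stirling's formula turns the binomial coefficient into `exp (n
I)` times `1 / √(2π n a (1 - a))` near `a`; so the exponent is `n A + t B`. At a `2m`-regular
maximizer the scale `t = n ^ (1 / (2m))` makes both parts survive: with `y = t (x - a)` they tend to
`c y ^ (2m)` and `b y`, with an error `1 / t` times a polynomial in `|y|`. For `m = 1` this is a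
Gaussian at scale `√n`, for `m = 2` a quartic law at scale `n ^ (1 / 4)`.

The rate comes from `LaplaceData.abs_scaledWeight_sub_le`, a pointwise comparison with error `exp
(-|y|) / t`. A lattice sum is the integral of a step function with cells of width `t / n ≤ 1 / t`,
so integrating the comparison gives `LaplaceData.abs_latticeSum_sub_le`, uniformly over test
functions with a common growth and Lipschitz constant. Dividing by the mass of the window gives the
Wasserstein bound `LaplaceData.exists_wasserstein_le`.

With several maximizers the values of `A` agree, so the masses of their neighbourhoods differ by
factors `exp (t B)`: those with smaller `B` lose exponentially in `√n`, the others share the mass in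
proportion to their Laplace integrals. The nearest-maximizer map cuts the line into one window per
maximizer. Away from all maximizers the drop of `A` and the entropy bound on binomial coefficients
give exponential smallness in `n`.

The analysis of `A` supplies the regularity. Maximizers are interior because the entropy has
infinite slope at the endpoints. If `A''` vanishes at a maximizer, so does `A'''`; both equations
together fix `(2a - 1) ^ 2 = (p - 2) / p` and force the fourth derivative to be negative. They also
make `A` concave on `[0, 1]` for `β > 0`, so that a degenerate maximizer is unique
(`maximizers_eq_singleton_of_degenerate`): on the critical curve all maximizers are `2`-regular. -/

theorem abs_exp_sub_exp_le (u v : ℝ) :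
    |Real.exp u - Real.exp v| ≤ |u - v| * Real.exp (max u v) := by
  wlog h : v ≤ u generalizing u v
  · rw [abs_sub_comm, abs_sub_comm u, max_comm]
    exact this v u (le_of_not_ge h)
  rw [max_eq_left h, abs_of_nonneg (sub_nonneg.2 h),
    abs_of_nonneg (sub_nonneg.2 (Real.exp_le_exp.2 h))]
  have h1 := Real.add_one_le_exp (v - u)
  rw [Real.exp_sub, le_div_iff₀ (Real.exp_pos u)] at h1
  linarith

theorem abs_log_sub_log_le {x y η : ℝ} (hη : 0 < η) (hx : η ≤ x) (hy : η ≤ y) :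
    |Real.log x - Real.log y| ≤ |x - y| / η := by
  wlog h : y ≤ x generalizing x y
  · rw [abs_sub_comm, abs_sub_comm x]
    exact this hy hx (le_of_not_ge h)
  have hy0 : 0 < y := hη.trans_le hy
  have hx0 : 0 < x := hη.trans_le hx
  rw [abs_of_nonneg (sub_nonneg.2 h),
    abs_of_nonneg (sub_nonneg.2 (Real.log_le_log hy0 h)), ← Real.log_div hx0.ne' hy0.ne']
  calc Real.log (x / y) ≤ x / y - 1 := Real.log_le_sub_one_of_pos (by positivity)
    _ = (x - y) / y := by field_simp
    _ ≤ (x - y) / η := div_le_div_of_nonneg_left (sub_nonneg.2 h) hη hy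

/-- The Stirling sequence approaches `√π` at rate `1 / n`. -/
theorem log_stirlingSeq_sub_log_sqrt_pi_le {n : ℕ} (hn : 1 ≤ n) :
    Real.log (Stirling.stirlingSeq n) - Real.log √Real.pi ≤ 1 / (12 * n) := by
  -- The bound `1 / (12 i (i + 1))` on one decrement of the logarithm telescopes; letting `j → ∞`
  -- replaces the second logarithm by `log √π`.
  have hstep : ∀ j : ℕ, Real.log (Stirling.stirlingSeq n) - Real.log (Stirling.stirlingSeq (n + j))
      ≤ 1 / (12 * n) - 1 / (12 * (n + j : ℕ)) := by
    intro j
    induction j with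
    | zero => simp
    | succ j ih =>
      have h := Stirling.log_stirlingSeq_sdiff_le (n + j)
      have hpos : (0 : ℝ) < (n + j : ℕ) := by exact_mod_cast (by omega : 0 < n + j)
      have e : 1 / (12 * ((n + j : ℕ) : ℝ) * (((n + j : ℕ) : ℝ) + 1))
          = 1 / (12 * ((n + j : ℕ) : ℝ)) - 1 / (12 * ((n + (j + 1) : ℕ) : ℝ)) := by
        rw [show ((n + (j + 1) : ℕ) : ℝ) = ((n + j : ℕ) : ℝ) + 1 by push_cast; ring]
        field_simp
        ring
      rw [e] at h
      rw [← add_assoc] at *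
      linarith
  have hlim : Tendsto (fun j : ℕ => Real.log (Stirling.stirlingSeq n)
      - Real.log (Stirling.stirlingSeq (n + j))) atTop
      (𝓝 (Real.log (Stirling.stirlingSeq n) - Real.log √Real.pi)) := by
    refine tendsto_const_nhds.sub (Tendsto.log ?_ (by positivity))
    have := (tendsto_add_atTop_iff_nat n).2 Stirling.tendsto_stirlingSeq_sqrt_pi
    simpa [add_comm] using this
  refine le_of_tendsto hlim (Eventually.of_forall fun j => (hstep j).trans ?_)
  have : (0 : ℝ) ≤ 1 / (12 * (n + j : ℕ)) := by positivity
  linarith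

/-- Stirling's formula with the remainder kept as a number `θ`: nonnegative because the Stirling
sequence stays above its limit `√π`, small by the telescoping bound. -/
theorem log_factorial_eq {n : ℕ} (hn : 1 ≤ n) :
    ∃ θ : ℝ, 0 ≤ θ ∧ θ ≤ 1 / (12 * n) ∧ Real.log (n.factorial : ℝ)
      = θ + Real.log Real.pi / 2 + Real.log (2 * n) / 2 + n * Real.log n - n := by
  have hn0 : n ≠ 0 := by omega
  have hnpos : (0 : ℝ) < n := by exact_mod_cast hn
  refine ⟨Real.log (Stirling.stirlingSeq n) - Real.log √Real.pi, ?_,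
    log_stirlingSeq_sub_log_sqrt_pi_le hn, ?_⟩
  · exact sub_nonneg.2 (Real.log_le_log (by positivity) (Stirling.sqrt_pi_le_stirlingSeq hn0))
  · rw [Stirling.log_stirlingSeq_formula, Real.log_sqrt Real.pi_pos.le,
      Real.log_div hnpos.ne' (Real.exp_pos 1).ne', Real.log_exp]
    ring

theorem mul_binEntropy_div {n k : ℕ} (hk : 0 < k) (hkn : k < n) :
    n * Real.binEntropy (k / n) = n * Real.log n - k * Real.log k
      - ((n - k : ℕ) : ℝ) * Real.log ((n - k : ℕ) : ℝ) := by
  have hn : (0 : ℝ) < n := by exact_mod_cast (hk.trans hkn)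
  have hk' : (0 : ℝ) < k := by exact_mod_cast hk
  have hnk : (0 : ℝ) < (n - k : ℕ) := by exact_mod_cast (by omega : 0 < n - k)
  have hc : ((n - k : ℕ) : ℝ) = n - k := by rw [Nat.cast_sub hkn.le]
  have h1 : 1 - (k : ℝ) / n = ((n - k : ℕ) : ℝ) / n := by rw [hc]; field_simp
  rw [Real.binEntropy, h1, Real.log_inv, Real.log_inv, Real.log_div hk'.ne' hn.ne',
    Real.log_div hnk.ne' hn.ne']
  field_simp
  rw [hc]
  ring

/-- The entropy bound for binomial coefficients. -/
theorem choose_mul_exp_neg_binEntropy_le_one {n k : ℕ} (hn : 1 ≤ n) (hk : k ≤ n) :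
    (n.choose k : ℝ) * Real.exp (-(n * Real.binEntropy (k / n))) ≤ 1 := by
  have hn' : (n : ℝ) ≠ 0 := by positivity
  rcases Nat.eq_zero_or_pos k with rfl | hk0
  · simp
  rcases hk.eq_or_lt with rfl | hkn
  · simp [div_self hn']
  have hnp : (0 : ℝ) < n := by exact_mod_cast hn
  have hk' : (0 : ℝ) < k := by exact_mod_cast hk0
  have hnk : (0 : ℝ) < (n - k : ℕ) := by exact_mod_cast (by omega : 0 < n - k)
  have hc : ((n - k : ℕ) : ℝ) = n - k := by rw [Nat.cast_sub hkn.le]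
  have hexp : Real.exp (-(n * Real.binEntropy (k / n)))
      = ((k : ℝ) / n) ^ k * (((n - k : ℕ) : ℝ) / n) ^ (n - k) := by
    rw [mul_binEntropy_div hk0 hkn, ← Real.exp_log (by positivity : 0 < ((k : ℝ) / n) ^ k
      * (((n - k : ℕ) : ℝ) / n) ^ (n - k)), Real.log_mul (by positivity) (by positivity),
      Real.log_pow, Real.log_pow, Real.log_div hk'.ne' hnp.ne', Real.log_div hnk.ne' hnp.ne']
    congr 1
    rw [hc]
    ring
  have hsum : ((k : ℝ) / n + ((n - k : ℕ) : ℝ) / n) ^ n = 1 := by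
    rw [hc, ← add_div, add_sub_cancel, div_self hn', one_pow]
  rw [hexp, ← hsum, add_pow]
  -- With `x = k / n`, the quantity is one term of the binomial expansion of `(x + (1 - x)) ^ n =
  -- 1`, whose terms are all nonnegative.
  have := Finset.single_le_sum (f := fun m => ((k : ℝ) / n) ^ m * (((n - k : ℕ) : ℝ) / n) ^ (n - m)
    * (n.choose m : ℝ)) (s := Finset.range (n + 1)) (fun m _ => by positivity)
    (Finset.mem_range.2 (Nat.lt_succ_of_le hk))
  calc _ = ((k : ℝ) / n) ^ k * (((n - k : ℕ) : ℝ) / n) ^ (n - k) * (n.choose k : ℝ) := by ring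
    _ ≤ _ := this

set_option maxHeartbeats 800000 in
/-- The local Stirling approximation of binomial coefficients around a fraction `a`. -/
theorem exists_abs_sqrt_mul_choose_sub_le {a ε : ℝ} (h0 : 0 < a - ε) (h1 : a + ε < 1)
    (hε : 0 ≤ ε) :
    ∃ C : ℝ, 0 ≤ C ∧ ∀ n k : ℕ, 1 ≤ n → k ≤ n → |(k : ℝ) / n - a| ≤ ε →
      |√(n : ℝ) * ((n.choose k : ℝ) * Real.exp (-(n * Real.binEntropy (k / n))))
        - (√(2 * Real.pi * (a * (1 - a))))⁻¹| ≤ C * (|(k : ℝ) / n - a| + 1 / n) := by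
  obtain ⟨η, hη, hη0, hη1⟩ : ∃ η : ℝ, 0 < η ∧ η ≤ a - ε ∧ η ≤ 1 - (a + ε) :=
    ⟨min (a - ε) (1 - (a + ε)), lt_min h0 (by linarith), min_le_left _ _, min_le_right _ _⟩
  have hηa : η ≤ a := by linarith
  have hηa' : η ≤ 1 - a := by linarith
  set G : ℝ := (√(2 * Real.pi * (a * (1 - a))))⁻¹ with hG
  have ha : 0 < a := by linarith
  have ha' : 0 < 1 - a := by linarith
  have hGexp : G = Real.exp (-(Real.log (2 * Real.pi) / 2) - Real.log a / 2 -
      Real.log (1 - a) / 2) := by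
    rw [hG, ← Real.exp_log (by positivity : 0 < (√(2 * Real.pi * (a * (1 - a))))⁻¹), Real.log_inv,
      Real.log_sqrt (by positivity), Real.log_mul (by positivity) (by positivity),
      Real.log_mul ha.ne' ha'.ne']
    congr 1
    ring
  -- The logarithms of `x` and `1 - x` are `1 / η`-Lipschitz on `[η, ∞)`, and the three Stirling
  -- remainders are at most `1 / (12 n)` or `1 / (12 η n)`; `K` covers them all. The factor `exp (2
  -- * K)` bounds the exponential, since `|x - a| + 1 / n ≤ 2`.
  set K : ℝ := 1 / η + 1
  have hK : 0 < K := by positivity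
  refine ⟨K * (G * Real.exp (2 * K)), by positivity, ?_⟩
  intro n k hn hkn hx
  have hnp : (0 : ℝ) < n := by exact_mod_cast hn
  set x : ℝ := (k : ℝ) / n with hxdef
  obtain ⟨hxl, hxu⟩ := abs_le.1 hx
  have hxη : η ≤ x := by linarith
  have hxη' : η ≤ 1 - x := by linarith
  have hk0 : 0 < k := by
    rcases Nat.eq_zero_or_pos k with rfl | h
    · simp [hxdef] at hxη; linarith
    · exact h
  have hkn' : k < n := by
    rcases hkn.eq_or_lt with rfl | h
    · rw [hxdef, div_self hnp.ne'] at hxη'; linarith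
    · exact h
  have hk' : (0 : ℝ) < k := by exact_mod_cast hk0
  have hnk : (0 : ℝ) < (n - k : ℕ) := by exact_mod_cast (by omega : 0 < n - k)
  have hc : ((n - k : ℕ) : ℝ) = n - k := by rw [Nat.cast_sub hkn'.le]
  have hkx : (k : ℝ) = n * x := by rw [hxdef]; field_simp
  have hnkx : ((n - k : ℕ) : ℝ) = n * (1 - x) := by rw [hc, hkx]; ring
  obtain ⟨θ, hθ0, hθ1, hθ⟩ := log_factorial_eq hn
  obtain ⟨θk, hθk0, hθk1, hθk⟩ := log_factorial_eq hk0
  obtain ⟨θr, hθr0, hθr1, hθr⟩ := log_factorial_eq (by omega : 1 ≤ n - k)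
  have hchoose : (n.choose k : ℝ) * (k.factorial * (n - k).factorial) = n.factorial := by
    rw [← mul_assoc]; exact_mod_cast Nat.choose_mul_factorial_mul_factorial hkn'.le
  have hCpos : (0 : ℝ) < n.choose k := by exact_mod_cast Nat.choose_pos hkn'.le
  have hlog : Real.log (n.choose k) + (Real.log k.factorial + Real.log (n - k).factorial)
      = Real.log n.factorial := by
    rw [← hchoose, Real.log_mul hCpos.ne' (by positivity), Real.log_mul (by positivity)
      (by positivity)]
  have hx0 : 0 < x := by linarith
  have hx1 : 0 < 1 - x := by linarith
  -- The powers of `n` cancel against `√n` and the entropy against the main terms of Stirling's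
  -- formula; only the remainders and the logarithms of `x` and `1 - x` are left.
  have hval : √(n : ℝ) * ((n.choose k : ℝ) * Real.exp (-(n * Real.binEntropy (k / n))))
      = Real.exp (θ - θk - θr - Real.log (2 * Real.pi) / 2 - Real.log x / 2
        - Real.log (1 - x) / 2) := by
    rw [mul_binEntropy_div hk0 hkn', ← Real.exp_log (by positivity : 0 < √(n : ℝ)),
      ← Real.exp_log hCpos, ← Real.exp_add, ← Real.exp_add,
      Real.log_sqrt hnp.le]
    congr 1
    have e1 : Real.log (n.choose k) = Real.log n.factorial
      - (Real.log k.factorial + Real.log (n - k).factorial) := by linarith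
    rw [e1, hθ, hθk, hθr, Real.log_mul two_ne_zero hnp.ne', Real.log_mul two_ne_zero hk'.ne',
      Real.log_mul two_ne_zero hnk.ne', Real.log_mul two_ne_zero Real.pi_pos.ne', hc]
    have e2 : Real.log (k : ℝ) = Real.log n + Real.log x := by
      rw [hkx, Real.log_mul hnp.ne' hx0.ne']
    have e3 : Real.log ((n : ℝ) - k) = Real.log n + Real.log (1 - x) := by
      rw [← hc, hnkx, Real.log_mul hnp.ne' hx1.ne']
    rw [e2, e3]
    ring
  have hlogx := abs_log_sub_log_le hη hxη hηa
  have hlogx' := abs_log_sub_log_le hη hxη' hηa'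
  rw [show 1 - x - (1 - a) = -(x - a) by ring, abs_neg] at hlogx'
  have hθb : |θ - θk - θr| ≤ K * (1 / n) := by
    have b1 : 1 / (12 * (k : ℝ)) ≤ 1 / 12 * (1 / η) * (1 / n) := by
      rw [hkx, ← one_div_mul_one_div, ← one_div_mul_one_div, mul_comm (1 / (n : ℝ)), ← mul_assoc]
      have := one_div_le_one_div_of_le hη hxη
      gcongr
    have b2 : 1 / (12 * ((n - k : ℕ) : ℝ)) ≤ 1 / 12 * (1 / η) * (1 / n) := by
      rw [hnkx, ← one_div_mul_one_div, ← one_div_mul_one_div, mul_comm (1 / (n : ℝ)), ← mul_assoc]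
      have := one_div_le_one_div_of_le hη hxη'
      gcongr
    have b0 : 1 / (12 * (n : ℝ)) = 1 / 12 * (1 / n) := by rw [← one_div_mul_one_div]
    have p1 : 0 ≤ 1 / (n : ℝ) := by positivity
    have p2 : 0 ≤ 1 / η * (1 / (n : ℝ)) := by positivity
    have e : K * (1 / n) = 1 / η * (1 / (n : ℝ)) + 1 / n := by simp only [K]; ring
    rw [e, abs_le]
    constructor <;> linarith
  have hdiff : |(θ - θk - θr - Real.log (2 * Real.pi) / 2 - Real.log x / 2 - Real.log (1 - x) / 2)
      - (-(Real.log (2 * Real.pi) / 2) - Real.log a / 2 - Real.log (1 - a) / 2)|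
      ≤ K * (|x - a| + 1 / n) := by
    have e : K * (|x - a| + 1 / n) = |x - a| / η + |x - a| + K * (1 / n) := by
      simp only [K]; ring
    have := abs_nonneg (x - a)
    rw [e]
    rw [abs_le] at hθb hlogx hlogx' ⊢
    constructor <;> linarith [hθb.1, hθb.2, hlogx.1, hlogx.2, hlogx'.1, hlogx'.2]
  rw [hval, hGexp]
  refine (abs_exp_sub_exp_le _ _).trans ?_
  rw [mul_right_comm, ← Real.exp_add]
  refine mul_le_mul hdiff (Real.exp_le_exp.2 ?_) (Real.exp_pos _).le (by positivity)
  have hxle : |x - a| ≤ 1 := by rw [abs_le]; constructor <;> linarith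
  have hn1 : 1 / (n : ℝ) ≤ 1 := by
    rw [div_le_one hnp]; exact_mod_cast hn
  have : K * (|x - a| + 1 / n) ≤ K * 2 := mul_le_mul_of_nonneg_left (by linarith) hK.le
  have h2 := (abs_le.1 hdiff).2
  exact max_le (by linarith) (by linarith)

end PSpin

/-! ### Taylor expansions and derivatives of the free energy -/

namespace PSpin

/-- Taylor's theorem around an interior point of `[0, 1]`, with a bound on all of `[0, 1]`. -/
theorem exists_taylor_bound_Icc {A : ℝ → ℝ} {N : ℕ} (hc : ContinuousOn A (Set.Icc 0 1))
    (hA : ContDiffOn ℝ (N + 1 : ℕ) A (Set.Ioo 0 1)) {a : ℝ} (ha : a ∈ Set.Ioo (0 : ℝ) 1) :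
    ∃ C : ℝ, 0 ≤ C ∧ ∀ x ∈ Set.Icc (0 : ℝ) 1,
      |A x - ∑ k ∈ Finset.range (N + 1), iteratedDeriv k A a / k.factorial * (x - a) ^ k|
        ≤ C * |x - a| ^ (N + 1) := by
  have hT := taylor_isLittleO (convex_Ioo (0 : ℝ) 1) ha hA
  rw [isOpen_Ioo.nhdsWithin_eq ha] at hT
  have hsum : ∀ x, taylorWithinEval A (N + 1) (Set.Ioo 0 1) a x
      = ∑ k ∈ Finset.range (N + 2), iteratedDeriv k A a / k.factorial * (x - a) ^ k := by
    intro x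
    rw [taylor_within_apply]
    refine Finset.sum_congr rfl fun k _ => ?_
    rw [iteratedDerivWithin_of_isOpen isOpen_Ioo ha, smul_eq_mul]
    ring
  set P : ℝ → ℝ := fun x =>
    ∑ k ∈ Finset.range (N + 1), iteratedDeriv k A a / k.factorial * (x - a) ^ k with hP
  have hPc : Continuous P := by fun_prop
  -- Taylor's theorem with little-o remainder is used at order `N + 1`; its last term is `O((x - a)
  -- ^ (N + 1))` and joins the remainder. Away from `a` compactness bounds the difference, at the
  -- price of `ε ^ (N + 1)` in the denominator.
  have hO : (fun x => A x - P x) =O[𝓝 a] fun x => (x - a) ^ (N + 1) := by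
    have h2 : (fun x => iteratedDeriv (N + 1) A a / (N + 1).factorial * (x - a) ^ (N + 1))
        =O[𝓝 a] fun x => (x - a) ^ (N + 1) := Asymptotics.isBigO_const_mul_self _ _ _
    refine (hT.isBigO.add h2).congr_left fun x => ?_
    rw [hsum, Finset.sum_range_succ _ (N + 1)]
    simp only [hP]
    ring
  obtain ⟨C₁, hC₁⟩ := hO.bound
  obtain ⟨ε, hε, hball⟩ := Metric.eventually_nhds_iff.1 hC₁
  obtain ⟨K, hK⟩ := isCompact_Icc.exists_bound_of_continuousOn (hc.sub hPc.continuousOn)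
  have hK0 : 0 ≤ K := (norm_nonneg _).trans (hK a ⟨ha.1.le, ha.2.le⟩)
  refine ⟨max C₁ (K / ε ^ (N + 1)), le_max_of_le_right (by positivity), fun x hx => ?_⟩
  by_cases hxa : dist x a < ε
  · have := hball hxa
    rw [Real.norm_eq_abs, Real.norm_eq_abs, abs_pow] at this
    exact this.trans (mul_le_mul_of_nonneg_right (le_max_left _ _) (by positivity))
  · rw [not_lt, Real.dist_eq] at hxa
    have h1 := hK x hx
    rw [Real.norm_eq_abs] at h1
    calc |A x - P x| ≤ K := h1
      _ = K / ε ^ (N + 1) * ε ^ (N + 1) := by field_simp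
      _ ≤ max C₁ (K / ε ^ (N + 1)) * |x - a| ^ (N + 1) := by
        gcongr
        exact le_max_right _ _

theorem contDiff_energy (p : ℕ) (β h : ℝ) {n : WithTop ℕ∞} : ContDiff ℝ n (energy p β h) := by
  unfold energy; fun_prop

theorem continuous_freeEnergy (p : ℕ) (β h : ℝ) : Continuous (freeEnergy p β h) := by
  have := (contDiff_energy p β h (n := 0)).continuous
  unfold freeEnergy; fun_prop

theorem contDiffOn_freeEnergy (p : ℕ) (β h : ℝ) {n : WithTop ℕ∞} :
    ContDiffOn ℝ n (freeEnergy p β h) (Set.Ioo 0 1) := by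
  intro x hx
  have h1 : x ≠ 0 := hx.1.ne'
  have h2 : 1 - x ≠ 0 := by linarith [hx.2]
  refine ContDiffAt.contDiffWithinAt ?_
  refine (contDiff_energy p β h).contDiffAt.add ?_
  unfold Real.binEntropy
  refine ContDiffAt.add (contDiffAt_id.mul ((contDiffAt_id.inv h1).log (inv_ne_zero h1))) ?_
  have h3 : ContDiffAt ℝ n (fun y : ℝ => 1 - y) x := contDiffAt_const.sub contDiffAt_id
  exact h3.mul ((h3.inv h2).log (inv_ne_zero h2))

section Derivatives

variable (p : ℕ) (β h : ℝ) {x : ℝ}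

theorem hasDerivAt_two_mul_sub_one_pow (k : ℕ) (x : ℝ) :
    HasDerivAt (fun y : ℝ => (2 * y - 1) ^ k) (2 * k * (2 * x - 1) ^ (k - 1)) x := by
  have h1 : HasDerivAt (fun y : ℝ => 2 * y - 1) 2 x := by
    simpa using ((hasDerivAt_id x).const_mul (2 : ℝ)).sub_const 1
  exact (h1.pow k).congr_deriv (by ring)

theorem iteratedDeriv_one_freeEnergy (hx : x ∈ Set.Ioo (0 : ℝ) 1) :
    iteratedDeriv 1 (freeEnergy p β h) x
      = 2 * β * p * (2 * x - 1) ^ (p - 1) + 2 * h + (Real.log (1 - x) - Real.log x) := by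
  rw [iteratedDeriv_one]
  have h1 := (hasDerivAt_two_mul_sub_one_pow p x).const_mul β
  have h2 := (hasDerivAt_two_mul_sub_one_pow 1 x).const_mul h
  have h3 := Real.hasDerivAt_binEntropy hx.1.ne' hx.2.ne
  have h4 := ((h1.add h2).add h3).deriv
  simp only [pow_one] at h4
  refine Eq.trans (congrArg (fun f => deriv f x) ?_) (h4.trans ?_)
  · rfl
  · simp; ring

/-- A formula valid only on the open interval may still be differentiated there; each derivative of
the free energy is obtained from the preceding one in this way. -/
theorem iteratedDeriv_succ_of_eqOn {f g : ℝ → ℝ} {k : ℕ} {g' : ℝ}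
    (hfg : ∀ y ∈ Set.Ioo (0 : ℝ) 1, iteratedDeriv k f y = g y) (hx : x ∈ Set.Ioo (0 : ℝ) 1)
    (hg : HasDerivAt g g' x) : iteratedDeriv (k + 1) f x = g' := by
  rw [iteratedDeriv_succ]
  have : iteratedDeriv k f =ᶠ[𝓝 x] g :=
    Filter.eventuallyEq_of_mem (isOpen_Ioo.mem_nhds hx) hfg
  rw [this.deriv_eq, hg.deriv]

/-- The truncated exponents are harmless: when `p - 2` truncates, the coefficient `p * (p - 1)` is
zero. The same holds for the third and fourth derivatives. -/
theorem iteratedDeriv_two_freeEnergy (hx : x ∈ Set.Ioo (0 : ℝ) 1) :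
    iteratedDeriv 2 (freeEnergy p β h) x
      = 4 * β * p * (p - 1 : ℕ) * (2 * x - 1) ^ (p - 2) - (x⁻¹ + (1 - x)⁻¹) := by
  refine iteratedDeriv_succ_of_eqOn (fun y hy => iteratedDeriv_one_freeEnergy p β h hy) hx ?_
  have h1 := (hasDerivAt_two_mul_sub_one_pow (p - 1) x).const_mul (2 * β * p)
  have h0 : HasDerivAt (fun y : ℝ => 1 - y) (-1) x := by
    simpa using (hasDerivAt_id x).const_sub 1
  have h2 := (h0.log (by linarith [hx.2])).sub (Real.hasDerivAt_log hx.1.ne')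
  refine ((h1.add_const (2 * h)).add h2).congr_deriv ?_
  rw [Nat.sub_sub]
  ring

theorem iteratedDeriv_three_freeEnergy (hx : x ∈ Set.Ioo (0 : ℝ) 1) :
    iteratedDeriv 3 (freeEnergy p β h) x
      = 8 * β * p * (p - 1 : ℕ) * (p - 2 : ℕ) * (2 * x - 1) ^ (p - 3)
        + ((x ^ 2)⁻¹ - ((1 - x) ^ 2)⁻¹) := by
  refine iteratedDeriv_succ_of_eqOn (fun y hy => iteratedDeriv_two_freeEnergy p β h hy) hx ?_
  have h1 := (hasDerivAt_two_mul_sub_one_pow (p - 2) x).const_mul (4 * β * p * (p - 1 : ℕ))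
  have h0 : HasDerivAt (fun y : ℝ => 1 - y) (-1) x := by
    simpa using (hasDerivAt_id x).const_sub 1
  have h2 := (hasDerivAt_inv hx.1.ne').add (h0.inv (by linarith [hx.2]))
  refine (h1.sub h2).congr_deriv ?_
  rw [Nat.sub_sub]
  ring

theorem iteratedDeriv_four_freeEnergy (hx : x ∈ Set.Ioo (0 : ℝ) 1) :
    iteratedDeriv 4 (freeEnergy p β h) x
      = 16 * β * p * (p - 1 : ℕ) * (p - 2 : ℕ) * (p - 3 : ℕ) * (2 * x - 1) ^ (p - 4)
        - 2 * ((x ^ 3)⁻¹ + ((1 - x) ^ 3)⁻¹) := by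
  refine iteratedDeriv_succ_of_eqOn (fun y hy => iteratedDeriv_three_freeEnergy p β h hy) hx ?_
  have hx1 : x ≠ 0 := hx.1.ne'
  have hx2 : 1 - x ≠ 0 := by linarith [hx.2]
  have h1 := (hasDerivAt_two_mul_sub_one_pow (p - 3) x).const_mul
    (8 * β * p * (p - 1 : ℕ) * (p - 2 : ℕ))
  have h0 : HasDerivAt (fun y : ℝ => 1 - y) (-1) x := by
    simpa using (hasDerivAt_id x).const_sub 1
  have h2 := ((hasDerivAt_pow 2 x).inv (by positivity)).sub
    ((h0.pow 2).inv (pow_ne_zero 2 hx2))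
  refine (h1.add h2).congr_deriv ?_
  rw [Nat.sub_sub]
  simp only [Pi.pow_apply]
  field_simp
  ring

end Derivatives

/-- The leading Taylor coefficient at an interior maximum. -/
theorem leading_coeff_mul_nonpos {A : ℝ → ℝ} {a c C σ : ℝ} {k : ℕ} (ha : a ∈ Set.Ioo (0 : ℝ) 1)
    (hmax : IsMaxOn A (Set.Icc 0 1) a) (hC : 0 ≤ C) (hσ : |σ| = 1)
    (hT : ∀ x ∈ Set.Icc (0 : ℝ) 1, |A x - A a - c * (x - a) ^ k| ≤ C * |x - a| ^ (k + 1)) :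
    c * σ ^ k ≤ 0 := by
  by_contra! hpos
  set q := c * σ ^ k
  -- The step `s` keeps `a + σ * s` in `[0, 1]` and makes `C * s < q`, so the remainder cannot
  -- compensate the positive leading term `q * s ^ k`.
  obtain ⟨s, hs, hsa, hsb, hsq⟩ : ∃ s : ℝ, 0 < s ∧ s ≤ a ∧ s ≤ 1 - a ∧ s < q / (C + 1) := by
    have h1 : 0 < q / (C + 1) := by positivity
    refine ⟨min (min a (1 - a)) (q / (C + 1) / 2), ?_, ?_, ?_, ?_⟩
    · exact lt_min (lt_min ha.1 (by linarith [ha.2])) (by positivity)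
    · exact (min_le_left _ _).trans (min_le_left _ _)
    · exact (min_le_left _ _).trans (min_le_right _ _)
    · exact (min_le_right _ _).trans_lt (by linarith)
  have hσs : |σ * s| = s := by rw [abs_mul, hσ, one_mul, abs_of_pos hs]
  have hx : a + σ * s ∈ Set.Icc (0 : ℝ) 1 := by
    have := abs_le.1 hσs.le
    constructor <;> linarith
  have h1 := hT _ hx
  have h2 : A (a + σ * s) ≤ A a := hmax hx
  rw [add_sub_cancel_left, hσs, mul_pow, ← mul_assoc] at h1
  have h3 := (abs_le.1 h1).1
  have h4 : q * s ^ k ≤ C * s * s ^ k := by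
    have : C * s ^ (k + 1) = C * s * s ^ k := by ring
    linarith
  have h5 : q ≤ C * s := le_of_mul_le_mul_right h4 (by positivity)
  rw [lt_div_iff₀ (by positivity)] at hsq
  nlinarith

theorem exists_taylor_bound_freeEnergy {p m : ℕ} {β h a : ℝ}
    (ha : a ∈ Set.Ioo (0 : ℝ) 1) (hr : ∀ k, 1 ≤ k → k < 2 * m →
      iteratedDeriv k (freeEnergy p β h) a = 0) {j : ℕ} (hj : 1 ≤ j) (hjm : j ≤ 2 * m) :
    ∃ C : ℝ, 0 ≤ C ∧ ∀ x ∈ Set.Icc (0 : ℝ) 1, |freeEnergy p β h x - freeEnergy p β h a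
      - iteratedDeriv j (freeEnergy p β h) a / j.factorial * (x - a) ^ j|
        ≤ C * |x - a| ^ (j + 1) := by
  obtain ⟨C, hC, hT⟩ := exists_taylor_bound_Icc (N := j)
    (continuous_freeEnergy p β h).continuousOn (contDiffOn_freeEnergy p β h) ha
  refine ⟨C, hC, fun x hx => ?_⟩
  have h1 := hT x hx
  obtain ⟨i, rfl⟩ : ∃ i, j = i + 1 := ⟨j - 1, by omega⟩
  rw [Finset.sum_range_succ, Finset.sum_range_succ', Finset.sum_eq_zero] at h1
  · simpa [sub_sub] using h1
  · intro k hk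
    rw [hr (k + 1) (by omega) (by have := Finset.mem_range.1 hk; omega)]
    simp

end PSpin

/-! ### Interior maximizers and degenerate maximizers -/

namespace PSpin

/-- Reflection exchanges the endpoints, so only `0` needs an estimate. The new coupling `(-1) ^ p *
β` may be negative, which is why that estimate puts no sign on `β`. -/
theorem freeEnergy_one_sub (p : ℕ) (β h x : ℝ) :
    freeEnergy p β h (1 - x) = freeEnergy p ((-1) ^ p * β) (-h) x := by
  have e : 2 * (1 - x) - 1 = (-1) * (2 * x - 1) := by ring
  simp only [freeEnergy, energy, Real.binEntropy_one_sub, e, mul_pow]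
  ring

/-- The entropy has infinite slope at `0` while the energy is `K`-Lipschitz: at `x = exp (-(K + 1))`
the entropy is at least `(K + 1) * x`, more than the possible loss `K * x`. -/
theorem exists_freeEnergy_zero_lt (p : ℕ) (β h : ℝ) :
    ∃ x ∈ Set.Icc (0 : ℝ) 1, freeEnergy p β h 0 < freeEnergy p β h x := by
  obtain ⟨K, hK⟩ := (contDiff_energy p β h (n := 1)).contDiffOn.exists_lipschitzOnWith
    (s := Set.Icc (0 : ℝ) 1) one_ne_zero (convex_Icc 0 1) isCompact_Icc
  set x := Real.exp (-(K + 1)) with hx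
  have hx0 : 0 < x := Real.exp_pos _
  have hx1 : x < 1 := by
    rw [hx, Real.exp_lt_one_iff]
    have := K.2
    simp only [NNReal.val_eq_coe] at this
    linarith
  refine ⟨x, ⟨hx0.le, hx1.le⟩, ?_⟩
  have h1 := hK.dist_le_mul x ⟨hx0.le, hx1.le⟩ 0 ⟨le_rfl, zero_le_one⟩
  rw [Real.dist_eq, Real.dist_eq, sub_zero, abs_of_pos hx0] at h1
  have h2 := (abs_le.1 h1).1
  have h3 : (K + 1) * x ≤ Real.binEntropy x := by
    have hl : Real.log x⁻¹ = K + 1 := by rw [Real.log_inv, hx, Real.log_exp]; ring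
    have : 0 ≤ (1 - x) * Real.log (1 - x)⁻¹ := by
      refine mul_nonneg (by linarith) (Real.log_nonneg ?_)
      exact (one_le_inv₀ (by linarith)).2 (by linarith)
    rw [Real.binEntropy, hl]
    linarith
  simp only [freeEnergy, Real.binEntropy_zero]
  linarith

theorem maximizers_subset_Ioo (p : ℕ) (β h : ℝ) : maximizers p β h ⊆ Set.Ioo 0 1 := by
  rintro a ⟨ha, hmax⟩
  refine ⟨lt_of_le_of_ne ha.1 ?_, lt_of_le_of_ne ha.2 ?_⟩
  · rintro rfl
    obtain ⟨x, hx, hlt⟩ := exists_freeEnergy_zero_lt p β h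
    exact absurd (hmax hx) (not_le.2 hlt)
  · rintro rfl
    obtain ⟨x, hx, hlt⟩ := exists_freeEnergy_zero_lt p ((-1) ^ p * β) (-h)
    rw [← freeEnergy_one_sub, ← freeEnergy_one_sub, sub_zero] at hlt
    exact absurd (hmax (show 1 - x ∈ Set.Icc (0 : ℝ) 1 from ⟨by linarith [hx.2], by linarith [hx.1]⟩))
      (not_le.2 hlt)

section

variable {p : ℕ} {β h a : ℝ}

theorem iteratedDeriv_one_eq_zero_of_mem_maximizers (ha : a ∈ maximizers p β h) :
    iteratedDeriv 1 (freeEnergy p β h) a = 0 := by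
  have hI := maximizers_subset_Ioo p β h ha
  rw [iteratedDeriv_one]
  exact (ha.2.isLocalMax (Icc_mem_nhds hI.1 hI.2)).deriv_eq_zero

theorem iteratedDeriv_two_nonpos_of_mem_maximizers (ha : a ∈ maximizers p β h) :
    iteratedDeriv 2 (freeEnergy p β h) a ≤ 0 := by
  have hI := maximizers_subset_Ioo p β h ha
  obtain ⟨C, hC, hT⟩ := exists_taylor_bound_freeEnergy (p := p) (β := β) (h := h) (m := 1) hI
    (fun k h1 h2 => by
      obtain rfl : k = 1 := by omega
      exact iteratedDeriv_one_eq_zero_of_mem_maximizers ha) (j := 2) (by norm_num) (by norm_num)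
  have := leading_coeff_mul_nonpos (σ := 1) hI ha.2 hC (by simp) hT
  simp only [one_pow, mul_one, Nat.factorial_two, Nat.cast_ofNat] at this
  linarith

theorem isRegular_one_of_ne_zero (ha : a ∈ maximizers p β h)
    (h2 : iteratedDeriv 2 (freeEnergy p β h) a ≠ 0) : IsRegular (freeEnergy p β h) 1 a := by
  refine ⟨fun k h1 h2 => ?_, lt_of_le_of_ne (iteratedDeriv_two_nonpos_of_mem_maximizers ha) h2⟩
  obtain rfl : k = 1 := by omega
  exact iteratedDeriv_one_eq_zero_of_mem_maximizers ha

/-- A nonzero cubic term would push the function above its maximum on one side of the point; the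
directions `1` and `-1` give the two inequalities. -/
theorem iteratedDeriv_three_eq_zero (ha : a ∈ maximizers p β h)
    (h2 : iteratedDeriv 2 (freeEnergy p β h) a = 0) :
    iteratedDeriv 3 (freeEnergy p β h) a = 0 := by
  have hI := maximizers_subset_Ioo p β h ha
  have hlow : ∀ k, 1 ≤ k → k < 3 → iteratedDeriv k (freeEnergy p β h) a = 0 := by
    intro k hk1 hk2
    interval_cases k
    · exact iteratedDeriv_one_eq_zero_of_mem_maximizers ha
    · exact h2
  obtain ⟨C, hC, hT⟩ := exists_taylor_bound_Icc (N := 3)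
    (continuous_freeEnergy p β h).continuousOn (contDiffOn_freeEnergy p β h) hI
  have hT' : ∀ x ∈ Set.Icc (0 : ℝ) 1, |freeEnergy p β h x - freeEnergy p β h a
      - iteratedDeriv 3 (freeEnergy p β h) a / 6 * (x - a) ^ 3| ≤ C * |x - a| ^ (3 + 1) := by
    intro x hx
    have := hT x hx
    simp only [Finset.sum_range_succ, Finset.sum_range_zero, hlow 1 le_rfl (by norm_num),
      hlow 2 (by norm_num) (by norm_num)] at this
    simpa [sub_sub, Nat.factorial] using this
  have h1 := leading_coeff_mul_nonpos (σ := 1) hI ha.2 hC (by simp) hT'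
  have h3 := leading_coeff_mul_nonpos (σ := -1) hI ha.2 hC (by simp) hT'
  norm_num at h1 h3
  linarith

/-- The algebraic relations at a point where the second and third derivatives vanish. -/
theorem degenerate_relations (hI : a ∈ Set.Ioo (0 : ℝ) 1)
    (h2 : iteratedDeriv 2 (freeEnergy p β h) a = 0)
    (h3 : iteratedDeriv 3 (freeEnergy p β h) a = 0) :
    ∃ r : ℕ, p = r + 2 ∧ ((r : ℝ) + 2) * (2 * a - 1) ^ 2 = r ∧
      β * (r + 2) * (r + 1) * (2 * a - 1) ^ r * (1 - (2 * a - 1) ^ 2) = 1 := by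
  rw [iteratedDeriv_two_freeEnergy p β h hI] at h2
  rw [iteratedDeriv_three_freeEnergy p β h hI] at h3
  have ha0 : 0 < a := hI.1
  have ha1 : 0 < 1 - a := by linarith [hI.2]
  have hp : 2 ≤ p := by
    by_contra! hp
    have : p - 1 = 0 := by omega
    rw [this] at h2
    have : 0 < a⁻¹ + (1 - a)⁻¹ := by positivity
    norm_num at h2
    linarith
  obtain ⟨r, rfl⟩ : ∃ r, p = r + 2 := ⟨p - 2, by omega⟩
  rw [show r + 2 - 1 = r + 1 by omega, show r + 2 - 2 = r by omega] at h2 h3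
  rw [show r + 2 - 3 = r - 1 by omega] at h3
  push_cast at h2 h3
  have hT : β * (r + 2) * (r + 1) * (2 * a - 1) ^ r * (1 - (2 * a - 1) ^ 2) = 1 := by
    field_simp at h2
    linear_combination h2
  refine ⟨r, rfl, ?_, hT⟩
  have hr : (r : ℝ) * (2 * a - 1) ^ (r - 1) * (2 * a - 1) = r * (2 * a - 1) ^ r := by
    cases r with
    | zero => simp
    | succ r => rw [Nat.add_sub_cancel, mul_assoc, ← pow_succ]
  -- The third-derivative equation times `2 * a - 1`, which restores the exponent `r`. As `4 a (1 -
  -- a) = 1 - (2 a - 1) ^ 2`, the second-derivative relation `hT` then eliminates `β`.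
  have e3 : (8 * β * (r + 2) * (r + 1) * r * (2 * a - 1) ^ r) * (a ^ 2 * (1 - a) ^ 2)
      - (2 * a - 1) ^ 2 = 0 := by
    field_simp at h3
    linear_combination (2 * a - 1) * h3 - 8 * β * (r + 2) * (r + 1) * (a ^ 2 * (1 - a) ^ 2) * hr
  linear_combination -2 * e3 + r * (1 - (2 * a - 1) ^ 2) * hT

/-- With `u = 2 a - 1`, the relations give `u ^ 2 = r / (r + 2)` and eliminate `β`; the fourth
derivative times `u ^ 2` becomes `-8 r (r + 2) ^ 2`. For `r = 0` that product carries no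
information, but there the polynomial part has coefficient zero. -/
theorem iteratedDeriv_four_neg_of_degenerate (hI : a ∈ Set.Ioo (0 : ℝ) 1)
    (h2 : iteratedDeriv 2 (freeEnergy p β h) a = 0)
    (h3 : iteratedDeriv 3 (freeEnergy p β h) a = 0) :
    iteratedDeriv 4 (freeEnergy p β h) a < 0 := by
  obtain ⟨r, rfl, hu, hT⟩ := degenerate_relations hI h2 h3
  rw [iteratedDeriv_four_freeEnergy _ β h hI]
  have ha0 : 0 < a := hI.1
  have ha1 : 0 < 1 - a := by linarith [hI.2]
  have hpos : 0 < 2 * ((a ^ 3)⁻¹ + ((1 - a) ^ 3)⁻¹) := by positivity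
  rw [show r + 2 - 1 = r + 1 by omega, show r + 2 - 2 = r by omega,
    show r + 2 - 3 = r - 1 by omega, show r + 2 - 4 = r - 2 by omega]
  rcases Nat.eq_zero_or_pos r with rfl | hr
  · simp only [Nat.cast_zero, mul_zero, zero_mul, zero_sub]
    linarith
  set u := 2 * a - 1 with hudef
  have hrpos : (0 : ℝ) < r := by exact_mod_cast hr
  have hu2 : 0 < u ^ 2 := by
    by_contra! hle
    have : u ^ 2 = 0 := le_antisymm hle (sq_nonneg u)
    rw [this] at hu
    linarith
  have hr' : (((r - 1 : ℕ)) : ℝ) * u ^ (r - 2) * u ^ 2 = (r - 1) * u ^ r := by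
    rcases Nat.eq_or_lt_of_le hr with h1 | h1
    · simp [← h1]
    · obtain ⟨i, rfl⟩ : ∃ i, r = i + 2 := ⟨r - 2, by omega⟩
      rw [show i + 2 - 1 = i + 1 by omega, Nat.add_sub_cancel]
      push_cast
      ring
  have e1 : a = (1 + u) / 2 := by rw [hudef]; ring
  have e2 : 1 - a = (1 - u) / 2 := by rw [hudef]; ring
  have hv : 0 < 1 - u ^ 2 := by
    have := mul_pos ha0 ha1
    rw [e2, e1] at this
    linarith
  have hinv : (a ^ 3)⁻¹ + ((1 - a) ^ 3)⁻¹ = 16 * (1 + 3 * u ^ 2) / (1 - u ^ 2) ^ 3 := by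
    have q1 : 0 < 1 + u := by linarith
    have q2 : 0 < 1 - u := by linarith
    have q3 : 1 - u ^ 2 = (1 + u) * (1 - u) := by ring
    rw [e2, e1, q3]
    field_simp
    ring
  rw [hinv]
  set S := β * (r + 2) * (r + 1) * u ^ r with hS
  have hSv : S = 1 / (1 - u ^ 2) := by rw [eq_div_iff hv.ne', hS]; exact hT
  have huv : u ^ 2 = r / (r + 2) := by rw [eq_div_iff (by positivity)]; linarith
  have key : (16 * β * ((r + 2 : ℕ) : ℝ) * ((r + 1 : ℕ) : ℝ) * r * ((r - 1 : ℕ) : ℝ) * u ^ (r - 2)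
      - 2 * (16 * (1 + 3 * u ^ 2) / (1 - u ^ 2) ^ 3)) * u ^ 2
      = 16 * r * (r - 1) * S - 32 * (1 + 3 * u ^ 2) * u ^ 2 / (1 - u ^ 2) ^ 3 := by
    push_cast
    rw [sub_mul, hS]
    linear_combination 16 * β * (r + 2) * (r + 1) * r * hr'
  have hneg : 16 * r * (r - 1) * S - 32 * (1 + 3 * u ^ 2) * u ^ 2 / (1 - u ^ 2) ^ 3 < 0 := by
    rw [hSv, huv]
    have q : 1 - (r : ℝ) / (r + 2) = 2 / (r + 2) := by field_simp; ring
    rw [q]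
    have : 16 * (r : ℝ) * (r - 1) * (1 / (2 / (r + 2)))
        - 32 * (1 + 3 * (r / (r + 2))) * (r / (r + 2)) / (2 / (r + 2)) ^ 3
        = -(8 * r * (r + 2) ^ 2) := by
      field_simp
      ring
    rw [this]
    exact neg_neg_of_pos (by positivity)
  rw [← key] at hneg
  exact neg_of_mul_neg_left hneg hu2.le

/-- With `v = 2 x - 1`, the second derivative has the sign of `β p (p - 1) v ^ r (1 - v ^ 2) - 1`.
The product `|v| ^ r (1 - v ^ 2)` is largest at `v ^ 2 = r / (r + 2)`, which is the degenerate
point, and there the expression is zero. -/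
theorem iteratedDeriv_two_nonpos_of_degenerate (hβ : 0 < β) (hI : a ∈ Set.Ioo (0 : ℝ) 1)
    (h2 : iteratedDeriv 2 (freeEnergy p β h) a = 0)
    (h3 : iteratedDeriv 3 (freeEnergy p β h) a = 0) {x : ℝ} (hx : x ∈ Set.Ioo (0 : ℝ) 1) :
    iteratedDeriv 2 (freeEnergy p β h) x ≤ 0 := by
  obtain ⟨r, rfl, hu, hT⟩ := degenerate_relations hI h2 h3
  rw [iteratedDeriv_two_freeEnergy _ β h hx]
  have hx0 : 0 < x := hx.1
  have hx1 : 0 < 1 - x := by linarith [hx.2]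
  rw [show r + 2 - 1 = r + 1 by omega, show r + 2 - 2 = r by omega]
  set u := 2 * a - 1 with hudef
  set v := 2 * x - 1 with hvdef
  have hv : 0 < 1 - v ^ 2 := by
    have : 1 - v ^ 2 = 4 * (x * (1 - x)) := by rw [hvdef]; ring
    rw [this]; positivity
  have huv : 0 < 1 - u ^ 2 := by
    have : 1 - u ^ 2 = 2 / (r + 2) := by
      rw [eq_div_iff (by positivity)]; linarith
    rw [this]; positivity
  have hur : 0 < u ^ r := by
    by_contra! hle
    have h1 : β * (r + 2) * (r + 1) * u ^ r * (1 - u ^ 2) ≤ 0 :=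
      mul_nonpos_of_nonpos_of_nonneg (mul_nonpos_of_nonneg_of_nonpos (by positivity) hle) huv.le
    linarith
  have hmain : v ^ r * (1 - v ^ 2) ≤ u ^ r * (1 - u ^ 2) := by
    rcases Nat.eq_zero_or_pos r with rfl | hr
    · have hu0 : u ^ 2 = 0 := by simpa using hu
      rw [hu0]
      simp only [pow_zero, one_mul]
      linarith [sq_nonneg v]
    have hrpos : (0 : ℝ) < r := by exact_mod_cast hr
    have hu2 : 0 < u ^ 2 := by
      by_contra! hle
      have : u ^ 2 = 0 := le_antisymm hle (sq_nonneg u)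
      rw [this] at hu
      linarith
    refine le_of_abs_le (abs_le_of_sq_le_sq ?_ (by positivity))
    -- Weighted AM-GM in the form `1 + z ≤ exp z`: the exponents for the two ratios, weighted by `r`
    -- and `2`, add up to zero.
    have hX : (v ^ 2 / u ^ 2) ^ r * ((1 - v ^ 2) / (1 - u ^ 2)) ^ 2 ≤ 1 := by
      have b1 : v ^ 2 / u ^ 2 ≤ Real.exp (v ^ 2 / u ^ 2 - 1) := by
        linarith [Real.add_one_le_exp (v ^ 2 / u ^ 2 - 1)]
      have b2 : (1 - v ^ 2) / (1 - u ^ 2) ≤ Real.exp ((1 - v ^ 2) / (1 - u ^ 2) - 1) := by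
        linarith [Real.add_one_le_exp ((1 - v ^ 2) / (1 - u ^ 2) - 1)]
      calc (v ^ 2 / u ^ 2) ^ r * ((1 - v ^ 2) / (1 - u ^ 2)) ^ 2
          ≤ Real.exp (v ^ 2 / u ^ 2 - 1) ^ r * Real.exp ((1 - v ^ 2) / (1 - u ^ 2) - 1) ^ 2 := by
            gcongr
        _ = 1 := by
          rw [← Real.exp_nat_mul, ← Real.exp_nat_mul, ← Real.exp_add, Real.exp_eq_one_iff]
          have q1 : u ^ 2 = r / (r + 2) := by rw [eq_div_iff (by positivity)]; linarith
          have q2 : 1 - u ^ 2 = 2 / (r + 2) := by rw [eq_div_iff (by positivity)]; linarith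
          rw [q2, q1]
          push_cast
          field_simp
          ring
    have e : (v ^ r * (1 - v ^ 2)) ^ 2 = ((v ^ 2 / u ^ 2) ^ r * ((1 - v ^ 2) / (1 - u ^ 2)) ^ 2)
        * (u ^ r * (1 - u ^ 2)) ^ 2 := by
      rw [div_pow, ← pow_mul, ← pow_mul, mul_comm 2 r, pow_mul, pow_mul]
      field_simp
    rw [e]
    exact mul_le_of_le_one_left (by positivity) hX
  have hb : β * (r + 2) * (r + 1) * v ^ r * (1 - v ^ 2) ≤ 1 := by
    refine le_of_le_of_eq ?_ hT
    rw [mul_assoc _ (v ^ r), mul_assoc _ (u ^ r)]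
    exact mul_le_mul_of_nonneg_left hmain (by positivity)
  have e : x⁻¹ + (1 - x)⁻¹ = 4 / (1 - v ^ 2) := by
    have : 1 - v ^ 2 = 4 * (x * (1 - x)) := by rw [hvdef]; ring
    rw [this]; field_simp; ring
  rw [e, sub_nonpos, le_div_iff₀ hv]
  push_cast
  linarith

/-- A degenerate maximizer is the only maximizer. -/
theorem maximizers_eq_singleton_of_degenerate (hβ : 0 < β) (ha : a ∈ maximizers p β h)
    (h2 : iteratedDeriv 2 (freeEnergy p β h) a = 0) : maximizers p β h = {a} := by
  have hI := maximizers_subset_Ioo p β h ha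
  have h3 := iteratedDeriv_three_eq_zero ha h2
  have hconc : ConcaveOn ℝ (Set.Icc 0 1) (freeEnergy p β h) := by
    refine concaveOn_of_deriv2_nonpos (convex_Icc 0 1) (continuous_freeEnergy p β h).continuousOn
      ?_ ?_ ?_
    · rw [interior_Icc]
      exact (contDiffOn_freeEnergy p β h (n := 1)).differentiableOn one_ne_zero
    · rw [interior_Icc]
      exact ((contDiffOn_freeEnergy p β h (n := 2)).deriv_of_isOpen isOpen_Ioo
        (m := 1) (by norm_num)).differentiableOn one_ne_zero
    · rw [interior_Icc]
      intro x hx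
      rw [← iteratedDeriv_eq_iterate]
      exact iteratedDeriv_two_nonpos_of_degenerate hβ hI h2 h3 hx
  refine Set.eq_singleton_iff_unique_mem.2 ⟨ha, fun b hb => ?_⟩
  by_contra hne
  -- By concavity the segment between two maximizers consists of maximizers.
  have hseg : ∀ s ∈ Set.Icc (0 : ℝ) 1, a + s * (b - a) ∈ maximizers p β h := by
    intro s hs
    have hmem : a + s * (b - a) ∈ Set.Icc (0 : ℝ) 1 := by
      have := (convex_Icc (0 : ℝ) 1) ha.1 hb.1 (sub_nonneg.2 hs.2) hs.1 (by ring)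
      simp only [smul_eq_mul] at this
      convert this using 1
      ring
    refine ⟨hmem, fun y hy => ?_⟩
    have h1 := hconc.2 ha.1 hb.1 (sub_nonneg.2 hs.2) hs.1 (by ring)
    simp only [smul_eq_mul] at h1
    have h4 : freeEnergy p β h y ≤ freeEnergy p β h a := ha.2 hy
    have h5 : freeEnergy p β h y ≤ freeEnergy p β h b := hb.2 hy
    have e : (1 - s) * a + s * b = a + s * (b - a) := by ring
    rw [e] at h1
    refine le_trans ?_ h1
    have := mul_le_mul_of_nonneg_left h4 (sub_nonneg.2 hs.2)
    have := mul_le_mul_of_nonneg_left h5 hs.1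
    change freeEnergy p β h y ≤ _
    linarith
  -- Inside the segment `A` is locally constant, so every point is degenerate and satisfies the
  -- relation above. A quadratic that takes one value at three equally spaced points has zero
  -- leading coefficient, which here is a multiple of `(b - a) ^ 2`.
  have hflat : ∀ s ∈ Set.Ioo (0 : ℝ) 1,
      ((p : ℝ)) * (2 * (a + s * (b - a)) - 1) ^ 2 = p - 2 := by
    intro s hs
    set z := a + s * (b - a) with hz
    have hzm : z ∈ maximizers p β h := hseg s ⟨hs.1.le, hs.2.le⟩
    have hba : b - a ≠ 0 := sub_ne_zero.2 hne
    have hev : freeEnergy p β h =ᶠ[𝓝 z] fun _ => freeEnergy p β h a := by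
      have hcont : ContinuousAt (fun w : ℝ => (w - a) / (b - a)) z := by fun_prop
      have hz' : (z - a) / (b - a) = s := by rw [hz]; field_simp; ring
      have hmem : Set.Ioo (0 : ℝ) 1 ∈ 𝓝 ((fun w : ℝ => (w - a) / (b - a)) z) := by
        simp only [hz']
        exact isOpen_Ioo.mem_nhds hs
      filter_upwards [hcont hmem] with w hw
      have hw' : w ∈ maximizers p β h := by
        have := hseg _ ⟨hw.1.le, hw.2.le⟩
        rwa [div_mul_cancel₀ _ hba, add_sub_cancel] at this
      exact le_antisymm (ha.2 hw'.1) (hw'.2 ha.1)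
    have hz2 : iteratedDeriv 2 (freeEnergy p β h) z = 0 := by
      rw [hev.iteratedDeriv_eq 2]
      simp [iteratedDeriv_const]
    obtain ⟨r, hr, hu, -⟩ := degenerate_relations (maximizers_subset_Ioo p β h hzm) hz2
      (iteratedDeriv_three_eq_zero hzm hz2)
    rw [hr]
    push_cast
    linarith
  have hp : (0 : ℝ) < p := by
    obtain ⟨r, hr, -⟩ := degenerate_relations hI h2 h3
    rw [hr]; positivity
  have f1 := hflat (1 / 4) (by norm_num)
  have f2 := hflat (1 / 2) (by norm_num)
  have f3 := hflat (3 / 4) (by norm_num)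
  have : (p : ℝ) * (b - a) ^ 2 = 0 := by linear_combination 2 * f1 - 4 * f2 + 2 * f3
  rcases mul_eq_zero.1 this with h | h
  · exact hp.ne' h
  · exact hne (sub_eq_zero.1 (pow_eq_zero_iff two_ne_zero |>.1 h))

theorem isRegular_two_of_eq_zero (ha : a ∈ maximizers p β h)
    (h2 : iteratedDeriv 2 (freeEnergy p β h) a = 0) : IsRegular (freeEnergy p β h) 2 a := by
  have h3 := iteratedDeriv_three_eq_zero ha h2
  refine ⟨fun k hk1 hk2 => ?_,
    iteratedDeriv_four_neg_of_degenerate (maximizers_subset_Ioo p β h ha) h2 h3⟩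
  have : k < 4 := hk2
  interval_cases k
  · exact iteratedDeriv_one_eq_zero_of_mem_maximizers ha
  · exact h2
  · exact h3

end

end PSpin

/-! ### Decay of the free energy away from its maximizers -/

namespace PSpin

variable {p : ℕ} {β h : ℝ}

theorem IsRegular.taylor {m : ℕ} (hm : 1 ≤ m) {a : ℝ} (ha : a ∈ Set.Ioo (0 : ℝ) 1)
    (hr : IsRegular (freeEnergy p β h) m a) :
    ∃ C : ℝ, 0 ≤ C ∧ ∀ x ∈ Set.Icc (0 : ℝ) 1, |freeEnergy p β h x - freeEnergy p β h a
      - iteratedDeriv (2 * m) (freeEnergy p β h) a / (2 * m).factorial * (x - a) ^ (2 * m)|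
        ≤ C * |x - a| ^ (2 * m + 1) :=
  exists_taylor_bound_freeEnergy ha hr.1 (by omega) le_rfl

/-- Half of the leading Taylor coefficient survives: within `-c / (2 * (C + 1))` of `a` the
remainder uses up at most the other half. -/
theorem IsRegular.eventually_le {m : ℕ} (hm : 1 ≤ m) {a : ℝ} (ha : a ∈ Set.Ioo (0 : ℝ) 1)
    (hr : IsRegular (freeEnergy p β h) m a) :
    ∃ κ : ℝ, 0 < κ ∧ ∀ᶠ x in 𝓝 a,
      freeEnergy p β h x - freeEnergy p β h a ≤ -κ * (x - a) ^ (2 * m) := by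
  obtain ⟨C, hC, hT⟩ := hr.taylor hm ha
  set c := iteratedDeriv (2 * m) (freeEnergy p β h) a / (2 * m).factorial with hc
  have hc0 : c < 0 := div_neg_of_neg_of_pos hr.2 (by positivity)
  refine ⟨-c / 2, by linarith, ?_⟩
  have hd : 0 < -c / (2 * (C + 1)) := div_pos (by linarith) (by linarith)
  filter_upwards [Icc_mem_nhds ha.1 ha.2, Metric.ball_mem_nhds a hd] with x hx hxd
  rw [Metric.mem_ball, Real.dist_eq, lt_div_iff₀ (by linarith)] at hxd
  have h1 := (abs_le.1 (hT x hx)).2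
  have hev : |x - a| ^ (2 * m) = (x - a) ^ (2 * m) := (even_two_mul m).pow_abs _
  rw [pow_succ, hev] at h1
  have hn : 0 ≤ (x - a) ^ (2 * m) := (even_two_mul m).pow_nonneg _
  have h2 : C * |x - a| ≤ -c / 2 := by nlinarith [abs_nonneg (x - a)]
  have h3 := mul_le_mul_of_nonneg_right h2 hn
  linarith

theorem isClosed_maximizers : IsClosed (maximizers p β h) := by
  have : maximizers p β h = Set.Icc 0 1 ∩ ⋂ y ∈ Set.Icc (0 : ℝ) 1,
      {a | freeEnergy p β h y ≤ freeEnergy p β h a} := by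
    ext a
    simp [maximizers, isMaxOn_iff]
  rw [this]
  exact isClosed_Icc.inter (isClosed_biInter fun y _ =>
    isClosed_le continuous_const (continuous_freeEnergy p β h))

/-- The set of maximizers is closed, so an accumulation point would be a maximizer; the quadratic
drop around it leaves no room for others. -/
theorem finite_maximizers_of_isRegular
    (hr : ∀ a ∈ maximizers p β h, IsRegular (freeEnergy p β h) 1 a) :
    (maximizers p β h).Finite := by
  by_contra hinf
  obtain ⟨x, hx, hacc⟩ := Set.Infinite.exists_accPt_of_subset_isCompact hinf
    (isCompact_Icc (a := (0 : ℝ)) (b := 1)) (fun a ha => ha.1)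
  have hxm : x ∈ maximizers p β h := 
    isClosed_maximizers.closure_eq ▸ mem_closure_iff_clusterPt.2 hacc.clusterPt
  obtain ⟨κ, hκ, hev⟩ := (hr x hxm).eventually_le le_rfl (maximizers_subset_Ioo p β h hxm)
  obtain ⟨y, ⟨hyx, hym⟩, hy⟩ := ((accPt_iff_frequently.1 hacc).and_eventually hev).exists
  have h1 : freeEnergy p β h x ≤ freeEnergy p β h y := hym.2 hxm.1
  have h2 : 0 < (y - x) ^ 2 := by
    have := sub_ne_zero.2 hyx
    positivity
  simp only [mul_one] at hy
  nlinarith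

theorem exists_mem_maximizers (p : ℕ) (β h : ℝ) : (maximizers p β h).Nonempty := by
  obtain ⟨a, ha, hmax⟩ := isCompact_Icc.exists_isMaxOn (Set.nonempty_Icc.2 zero_le_one)
    (continuous_freeEnergy p β h).continuousOn
  exact ⟨a, ha, hmax⟩

/-- The free energy drops at least like the `2m`-th power of the distance to its maximizers. -/
theorem exists_freeEnergy_le {m : ℕ} (hm : 1 ≤ m) {s : Set ℝ} (hs : s = maximizers p β h)
    (hr : ∀ a ∈ s, IsRegular (freeEnergy p β h) m a) :
    ∃ κ : ℝ, 0 < κ ∧ ∀ x ∈ Set.Icc (0 : ℝ) 1, ∃ b ∈ s,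
      freeEnergy p β h x - freeEnergy p β h b ≤ -κ * (x - b) ^ (2 * m) := by
  subst hs
  -- The property passes to subsets and to unions, so local constants suffice: the regular drop near
  -- a maximizer, and elsewhere a positive gap `η`, enough because `|y - b| ≤ 1`.
  refine isCompact_Icc.induction_on (p := fun S => ∃ κ : ℝ, 0 < κ ∧ ∀ x ∈ S,
    ∃ b ∈ maximizers p β h,
      freeEnergy p β h x - freeEnergy p β h b ≤ -κ * (x - b) ^ (2 * m)) ?_ ?_ ?_ ?_
  · exact ⟨1, one_pos, by simp⟩
  · rintro S T hST ⟨κ, hκ, hT⟩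
    exact ⟨κ, hκ, fun x hx => hT x (hST hx)⟩
  · rintro S T ⟨κ, hκ, hS⟩ ⟨κ', hκ', hT⟩
    have hpow : ∀ z : ℝ, 0 ≤ z ^ (2 * m) := fun z => (even_two_mul m).pow_nonneg z
    refine ⟨min κ κ', lt_min hκ hκ', ?_⟩
    rintro x (hx | hx)
    · obtain ⟨b, hb, hle⟩ := hS x hx
      refine ⟨b, hb, hle.trans ?_⟩
      exact mul_le_mul_of_nonneg_right (neg_le_neg (min_le_left _ _)) (hpow _)
    · obtain ⟨b, hb, hle⟩ := hT x hx
      refine ⟨b, hb, hle.trans ?_⟩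
      exact mul_le_mul_of_nonneg_right (neg_le_neg (min_le_right _ _)) (hpow _)
  · intro x hx
    by_cases hxm : x ∈ maximizers p β h
    · obtain ⟨κ, hκ, hev⟩ := (hr x hxm).eventually_le hm (maximizers_subset_Ioo p β h hxm)
      exact ⟨_, mem_nhdsWithin_of_mem_nhds hev, κ, hκ, fun y hy => ⟨x, hxm, hy⟩⟩
    · obtain ⟨b, hb⟩ := exists_mem_maximizers p β h
      have hlt : freeEnergy p β h x < freeEnergy p β h b := by
        refine lt_of_le_of_ne (hb.2 hx) fun heq => hxm ⟨hx, fun y hy => ?_⟩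
        change freeEnergy p β h y ≤ _
        rw [heq]
        exact hb.2 hy
      set η := (freeEnergy p β h b - freeEnergy p β h x) / 2 with hη
      have hη0 : 0 < η := by linarith
      have hev : ∀ᶠ y in 𝓝 x, freeEnergy p β h y < freeEnergy p β h b - η :=
        (continuous_freeEnergy p β h).continuousAt.eventually_lt_const (by linarith)
      refine ⟨_, inter_mem_nhdsWithin _ hev, η, hη0, ?_⟩
      rintro y ⟨hy, hy'⟩
      refine ⟨b, hb, ?_⟩
      have hle : (y - b) ^ (2 * m) ≤ 1 := by
        rw [← (even_two_mul m).pow_abs]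
        refine pow_le_one₀ (abs_nonneg _) (abs_le.2 ⟨?_, ?_⟩) <;> linarith [hy.1, hy.2, hb.1.1, hb.1.2]
      have hy'' : freeEnergy p β h y < freeEnergy p β h b - η := hy'
      nlinarith

theorem energy_taylor (p : ℕ) (β h : ℝ) {a : ℝ} (ha : a ∈ Set.Ioo (0 : ℝ) 1) :
    ∃ C : ℝ, 0 ≤ C ∧ ∀ x ∈ Set.Icc (0 : ℝ) 1, |energy p β h x - energy p β h a
      - deriv (energy p β h) a * (x - a)| ≤ C * |x - a| ^ 2 := by
  obtain ⟨C, hC, hT⟩ := exists_taylor_bound_Icc (N := 1)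
    (contDiff_energy p β h (n := 0)).continuous.continuousOn (contDiff_energy p β h).contDiffOn ha
  refine ⟨C, hC, fun x hx => ?_⟩
  have := hT x hx
  simpa [Finset.sum_range_succ, sub_sub, iteratedDeriv_one] using this

end PSpin

/-! ### Local limit estimates for the lattice weights -/

namespace PSpin

/-- The hypotheses of Laplace's method at the point `a`, for the main exponent `A`, the perturbation
`B` and the window `D`. -/
structure LaplaceData (m : ℕ) (A B : ℝ → ℝ) (D : Set ℝ) (a c b κ C ε : ℝ) : Prop where
  one_le : 1 ≤ m
  lower : 0 < a - ε
  upper : a + ε < 1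
  eps_pos : 0 < ε
  kappa_pos : 0 < κ
  le_neg_kappa : c ≤ -κ
  const_nonneg : 0 ≤ C
  taylorA : ∀ x ∈ Set.Icc (0 : ℝ) 1,
    |A x - A a - c * (x - a) ^ (2 * m)| ≤ C * |x - a| ^ (2 * m + 1)
  taylorB : ∀ x ∈ Set.Icc (0 : ℝ) 1, |B x - B a - b * (x - a)| ≤ C * |x - a| ^ 2
  drop : ∀ x ∈ Set.Icc (0 : ℝ) 1, x ∈ D → A x - A a ≤ -κ * (x - a) ^ (2 * m)
  mem_of_near : ∀ x ∈ Set.Icc (0 : ℝ) 1, |x - a| ≤ ε → x ∈ D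

/-- As `y ^ (2 * m) ≥ y ^ 2 - 1`, a Gaussian tail beats the linear term, and completing the square
gives the constant. Of the decay `exp (-2 * |y|)`, one half later absorbs polynomials and the other
ensures integrability. -/
theorem exists_exp_neg_pow_le {m : ℕ} (hm : 1 ≤ m) {κ : ℝ} (hκ : 0 < κ) (L : ℝ) :
    ∃ K : ℝ, 0 < K ∧ ∀ y : ℝ,
      Real.exp (-κ * y ^ (2 * m) + L * |y|) ≤ K * Real.exp (-2 * |y|) := by
  refine ⟨Real.exp (κ + (L + 2) ^ 2 / (4 * κ)), Real.exp_pos _, fun y => ?_⟩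
  rw [← Real.exp_add, Real.exp_le_exp]
  have h1 : y ^ 2 - 1 ≤ y ^ (2 * m) := by
    rw [pow_mul]
    rcases le_total (y ^ 2) 1 with h | h
    · have : 0 ≤ (y ^ 2) ^ m := by positivity
      linarith
    · have := pow_le_pow_right₀ h hm
      rw [pow_one] at this
      linarith
  have h2 : κ * (y ^ 2 - 1) ≤ κ * y ^ (2 * m) := mul_le_mul_of_nonneg_left h1 hκ.le
  have h3 : (L + 2) * |y| - κ * y ^ 2 ≤ (L + 2) ^ 2 / (4 * κ) := by
    rw [le_div_iff₀ (by positivity), ← sq_abs y]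
    nlinarith [sq_nonneg (2 * κ * |y| - (L + 2))]
  linarith

theorem one_add_abs_pow_le (N : ℕ) (y : ℝ) :
    (1 + |y|) ^ N ≤ N.factorial * Real.exp 1 * Real.exp |y| := by
  have h := Real.pow_div_factorial_le_exp (1 + |y|) (by positivity) N
  rw [div_le_iff₀ (by positivity), Real.exp_add] at h
  linarith

theorem integrable_one_add_abs_pow_mul_exp (l : ℕ) :
    Integrable fun y : ℝ => (1 + |y|) ^ l * Real.exp (-|y|) := by
  refine ((integrable_inv_one_add_sq).const_mul
    ((l + 2).factorial * Real.exp 1)).mono' ?_ (Eventually.of_forall fun y => ?_)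
  · exact (Continuous.aestronglyMeasurable (by fun_prop))
  · rw [Real.norm_of_nonneg (by positivity), ← div_eq_mul_inv, le_div_iff₀ (by positivity),
      Real.exp_neg, mul_assoc, ← div_eq_inv_mul, mul_div_assoc', div_le_iff₀ (Real.exp_pos _)]
    refine le_trans ?_ (one_add_abs_pow_le (l + 2) y)
    rw [pow_add]
    gcongr
    nlinarith [sq_abs y, abs_nonneg y]

theorem sqrt_eq_pow {m n : ℕ} {t : ℝ} (ht : 1 ≤ t) (htn : t ^ (2 * m) = n) :
    √(n : ℝ) = t ^ m := by
  rw [← htn, mul_comm, pow_mul]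
  exact Real.sqrt_sq (by positivity)

theorem le_natCast_of_pow_eq {m n : ℕ} (hm : 1 ≤ m) {t : ℝ} (ht : 1 ≤ t)
    (htn : t ^ (2 * m) = n) : t ≤ n := by
  rw [← htn]
  exact le_self_pow₀ ht (by omega)

variable {m : ℕ} {A B : ℝ → ℝ} {D : Set ℝ} {a c b κ C ε : ℝ}

/-- The Gaussian-type prefactor `1 / √(2 π a (1 - a))`. -/
noncomputable def stirlingConst (a : ℝ) : ℝ := (√(2 * Real.pi * (a * (1 - a))))⁻¹

/-- The normalized weight of `k` plus spins. -/
noncomputable def scaledWeight (A B : ℝ → ℝ) (a : ℝ) (n : ℕ) (t : ℝ) (k : ℕ) : ℝ :=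
  √(n : ℝ) * ((n.choose k : ℝ) * Real.exp (-(n * Real.binEntropy (k / n))))
    * Real.exp (n * (A (k / n) - A a) + t * (B (k / n) - B a))

theorem LaplaceData.limit_le (H : LaplaceData m A B D a c b κ C ε) :
    ∃ K : ℝ, 0 < K ∧ ∀ y : ℝ,
      Real.exp (c * y ^ (2 * m) + b * y) ≤ K * Real.exp (-2 * |y|) := by
  obtain ⟨K, hK, h⟩ := exists_exp_neg_pow_le H.one_le H.kappa_pos |b|
  refine ⟨K, hK, fun y => le_trans (Real.exp_le_exp.2 ?_) (h y)⟩
  have h1 : c * y ^ (2 * m) ≤ -κ * y ^ (2 * m) :=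
    mul_le_mul_of_nonneg_right H.le_neg_kappa ((even_two_mul m).pow_nonneg y)
  have h2 : b * y ≤ |b| * |y| := by rw [← abs_mul]; exact le_abs_self _
  linarith

/-- Near `a` this is Stirling's formula. Beyond `ε` the entropy bound yields only `√n = t ^ m`, but
there `t * ε ≤ 1 + |y|`, whence `t ^ m ≤ ((1 + |y|) / ε) ^ (m + 1) / t`: the distance pays for the
missing rate, and this dictates the power `m + 1`. -/
theorem LaplaceData.abs_choose_sub_le (H : LaplaceData m A B D a c b κ C ε) :
    ∃ K : ℝ, 0 ≤ K ∧ ∀ (n k : ℕ) (t y : ℝ), 1 ≤ n → k ≤ n → 1 ≤ t → t ^ (2 * m) = n →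
      |t * ((k : ℝ) / n - a)| ≤ 1 + |y| →
      |√(n : ℝ) * ((n.choose k : ℝ) * Real.exp (-(n * Real.binEntropy (k / n))))
        - stirlingConst a| ≤ K / t * (1 + |y|) ^ (m + 1) := by
  obtain ⟨Cs, hCs, hS⟩ := exists_abs_sqrt_mul_choose_sub_le H.lower H.upper H.eps_pos.le
  have hε := H.eps_pos
  have hG : 0 ≤ stirlingConst a := by unfold stirlingConst; positivity
  refine ⟨2 * Cs + (1 / ε ^ (m + 1) + stirlingConst a / ε), by positivity, ?_⟩
  intro n k t y hn hk ht htn hz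
  have ht0 : 0 < t := by linarith
  have hn0 : (0 : ℝ) < n := by exact_mod_cast hn
  set w := 1 + |y| with hw
  have hw1 : 1 ≤ w := by have := abs_nonneg y; linarith
  have hww : w ≤ w ^ (m + 1) := le_self_pow₀ hw1 (by omega)
  rw [abs_mul, abs_of_pos ht0] at hz
  by_cases hx : |(k : ℝ) / n - a| ≤ ε
  · have h1 : |(k : ℝ) / n - a| ≤ w / t := by rw [le_div_iff₀ ht0]; linarith
    have h2 : 1 / (n : ℝ) ≤ w / t :=
      div_le_div₀ (by linarith) hw1 ht0 (le_natCast_of_pow_eq H.one_le ht htn)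
    calc _ ≤ Cs * (|(k : ℝ) / n - a| + 1 / n) := hS n k hn hk hx
      _ ≤ Cs * (w / t + w / t) := by gcongr
      _ = 2 * Cs / t * w := by ring
      _ ≤ (2 * Cs + (1 / ε ^ (m + 1) + stirlingConst a / ε)) / t * w ^ (m + 1) := by
        gcongr
        exact le_add_of_nonneg_right (by positivity)
  · rw [not_le] at hx
    have h1 : t * ε ≤ w := (mul_le_mul_of_nonneg_left hx.le ht0.le).trans hz
    have hq0 : 0 ≤ √(n : ℝ) * ((n.choose k : ℝ) * Real.exp (-(n * Real.binEntropy (k / n)))) := by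
      positivity
    have hq1 : √(n : ℝ) * ((n.choose k : ℝ) * Real.exp (-(n * Real.binEntropy (k / n)))) ≤ t ^ m := by
      rw [← sqrt_eq_pow ht htn]
      exact mul_le_of_le_one_right (Real.sqrt_nonneg _) (choose_mul_exp_neg_binEntropy_le_one hn hk)
    have h2 : t ^ m ≤ 1 / ε ^ (m + 1) / t * w ^ (m + 1) := by
      have := pow_le_pow_left₀ (by positivity) h1 (m + 1)
      rw [mul_pow, pow_succ t] at this
      rw [div_div, div_mul_eq_mul_div, le_div_iff₀ (by positivity)]
      linarith
    have h3 : stirlingConst a ≤ stirlingConst a / ε / t * w ^ (m + 1) := by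
      rw [div_div, div_mul_eq_mul_div, le_div_iff₀ (by positivity)]
      have : t * ε ≤ w ^ (m + 1) := h1.trans hww
      have := mul_le_mul_of_nonneg_left this hG
      linarith
    have h4 : 0 ≤ 2 * Cs / t * w ^ (m + 1) := by positivity
    have e : (2 * Cs + (1 / ε ^ (m + 1) + stirlingConst a / ε)) / t * w ^ (m + 1)
        = 2 * Cs / t * w ^ (m + 1) + (1 / ε ^ (m + 1) / t * w ^ (m + 1)
          + stirlingConst a / ε / t * w ^ (m + 1)) := by ring
    rw [e, abs_le]
    constructor <;> linarith

/-- In the variable `z = t * (x - a)` the factor `n = t ^ (2 * m)` exactly rescales the leading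
term, and each Taylor remainder retains a factor `1 / t`. Moving from `z` to a point `y` within `1 /
t` of it costs the same order. -/
theorem LaplaceData.abs_exponent_sub_le (H : LaplaceData m A B D a c b κ C ε) {n : ℕ}
    {x t y : ℝ} (hx : x ∈ Set.Icc (0 : ℝ) 1) (ht : 1 ≤ t) (htn : t ^ (2 * m) = n)
    (hy : |y - t * (x - a)| ≤ 1 / t) :
    |n * (A x - A a) + t * (B x - B a) - (c * y ^ (2 * m) + b * y)|
      ≤ (2 * C + 2 * m * |c| + |b|) / t * (1 + |y|) ^ (2 * m + 1) := by
  have ht0 : 0 < t := by linarith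
  have hC := H.const_nonneg
  set z := t * (x - a) with hz
  set w := 1 + |y| with hw
  have hw1 : 1 ≤ w := by have := abs_nonneg y; linarith
  have h1t : 1 / t ≤ 1 := by rw [div_le_one ht0]; exact ht
  have hzw : |z| ≤ w := by
    have h1 : |z| ≤ |y| + |y - z| := by
      have := abs_sub_abs_le_abs_sub z y
      rw [abs_sub_comm z y] at this
      linarith
    linarith
  have hyw : |y| ≤ w := by rw [hw]; linarith
  have hxz : x - a = z / t := by rw [hz]; field_simp
  have hA := H.taylorA x hx
  have hB := H.taylorB x hx
  have hzp : |z| ^ (2 * m + 1) ≤ w ^ (2 * m + 1) := by gcongr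
  have hz2 : |z| ^ 2 ≤ w ^ (2 * m + 1) :=
    (pow_le_pow_left₀ (abs_nonneg _) hzw 2).trans
      (pow_le_pow_right₀ hw1 (by have := H.one_le; omega))
  have b1 : |n * (A x - A a) - c * z ^ (2 * m)| ≤ C / t * w ^ (2 * m + 1) := by
    have e : n * (A x - A a) - c * z ^ (2 * m)
        = t ^ (2 * m) * (A x - A a - c * (x - a) ^ (2 * m)) := by
      rw [← htn, hz, mul_pow]; ring
    rw [e, abs_mul, abs_of_pos (by positivity)]
    calc t ^ (2 * m) * |A x - A a - c * (x - a) ^ (2 * m)|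
        ≤ t ^ (2 * m) * (C * |x - a| ^ (2 * m + 1)) := by gcongr
      _ = C / t * |z| ^ (2 * m + 1) := by
        rw [hxz, abs_div, abs_of_pos ht0, div_pow, pow_succ t]
        field_simp
      _ ≤ C / t * w ^ (2 * m + 1) := by gcongr
  have b2 : |t * (B x - B a) - b * z| ≤ C / t * w ^ (2 * m + 1) := by
    have e : t * (B x - B a) - b * z = t * (B x - B a - b * (x - a)) := by rw [hz]; ring
    rw [e, abs_mul, abs_of_pos ht0]
    calc t * |B x - B a - b * (x - a)| ≤ t * (C * |x - a| ^ 2) := by gcongr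
      _ = C / t * |z| ^ 2 := by
        rw [hxz, abs_div, abs_of_pos ht0, div_pow]
        field_simp
      _ ≤ C / t * w ^ (2 * m + 1) := by gcongr
  have b3 : |c * z ^ (2 * m) - c * y ^ (2 * m)| ≤ 2 * m * |c| / t * w ^ (2 * m + 1) := by
    have h := abs_pow_sub_pow_le z y (2 * m)
    rw [← mul_sub, abs_mul]
    have hmax : max |z| |y| ^ (2 * m - 1) ≤ w ^ (2 * m + 1) :=
      (pow_le_pow_left₀ (le_max_of_le_left (abs_nonneg _)) (max_le hzw hyw) _).trans
        (pow_le_pow_right₀ hw1 (by omega))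
    rw [abs_sub_comm] at hy
    calc |c| * |z ^ (2 * m) - y ^ (2 * m)|
        ≤ |c| * (|z - y| * (2 * m : ℕ) * max |z| |y| ^ (2 * m - 1)) := by gcongr
      _ ≤ |c| * (1 / t * (2 * m : ℕ) * w ^ (2 * m + 1)) := by gcongr
      _ = 2 * m * |c| / t * w ^ (2 * m + 1) := by push_cast; ring
  have b4 : |b * z - b * y| ≤ |b| / t * w ^ (2 * m + 1) := by
    rw [← mul_sub, abs_mul]
    rw [abs_sub_comm] at hy
    calc |b| * |z - y| ≤ |b| * (1 / t) := by gcongr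
      _ = |b| / t * 1 := by ring
      _ ≤ |b| / t * w ^ (2 * m + 1) := by gcongr; exact one_le_pow₀ hw1
  have e : (2 * C + 2 * m * |c| + |b|) / t * w ^ (2 * m + 1)
      = C / t * w ^ (2 * m + 1) + C / t * w ^ (2 * m + 1)
        + 2 * m * |c| / t * w ^ (2 * m + 1) + |b| / t * w ^ (2 * m + 1) := by ring
  rw [e]
  rw [abs_le] at b1 b2 b3 b4 ⊢
  constructor <;> linarith [b1.1, b1.2, b2.1, b2.2, b3.1, b3.2, b4.1, b4.2]

/-- The error in the Taylor comparison grows with `|y|`; integrability needs this domination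
instead. It comes from `drop`, valid on the whole window, and from the linear growth of `B`, as `|x
- a| ≤ 1`. -/
theorem LaplaceData.exists_exp_exponent_le (H : LaplaceData m A B D a c b κ C ε) :
    ∃ K : ℝ, 0 < K ∧ ∀ (n : ℕ) (x t y : ℝ), x ∈ Set.Icc (0 : ℝ) 1 → x ∈ D → 1 ≤ t →
      t ^ (2 * m) = n → |y - t * (x - a)| ≤ 1 / t →
      Real.exp (n * (A x - A a) + t * (B x - B a)) ≤ K * Real.exp (-2 * |y|) := by
  obtain ⟨K, hK, h⟩ := exists_exp_neg_pow_le H.one_le H.kappa_pos (|b| + C)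
  refine ⟨K * Real.exp 2, by positivity, ?_⟩
  intro n x t y hx hxD ht htn hy
  have ht0 : 0 < t := by linarith
  have hC := H.const_nonneg
  set z := t * (x - a) with hz
  have h1t : 1 / t ≤ 1 := by rw [div_le_one ht0]; exact ht
  have hyz : |y| ≤ |z| + 1 := by
    have := abs_sub_abs_le_abs_sub y z
    linarith
  have h1 : n * (A x - A a) ≤ -κ * z ^ (2 * m) := by
    have := mul_le_mul_of_nonneg_left (H.drop x hx hxD) (by positivity : 0 ≤ t ^ (2 * m))
    rw [← htn, hz, mul_pow]
    linarith
  have h2 : t * (B x - B a) ≤ (|b| + C) * |z| := by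
    have hB := (abs_le.1 (H.taylorB x hx)).2
    have hxa : |x - a| ≤ 1 := by
      have := H.lower; have := H.upper; have := H.eps_pos
      rw [abs_le]; constructor <;> linarith [hx.1, hx.2]
    have hsq : |x - a| ^ 2 ≤ |x - a| := by nlinarith [abs_nonneg (x - a)]
    have hb : b * (x - a) ≤ |b| * |x - a| := by rw [← abs_mul]; exact le_abs_self _
    have h3 : B x - B a ≤ (|b| + C) * |x - a| := by
      have := mul_le_mul_of_nonneg_left hsq hC
      linarith
    have := mul_le_mul_of_nonneg_left h3 ht0.le
    rw [hz, abs_mul, abs_of_pos ht0]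
    linarith
  calc Real.exp (n * (A x - A a) + t * (B x - B a))
      ≤ Real.exp (-κ * z ^ (2 * m) + (|b| + C) * |z|) := Real.exp_le_exp.2 (by linarith)
    _ ≤ K * Real.exp (-2 * |z|) := h z
    _ ≤ K * Real.exp (2 + -2 * |y|) := by gcongr; linarith
    _ = K * Real.exp 2 * Real.exp (-2 * |y|) := by rw [Real.exp_add]; ring

/-- The local limit theorem with a rate. -/
theorem LaplaceData.abs_scaledWeight_sub_le (H : LaplaceData m A B D a c b κ C ε) :
    ∃ K : ℝ, 0 ≤ K ∧ ∀ (n k : ℕ) (t y : ℝ), 1 ≤ n → k ≤ n → 1 ≤ t → t ^ (2 * m) = n →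
      (k : ℝ) / n ∈ D → |y - t * ((k : ℝ) / n - a)| ≤ 1 / t →
      |scaledWeight A B a n t k - stirlingConst a * Real.exp (c * y ^ (2 * m) + b * y)|
        ≤ K / t * Real.exp (-|y|) := by
  obtain ⟨K₁, hK₁, h₁⟩ := H.abs_choose_sub_le
  obtain ⟨K₃, hK₃, h₃⟩ := H.exists_exp_exponent_le
  obtain ⟨K₄, hK₄, h₄⟩ := H.limit_le
  have hG : 0 ≤ stirlingConst a := by unfold stirlingConst; positivity
  have hC := H.const_nonneg
  set K₂ := 2 * C + 2 * m * |c| + |b| with hK₂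
  set K₅ := max K₃ K₄ with hK₅
  have hK₅0 : 0 < K₅ := lt_max_of_lt_left hK₃
  set N := 2 * m + 1 with hN
  refine ⟨(K₁ + stirlingConst a * K₂) * K₅ * (N.factorial * Real.exp 1), by positivity, ?_⟩
  intro n k t y hn hk ht htn hD hy
  have ht0 : 0 < t := by linarith
  have hn0 : (0 : ℝ) < n := by exact_mod_cast hn
  have hx : (k : ℝ) / n ∈ Set.Icc (0 : ℝ) 1 :=
    ⟨by positivity, (div_le_one hn0).2 (by exact_mod_cast hk)⟩
  have h1t : 1 / t ≤ 1 := by rw [div_le_one ht0]; exact ht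
  have hzw : |t * ((k : ℝ) / n - a)| ≤ 1 + |y| := by
    have := abs_sub_abs_le_abs_sub (t * ((k : ℝ) / n - a)) y
    rw [abs_sub_comm _ y] at this
    linarith
  have e₁ := h₁ n k t y hn hk ht htn hzw
  have e₂ := H.abs_exponent_sub_le hx ht htn hy
  have e₃ := h₃ n _ t y hx hD ht htn hy
  have e₄ := h₄ y
  rw [← hK₂] at e₂
  set q := √(n : ℝ) * ((n.choose k : ℝ) * Real.exp (-(n * Real.binEntropy (k / n))))
  set u := n * (A (k / n) - A a) + t * (B (k / n) - B a) with hu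
  set v := c * y ^ (2 * m) + b * y
  set G := stirlingConst a
  set w := 1 + |y| with hw
  have hw1 : 1 ≤ w := by have := abs_nonneg y; linarith
  have hq : scaledWeight A B a n t k = q * Real.exp u := rfl
  have hmax : Real.exp (max u v) ≤ K₅ * Real.exp (-2 * |y|) := by
    rcases max_choice u v with h | h <;> rw [h]
    · exact e₃.trans (by gcongr; exact le_max_left _ _)
    · exact e₄.trans (by gcongr; exact le_max_right _ _)
  have hpow : w ^ (m + 1) ≤ w ^ N := pow_le_pow_right₀ hw1 (by omega)
  have hwexp := one_add_abs_pow_le N y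
  rw [hq]
  -- The errors in the prefactor and in the exponent are separated. Each is a power of `w` over `t`
  -- times `exp (-2 * |y|)`, and half of this decay absorbs the power.
  calc |q * Real.exp u - G * Real.exp v|
      = |(q - G) * Real.exp u + G * (Real.exp u - Real.exp v)| := by congr 1; ring
    _ ≤ |q - G| * Real.exp u + G * |Real.exp u - Real.exp v| := by
      refine (abs_add_le _ _).trans (le_of_eq ?_)
      rw [abs_mul, abs_mul, abs_of_pos (Real.exp_pos u), abs_of_nonneg hG]
    _ ≤ K₁ / t * w ^ N * (K₅ * Real.exp (-2 * |y|))
        + G * (K₂ / t * w ^ N * (K₅ * Real.exp (-2 * |y|))) := by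
      have f1 : |q - G| * Real.exp u ≤ K₁ / t * w ^ N * (K₅ * Real.exp (-2 * |y|)) := by
        refine mul_le_mul (e₁.trans (by gcongr)) (e₃.trans ?_) (Real.exp_pos _).le (by positivity)
        gcongr
        exact le_max_left _ _
      have f2 : |Real.exp u - Real.exp v| ≤ K₂ / t * w ^ N * (K₅ * Real.exp (-2 * |y|)) :=
        (abs_exp_sub_exp_le u v).trans (mul_le_mul e₂ hmax (Real.exp_pos _).le (by positivity))
      gcongr
    _ = (K₁ + G * K₂) * K₅ / t * (w ^ N * Real.exp (-2 * |y|)) := by ring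
    _ ≤ (K₁ + G * K₂) * K₅ / t * (N.factorial * Real.exp 1 * Real.exp |y| * Real.exp (-2 * |y|)) := by
      gcongr
    _ = (K₁ + G * K₂) * K₅ * (N.factorial * Real.exp 1) / t * Real.exp (-|y|) := by
      rw [mul_assoc _ (Real.exp |y|), ← Real.exp_add, show |y| + -2 * |y| = -|y| by ring]
      ring

end PSpin

/-! ### From lattice sums to integrals -/

namespace PSpin

/-- The step function with value `f k` on the lattice cell `t (k / n - a) + [0, t / n)`. -/
noncomputable def cellSum (n : ℕ) (t a : ℝ) (f : ℕ → ℝ) (y : ℝ) : ℝ :=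
  ∑ k ∈ Finset.range (n + 1),
    (Set.Ico (t * ((k : ℝ) / n - a)) (t * ((k : ℝ) / n - a) + t / n)).indicator (fun _ => f k) y

theorem integrable_cellSum (n : ℕ) (t a : ℝ) (f : ℕ → ℝ) : Integrable (cellSum n t a f) := by
  refine integrable_finsetSum _ fun k _ => ?_
  exact (integrableOn_const (by simp)).integrable_indicator measurableSet_Ico

theorem integral_cellSum {n : ℕ} {t : ℝ} (ht : 0 ≤ t) (a : ℝ) (f : ℕ → ℝ) :
    ∫ y, cellSum n t a f y = t / n * ∑ k ∈ Finset.range (n + 1), f k := by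
  unfold cellSum
  rw [integral_finsetSum, Finset.mul_sum]
  · refine Finset.sum_congr rfl fun k _ => ?_
    rw [integral_indicator_const _ measurableSet_Ico, smul_eq_mul, Measure.real, Real.volume_Ico,
      add_sub_cancel_left, ENNReal.toReal_ofReal (by positivity)]
  · intro k _
    exact (integrableOn_const (by simp)).integrable_indicator measurableSet_Ico

/-- The only cell that can contain `y` has index `⌊n * (y / t + a)⌋₊`; if this is not in `0, …, n`,
then `y` lies outside the rescaled unit interval. The case does not depend on `f`. -/
theorem cellSum_cases {n : ℕ} (hn : 1 ≤ n) {t : ℝ} (ht : 0 < t) (a y : ℝ) :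
    (∃ k ≤ n, |y - t * ((k : ℝ) / n - a)| ≤ t / n ∧ ∀ f, cellSum n t a f y = f k) ∨
      ((y < -(t * a) ∨ t * (1 - a) ≤ y) ∧ ∀ f, cellSum n t a f y = 0) := by
  have hn0 : (0 : ℝ) < n := by exact_mod_cast hn
  set ζ := n * (y / t + a) with hζ
  have hmem : ∀ k : ℕ, y ∈ Set.Ico (t * ((k : ℝ) / n - a)) (t * ((k : ℝ) / n - a) + t / n) ↔
      (k : ℝ) ≤ ζ ∧ ζ < k + 1 := by
    intro k
    have e1 : ζ - k = n / t * (y - t * ((k : ℝ) / n - a)) := by rw [hζ]; field_simp; ring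
    have e2 : k + 1 - ζ = n / t * (t * ((k : ℝ) / n - a) + t / n - y) := by
      rw [hζ]; field_simp; ring
    have hnt : 0 < n / t := by positivity
    rw [Set.mem_Ico, ← sub_nonneg, ← sub_nonneg (b := (k : ℝ)), e1, mul_nonneg_iff_of_pos_left hnt,
      ← sub_pos, ← sub_pos (b := ζ), e2, mul_pos_iff_of_pos_left hnt]
  by_cases hζ0 : 0 ≤ ζ
  · by_cases hk : ⌊ζ⌋₊ ≤ n
    · left
      have hfl : ((⌊ζ⌋₊ : ℕ) : ℝ) ≤ ζ ∧ ζ < (⌊ζ⌋₊ : ℕ) + 1 := ⟨Nat.floor_le hζ0, Nat.lt_floor_add_one ζ⟩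
      have hin := (hmem ⌊ζ⌋₊).2 hfl
      refine ⟨⌊ζ⌋₊, hk, ?_, fun f => ?_⟩
      · rw [abs_of_nonneg (by linarith [hin.1])]
        linarith [hin.2]
      · unfold cellSum
        rw [Finset.sum_eq_single ⌊ζ⌋₊, Set.indicator_of_mem hin]
        · intro j _ hj
          refine Set.indicator_of_notMem (fun hj' => hj ?_) _
          have := (hmem j).1 hj'
          exact ((Nat.floor_eq_iff hζ0).2 this).symm
        · intro h
          exact absurd (Finset.mem_range.2 (Nat.lt_succ_of_le hk)) h
    · right
      rw [not_le] at hk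
      have h1 : (n : ℝ) + 1 ≤ ζ := by
        have : ((n + 1 : ℕ) : ℝ) ≤ ζ := (Nat.le_floor_iff hζ0).1 hk
        simpa using this
      refine ⟨Or.inr ?_, fun f => Finset.sum_eq_zero fun k hk' => ?_⟩
      · have e : ζ - n = n / t * (y - t * (1 - a)) := by rw [hζ]; field_simp; ring
        have h2 : 0 ≤ n / t * (y - t * (1 - a)) := by rw [← e]; linarith
        have := (mul_nonneg_iff_of_pos_left (by positivity : 0 < n / t)).1 h2
        linarith
      · refine Set.indicator_of_notMem (fun hj' => ?_) _
        have h2 := ((hmem k).1 hj').2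
        have h3 : (k : ℝ) ≤ n := by exact_mod_cast Nat.lt_succ_iff.1 (Finset.mem_range.1 hk')
        linarith
  · right
    rw [not_le] at hζ0
    refine ⟨Or.inl ?_, fun f => Finset.sum_eq_zero fun k _ => ?_⟩
    · have e : -ζ = n / t * (-(t * a) - y) := by rw [hζ]; field_simp; ring
      have h2 : 0 < n / t * (-(t * a) - y) := by rw [← e]; linarith
      have := (mul_pos_iff_of_pos_left (by positivity : 0 < n / t)).1 h2
      linarith
    · refine Set.indicator_of_notMem (fun hj' => ?_) _
      have h2 := ((hmem k).1 hj').1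
      have h3 : (0 : ℝ) ≤ k := by positivity
      linarith

variable {m : ℕ} {A B : ℝ → ℝ} {D : Set ℝ} {a c b κ C ε : ℝ}

/-- The lattice sum of `F` against the normalized weights. -/
noncomputable def latticeSum (A B : ℝ → ℝ) (a : ℝ) (n : ℕ) (t : ℝ) (F : ℝ → ℝ) : ℝ :=
  t / n * ∑ k ∈ Finset.range (n + 1), F ((k : ℝ) / n) * scaledWeight A B a n t k

theorem div_natCast_le_one_div {m n : ℕ} (hm : 1 ≤ m) {t : ℝ} (ht : 1 ≤ t)
    (htn : t ^ (2 * m) = n) : t / n ≤ 1 / t := by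
  have ht0 : 0 < t := by linarith
  rw [← htn, div_le_div_iff₀ (by positivity) ht0, one_mul, ← sq]
  exact pow_le_pow_right₀ ht (by omega)

/-- Case analysis for points of the line with respect to the lattice and the window. -/
theorem LaplaceData.cell_cases (H : LaplaceData m A B D a c b κ C ε) {n : ℕ} (hn : 1 ≤ n) {t : ℝ}
    (ht : 1 ≤ t) (htn : t ^ (2 * m) = n) (y : ℝ) :
    (∃ k ≤ n, |y - t * ((k : ℝ) / n - a)| ≤ 1 / t ∧ (k : ℝ) / n ∈ D ∧ ∀ g : ℝ → ℝ,
      cellSum n t a (fun k => D.indicator (fun x => g (t * (x - a))) ((k : ℝ) / n)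
        * scaledWeight A B a n t k) y = g (t * ((k : ℝ) / n - a)) * scaledWeight A B a n t k) ∨
      (1 ≤ (1 + |y|) / (ε * t) ∧ ∀ g : ℝ → ℝ,
      cellSum n t a (fun k => D.indicator (fun x => g (t * (x - a))) ((k : ℝ) / n)
        * scaledWeight A B a n t k) y = 0) := by
  have ht0 : 0 < t := by linarith
  have hε := H.eps_pos
  have hn0 : (0 : ℝ) < n := by exact_mod_cast hn
  rcases cellSum_cases hn ht0 a y with ⟨k, hk, hky, hf⟩ | ⟨hy, hf⟩
  · have hky' := hky.trans (div_natCast_le_one_div H.one_le ht htn)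
    by_cases hD : (k : ℝ) / n ∈ D
    · exact Or.inl ⟨k, hk, hky', hD, fun g => by rw [hf, Set.indicator_of_mem hD]⟩
    · refine Or.inr ⟨?_, fun g => by rw [hf, Set.indicator_of_notMem hD, zero_mul]⟩
      have hx : (k : ℝ) / n ∈ Set.Icc (0 : ℝ) 1 :=
        ⟨by positivity, (div_le_one hn0).2 (by exact_mod_cast hk)⟩
      -- Outside the window the lattice point is farther than `ε` from `a`, so `ε * t ≤ 1 + |y|`;
      -- the same holds beyond `[0, 1]`. This ratio, at least one, supplies the rate `1 / t` where
      -- the step function vanishes.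
      have hfar : ε < |(k : ℝ) / n - a| := by
        by_contra! hle
        exact hD (H.mem_of_near _ hx hle)
      rw [one_le_div (by positivity)]
      have h1t : 1 / t ≤ 1 := by rw [div_le_one ht0]; exact ht
      have h1 := abs_sub_abs_le_abs_sub (t * ((k : ℝ) / n - a)) y
      rw [abs_sub_comm _ y, abs_mul, abs_of_pos ht0] at h1
      have h2 := mul_lt_mul_of_pos_left hfar ht0
      linarith
  · refine Or.inr ⟨?_, fun g => hf _⟩
    rw [one_le_div (by positivity)]
    have h1 := H.lower
    have h2 := H.upper
    rcases hy with h | h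
    · have : ε * t ≤ t * a := by nlinarith
      have := neg_abs_le y
      linarith
    · have : ε * t ≤ t * (1 - a) := by nlinarith
      have := le_abs_self y
      linarith

/-- Laplace's method for functions of at most linear growth, with a rate. -/
theorem LaplaceData.abs_latticeSum_sub_le (H : LaplaceData m A B D a c b κ C ε) :
    ∃ K : ℝ, 0 ≤ K ∧ ∀ (n : ℕ) (t : ℝ) (g : ℝ → ℝ) (M : ℝ), 1 ≤ n → 1 ≤ t → t ^ (2 * m) = n →
      (∀ y, |g y| ≤ M * (1 + |y|)) → (∀ y z, |g y - g z| ≤ M * |y - z|) →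
      |latticeSum A B a n t (D.indicator fun x => g (t * (x - a)))
        - stirlingConst a * ∫ y, g y * Real.exp (c * y ^ (2 * m) + b * y)| ≤ M * K / t := by
  obtain ⟨K, hK, hloc⟩ := H.abs_scaledWeight_sub_le
  obtain ⟨K₄, hK₄, h₄⟩ := H.limit_le
  have hε := H.eps_pos
  have hG : 0 ≤ stirlingConst a := by unfold stirlingConst; positivity
  set G := stirlingConst a
  set K₀ := 2 * K + G * K₄ + G * K₄ / ε with hK₀
  have hK₀0 : 0 ≤ K₀ := by positivity
  set J := ∫ y : ℝ, (1 + |y|) ^ 2 * Real.exp (-|y|) with hJ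
  have hJ0 : 0 ≤ J := integral_nonneg fun y => by positivity
  refine ⟨K₀ * J, by positivity, ?_⟩
  intro n t g M hn ht htn hg1 hg2
  have ht0 : 0 < t := by linarith
  have h1t : 1 / t ≤ 1 := by rw [div_le_one ht0]; exact ht
  have hM : 0 ≤ M := by
    have := (abs_nonneg _).trans (hg1 0)
    simpa using this
  have hgc : Continuous g := by
    refine LipschitzWith.continuous (K := ⟨M, hM⟩) (LipschitzWith.of_dist_le_mul fun y z => ?_)
    rw [Real.dist_eq, Real.dist_eq]
    exact hg2 y z
  set φ : ℝ → ℝ := fun y => Real.exp (c * y ^ (2 * m) + b * y) with hφ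
  have hφ0 : ∀ y, 0 ≤ φ y := fun y => (Real.exp_pos _).le
  have hexp : ∀ y : ℝ, Real.exp (-2 * |y|) ≤ Real.exp (-|y|) := fun y =>
    Real.exp_le_exp.2 (by linarith [abs_nonneg y])
  have hφle : ∀ y, φ y ≤ K₄ * Real.exp (-|y|) := fun y =>
    (h₄ y).trans (mul_le_mul_of_nonneg_left (hexp y) hK₄.le)
  set f : ℕ → ℝ := fun k => D.indicator (fun x => g (t * (x - a))) ((k : ℝ) / n)
    * scaledWeight A B a n t k with hf
  -- The dominating function is integrable and involves `g` only through `M`, so integrating this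
  -- bound gives a rate uniform in the test function.
  have hpt : ∀ y, |cellSum n t a f y - G * (g y * φ y)|
      ≤ M * K₀ / t * ((1 + |y|) ^ 2 * Real.exp (-|y|)) := by
    intro y
    set w := 1 + |y| with hw
    have hw1 : 1 ≤ w := by have := abs_nonneg y; linarith
    have hww : w ≤ w ^ 2 := le_self_pow₀ hw1 two_ne_zero
    have hw2 : 1 ≤ w ^ 2 := hw1.trans hww
    rcases H.cell_cases hn ht htn y with ⟨k, hk, hky, hD, hval⟩ | ⟨hfar, hval⟩
    · rw [hval g]
      set z := t * ((k : ℝ) / n - a) with hz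
      have hρ := hloc n k t y hn hk ht htn hD hky
      set ρ := scaledWeight A B a n t k
      have hgz : |g z| ≤ M * (2 * w) := by
        refine (hg1 z).trans (mul_le_mul_of_nonneg_left ?_ hM)
        have := abs_sub_abs_le_abs_sub z y
        rw [abs_sub_comm z y] at this
        linarith
      have hgzy : |g z - g y| ≤ M * (1 / t) := by
        refine (hg2 z y).trans (mul_le_mul_of_nonneg_left ?_ hM)
        rwa [abs_sub_comm]
      calc |g z * ρ - G * (g y * φ y)|
          = |g z * (ρ - G * φ y) + (g z - g y) * (G * φ y)| := by congr 1; ring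
        _ ≤ |g z| * |ρ - G * φ y| + |g z - g y| * (G * φ y) := by
          refine (abs_add_le _ _).trans (le_of_eq ?_)
          rw [abs_mul, abs_mul, abs_of_nonneg (mul_nonneg hG (hφ0 y))]
        _ ≤ M * (2 * w) * (K / t * Real.exp (-|y|))
            + M * (1 / t) * (G * (K₄ * Real.exp (-|y|))) := by
          have := hφle y
          gcongr
        _ = M * (2 * K) / t * (w * Real.exp (-|y|)) + M * (G * K₄) / t * (1 * Real.exp (-|y|)) := by
          ring
        _ ≤ M * (2 * K) / t * (w ^ 2 * Real.exp (-|y|))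
            + M * (G * K₄) / t * (w ^ 2 * Real.exp (-|y|)) := by gcongr
        _ = M * (2 * K + G * K₄) / t * (w ^ 2 * Real.exp (-|y|)) := by ring
        _ ≤ M * K₀ / t * (w ^ 2 * Real.exp (-|y|)) := by
          gcongr
          exact le_add_of_nonneg_right (by positivity)
    · rw [hval g, zero_sub, abs_neg, abs_mul, abs_mul, abs_of_nonneg hG, abs_of_nonneg (hφ0 y)]
      calc G * (|g y| * φ y) ≤ G * (M * w * (K₄ * Real.exp (-|y|))) := by
            have := hφle y
            have := hg1 y
            gcongr
        _ = G * (M * w * (K₄ * Real.exp (-|y|))) * 1 := (mul_one _).symm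
        _ ≤ G * (M * w * (K₄ * Real.exp (-|y|))) * (w / (ε * t)) := by gcongr
        _ = M * (G * K₄ / ε) / t * (w ^ 2 * Real.exp (-|y|)) := by
          field_simp
        _ ≤ M * K₀ / t * (w ^ 2 * Real.exp (-|y|)) := by
          gcongr
          exact le_add_of_nonneg_left (by positivity)
  have hgφ : Integrable fun y => g y * φ y := by
    refine ((integrable_one_add_abs_pow_mul_exp 1).const_mul (M * K₄)).mono'
      (Continuous.aestronglyMeasurable (by fun_prop)) (Eventually.of_forall fun y => ?_)
    rw [norm_mul, Real.norm_eq_abs, Real.norm_of_nonneg (hφ0 y), pow_one]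
    calc |g y| * φ y ≤ M * (1 + |y|) * (K₄ * Real.exp (-|y|)) := by
          have := hφle y
          have := hg1 y
          gcongr
      _ = M * K₄ * ((1 + |y|) * Real.exp (-|y|)) := by ring
  have hsum : latticeSum A B a n t (D.indicator fun x => g (t * (x - a)))
      = ∫ y, cellSum n t a f y := by
    rw [integral_cellSum ht0.le]
    rfl
  rw [hsum, ← integral_const_mul, ← integral_sub (integrable_cellSum _ _ _ _) (hgφ.const_mul G)]
  refine (abs_integral_le_integral_abs).trans ?_
  calc ∫ y, |cellSum n t a f y - G * (g y * φ y)|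
      ≤ ∫ y, M * K₀ / t * ((1 + |y|) ^ 2 * Real.exp (-|y|)) := by
        refine integral_mono_of_nonneg (Eventually.of_forall fun y => abs_nonneg _)
          ((integrable_one_add_abs_pow_mul_exp 2).const_mul _) (Eventually.of_forall hpt)
    _ = M * (K₀ * J) / t := by rw [integral_const_mul]; ring

theorem scaledWeight_nonneg (A B : ℝ → ℝ) (a : ℝ) (n : ℕ) {t : ℝ} (k : ℕ) :
    0 ≤ scaledWeight A B a n t k := by
  unfold scaledWeight; positivity

/-- Moment bounds in Laplace's method. -/
theorem LaplaceData.latticeSum_abs_pow_le (H : LaplaceData m A B D a c b κ C ε) (l : ℕ) :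
    ∃ K : ℝ, 0 ≤ K ∧ ∀ (n : ℕ) (t : ℝ), 1 ≤ n → 1 ≤ t → t ^ (2 * m) = n →
      latticeSum A B a n t (D.indicator fun x => |t * (x - a)| ^ l) ≤ K := by
  obtain ⟨K, hK, hloc⟩ := H.abs_scaledWeight_sub_le
  obtain ⟨K₄, hK₄, h₄⟩ := H.limit_le
  have hG : 0 ≤ stirlingConst a := by unfold stirlingConst; positivity
  set G := stirlingConst a
  set J := ∫ y : ℝ, (1 + |y|) ^ l * Real.exp (-|y|) with hJ
  have hJ0 : 0 ≤ J := integral_nonneg fun y => by positivity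
  refine ⟨(K + G * K₄) * J, by positivity, ?_⟩
  intro n t hn ht htn
  have ht0 : 0 < t := by linarith
  have h1t : 1 / t ≤ 1 := by rw [div_le_one ht0]; exact ht
  set f : ℕ → ℝ := fun k => D.indicator (fun x => |t * (x - a)| ^ l) ((k : ℝ) / n)
    * scaledWeight A B a n t k with hf
  have hsum : latticeSum A B a n t (D.indicator fun x => |t * (x - a)| ^ l)
      = ∫ y, cellSum n t a f y := by
    rw [integral_cellSum ht0.le]
    rfl
  rw [hsum, hJ, ← integral_const_mul]
  refine integral_mono (integrable_cellSum _ _ _ _)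
    ((integrable_one_add_abs_pow_mul_exp l).const_mul _) fun y => ?_
  change cellSum n t a f y ≤ (K + G * K₄) * ((1 + |y|) ^ l * Real.exp (-|y|))
  rcases H.cell_cases hn ht htn y with ⟨k, hk, hky, hD, hval⟩ | ⟨-, hval⟩
  · rw [hval fun z => |z| ^ l]
    have hρ := (abs_le.1 (hloc n k t y hn hk ht htn hD hky)).2
    set z := t * ((k : ℝ) / n - a) with hz
    have hzw : |z| ≤ 1 + |y| := by
      have := abs_sub_abs_le_abs_sub z y
      rw [abs_sub_comm z y] at this
      linarith
    have hexp : Real.exp (-2 * |y|) ≤ Real.exp (-|y|) :=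
      Real.exp_le_exp.2 (by linarith [abs_nonneg y])
    have h1 : G * Real.exp (c * y ^ (2 * m) + b * y) ≤ G * (K₄ * Real.exp (-|y|)) :=
      mul_le_mul_of_nonneg_left ((h₄ y).trans (mul_le_mul_of_nonneg_left hexp hK₄.le)) hG
    have h2 : K / t * Real.exp (-|y|) ≤ K * Real.exp (-|y|) :=
      mul_le_mul_of_nonneg_right (div_le_self hK ht) (Real.exp_pos _).le
    have h3 : scaledWeight A B a n t k ≤ (K + G * K₄) * Real.exp (-|y|) := by linarith
    calc |z| ^ l * scaledWeight A B a n t k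
        ≤ (1 + |y|) ^ l * ((K + G * K₄) * Real.exp (-|y|)) :=
          mul_le_mul (pow_le_pow_left₀ (abs_nonneg _) hzw l) h3
            (scaledWeight_nonneg _ _ _ _ _) (by positivity)
      _ = (K + G * K₄) * ((1 + |y|) ^ l * Real.exp (-|y|)) := by ring
  · rw [hval fun z => |z| ^ l]
    positivity

end PSpin

/-! ### Gibbs expectations as binomial sums -/

namespace PSpin

theorem sum_config_plus {n : ℕ} (Φ : ℕ → ℝ) :
    ∑ ω : Config n, Φ (Finset.univ.filter fun i => ω i = true).card
      = ∑ k ∈ Finset.range (n + 1), (n.choose k : ℝ) * Φ k := by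
  let e : Config n ≃ Finset (Fin n) :=
    { toFun := fun ω => Finset.univ.filter fun i => ω i = true
      invFun := fun S i => decide (i ∈ S)
      left_inv := fun ω => by ext i; simp
      right_inv := fun S => by ext i; simp }
  have h1 : ∑ ω : Config n, Φ (Finset.univ.filter fun i => ω i = true).card
      = ∑ S : Finset (Fin n), Φ S.card := Fintype.sum_equiv e _ _ fun ω => rfl
  rw [h1, ← Finset.powerset_univ, Finset.sum_powerset_apply_card]
  simp

theorem magnetization_eq {n : ℕ} (hn : 1 ≤ n) (ω : Config n) :
    magnetization ω = n * (2 * plusFraction ω - 1) := by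
  have hn0 : (n : ℝ) ≠ 0 := by positivity
  have h1 : magnetization ω = ∑ i : Fin n, (2 * (if ω i = true then (1 : ℝ) else 0) - 1) := by
    refine Finset.sum_congr rfl fun i _ => ?_
    unfold spin
    split_ifs <;> norm_num
  rw [h1, Finset.sum_sub_distrib, ← Finset.mul_sum, Finset.sum_boole, plusFraction]
  simp
  field_simp

section Gibbs

variable {n : ℕ}

theorem sum_exp_pos (H : Config n → ℝ) : 0 < ∑ η, Real.exp (H η) :=
  Finset.sum_pos (fun _ _ => Real.exp_pos _) Finset.univ_nonempty

instance isProbabilityMeasure_gibbs (H : Config n → ℝ) : IsProbabilityMeasure (gibbs H) := by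
  constructor
  have hZ := sum_exp_pos H
  simp only [gibbs, Measure.coe_finsetSum, Measure.coe_smul, Finset.sum_apply, Pi.smul_apply,
    measure_univ, smul_eq_mul, mul_one]
  rw [← ENNReal.ofReal_sum_of_nonneg fun _ _ => by positivity, ← Finset.sum_div, div_self hZ.ne',
    ENNReal.ofReal_one]

theorem integral_gibbs (H : Config n → ℝ) (G : Config n → ℝ) :
    ∫ ω, G ω ∂(gibbs H) = (∑ ω, G ω * Real.exp (H ω)) / ∑ η, Real.exp (H η) := by
  have hZ := sum_exp_pos H
  rw [gibbs, integral_finsetSum_measure, Finset.sum_div]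
  · refine Finset.sum_congr rfl fun ω _ => ?_
    rw [integral_smul_measure, integral_dirac, ENNReal.toReal_ofReal (by positivity), smul_eq_mul]
    ring
  · intro ω _
    exact (integrable_dirac (by simp)).smul_measure ENNReal.ofReal_ne_top

/-- The sum of `F` over the binomial lattice, weighted by `exp U`. -/
noncomputable def spinSum (n : ℕ) (U F : ℝ → ℝ) : ℝ :=
  ∑ k ∈ Finset.range (n + 1), F ((k : ℝ) / n) * ((n.choose k : ℝ) * Real.exp (U ((k : ℝ) / n)))

theorem sum_config_eq_spinSum (U F : ℝ → ℝ) :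
    ∑ ω : Config n, F (plusFraction ω) * Real.exp (U (plusFraction ω)) = spinSum n U F := by
  have := sum_config_plus (n := n) fun k => F ((k : ℝ) / n) * Real.exp (U ((k : ℝ) / n))
  simp only [plusFraction, spinSum]
  rw [this]
  exact Finset.sum_congr rfl fun k _ => by ring

theorem integral_gibbs_plusFraction (U F : ℝ → ℝ) :
    ∫ ω : Config n, F (plusFraction ω) ∂(gibbs fun ω => U (plusFraction ω))
      = spinSum n U F / spinSum n U 1 := by
  rw [integral_gibbs, sum_config_eq_spinSum, ← sum_config_eq_spinSum U 1]
  simp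

theorem gibbs_real_plusFraction (U : ℝ → ℝ) (D : Set ℝ) :
    (gibbs fun ω : Config n => U (plusFraction ω)).real {ω | plusFraction ω ∈ D}
      = spinSum n U (D.indicator 1) / spinSum n U 1 := by
  rw [← integral_gibbs_plusFraction, ← integral_indicator_one (Set.toFinite _).measurableSet]
  rfl

theorem integral_cond_gibbs_plusFraction (U F : ℝ → ℝ) (D : Set ℝ) :
    ∫ ω : Config n, F (plusFraction ω)
        ∂((gibbs fun ω => U (plusFraction ω))[|{ω | plusFraction ω ∈ D}])
      = spinSum n U (D.indicator F) / spinSum n U (D.indicator 1) := by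
  have hZ : spinSum n U 1 ≠ 0 := by
    rw [← sum_config_eq_spinSum]
    simpa using (sum_exp_pos (n := n) fun ω => U (plusFraction ω)).ne'
  have h1 : ∫ ω in {ω : Config n | plusFraction ω ∈ D}, F (plusFraction ω)
      ∂(gibbs fun ω => U (plusFraction ω)) = spinSum n U (D.indicator F) / spinSum n U 1 := by
    rw [← integral_gibbs_plusFraction, ← integral_indicator (Set.toFinite _).measurableSet]
    rfl
  rw [ProbabilityTheory.cond, integral_smul_measure, h1, ENNReal.toReal_inv, smul_eq_mul]
  change ((gibbs fun ω : Config n => U (plusFraction ω)).real {ω | plusFraction ω ∈ D})⁻¹ * _ = _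
  rw [gibbs_real_plusFraction]
  -- For a window of probability zero both sides vanish, by the convention for division by zero; no
  -- positivity is needed.
  by_cases h0 : spinSum n U (D.indicator 1) = 0
  · simp [h0]
  · field_simp

theorem spinSum_one_pos (n : ℕ) (U : ℝ → ℝ) : 0 < spinSum n U 1 := by
  rw [← sum_config_eq_spinSum]
  simpa using (sum_exp_pos (n := n) fun ω => U (plusFraction ω))

theorem spinSum_mono {n : ℕ} {U F G : ℝ → ℝ}
    (hFG : ∀ k : ℕ, k ≤ n → F ((k : ℝ) / n) ≤ G ((k : ℝ) / n)) :
    spinSum n U F ≤ spinSum n U G := by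
  refine Finset.sum_le_sum fun k hk => mul_le_mul_of_nonneg_right
    (hFG k (Nat.lt_succ_iff.1 (Finset.mem_range.1 hk))) (by positivity)

theorem spinSum_add_const_mul (n : ℕ) (U F G : ℝ → ℝ) (r : ℝ) :
    spinSum n U (fun x => F x + r * G x) = spinSum n U F + r * spinSum n U G := by
  unfold spinSum
  rw [Finset.mul_sum, ← Finset.sum_add_distrib]
  refine Finset.sum_congr rfl fun k _ => ?_
  ring

end Gibbs

/-! ### Mass, moments and Wasserstein rate in one window -/

/-- The exponent `n f + t B` of the Gibbs measures. -/
noncomputable def gibbsExponent (p : ℕ) (β h β' h' : ℝ) (n : ℕ) (t x : ℝ) : ℝ :=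
  n * energy p β h x + t * energy p β' h' x

variable {p m : ℕ} {β h β' h' : ℝ} {D : Set ℝ} {a c b κ C ε : ℝ}

/-- The factor between the lattice sums and the unnormalized sums. -/
noncomputable def latticeFactor (p : ℕ) (β h β' h' a : ℝ) (n : ℕ) (t : ℝ) : ℝ :=
  t / n * √(n : ℝ) * Real.exp (-(n * freeEnergy p β h a + t * energy p β' h' a))

theorem latticeFactor_pos (p : ℕ) (β h β' h' a : ℝ) {n : ℕ} (hn : 1 ≤ n) {t : ℝ} (ht : 1 ≤ t) :
    0 < latticeFactor p β h β' h' a n t := by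
  have hn0 : (0 : ℝ) < n := by exact_mod_cast hn
  have : 0 < t := by linarith
  unfold latticeFactor
  positivity

/-- The entropy in `A` is what separates it from the energy, and it cancels the entropy factor of
`scaledWeight`. The factor left over does not depend on `k`, so it drops out of every Gibbs ratio.
-/
theorem latticeSum_eq (p : ℕ) (β h β' h' a : ℝ) (n : ℕ) (t : ℝ) (F : ℝ → ℝ) :
    latticeSum (freeEnergy p β h) (energy p β' h') a n t F
      = latticeFactor p β h β' h' a n t * spinSum n (gibbsExponent p β h β' h' n t) F := by
  unfold latticeSum spinSum latticeFactor
  rw [Finset.mul_sum, Finset.mul_sum]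
  refine Finset.sum_congr rfl fun k _ => ?_
  have : Real.exp (-(n * Real.binEntropy (k / n)))
      * Real.exp (n * (freeEnergy p β h (k / n) - freeEnergy p β h a)
        + t * (energy p β' h' (k / n) - energy p β' h' a))
      = Real.exp (-(n * freeEnergy p β h a + t * energy p β' h' a))
        * Real.exp (gibbsExponent p β h β' h' n t (k / n)) := by
    rw [← Real.exp_add, ← Real.exp_add]
    congr 1
    simp only [gibbsExponent, freeEnergy]
    ring
  unfold scaledWeight
  linear_combination t / n * F ((k : ℝ) / n) * √(n : ℝ) * (n.choose k : ℝ) * this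

/-- Only finitely many values precede the threshold, so their positive minimum extends the eventual
bound. This is how the rates come to hold from `n = 1` on. -/
theorem exists_pos_lower_bound {u : ℕ → ℝ} {z : ℝ} (hz : 0 < z) (hu : ∀ᶠ n in atTop, z ≤ u n) :
    ∃ z₀ : ℝ, 0 < z₀ ∧ ∀ n, 0 < u n → z₀ ≤ u n := by
  obtain ⟨N, hN⟩ := eventually_atTop.1 hu
  have : ∀ M : ℕ, ∃ z₀ : ℝ, 0 < z₀ ∧ ∀ n < M, 0 < u n → z₀ ≤ u n := by
    intro M
    induction M with
    | zero => exact ⟨1, one_pos, by simp⟩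
    | succ M ih =>
      obtain ⟨z₀, hz₀, h⟩ := ih
      by_cases hM : 0 < u M
      · refine ⟨min z₀ (u M), lt_min hz₀ hM, fun n hn hpos => ?_⟩
        rcases (Nat.lt_succ_iff.1 hn).lt_or_eq with h1 | rfl
        · exact (min_le_left _ _).trans (h n h1 hpos)
        · exact min_le_right _ _
      · refine ⟨z₀, hz₀, fun n hn hpos => ?_⟩
        rcases (Nat.lt_succ_iff.1 hn).lt_or_eq with h1 | rfl
        · exact h n h1 hpos
        · exact absurd hpos hM
  obtain ⟨z₀, hz₀, h⟩ := this N
  refine ⟨min z₀ z, lt_min hz₀ hz, fun n hpos => ?_⟩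
  rcases lt_or_ge n N with hn | hn
  · exact (min_le_left _ _).trans (h n hn hpos)
  · exact (min_le_right _ _).trans (hN n hn)

/-- `τ n` is the `2m`-th root of `n`. -/
def IsRootScale (m : ℕ) (τ : ℕ → ℝ) : Prop :=
  ∀ n : ℕ, 1 ≤ n → 1 ≤ τ n ∧ τ n ^ (2 * m) = n

theorem IsRootScale.tendsto {τ : ℕ → ℝ} (hm : 1 ≤ m) (hτ : IsRootScale m τ) :
    Tendsto τ atTop atTop := by
  refine tendsto_atTop.2 fun r => ?_
  filter_upwards [eventually_ge_atTop (max 1 ⌈|r| ^ (2 * m)⌉₊)] with n hn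
  obtain ⟨h1, h2⟩ := hτ n (le_of_max_le_left hn)
  have h3 : |r| ^ (2 * m) ≤ τ n ^ (2 * m) := by
    rw [h2]
    exact (Nat.le_ceil _).trans (by exact_mod_cast le_of_max_le_right hn)
  exact (le_abs_self r).trans (le_of_pow_le_pow_left₀ (by omega) (by linarith) h3)

/-- The limiting normalization constant. -/
noncomputable def laplaceMass (m : ℕ) (a c b : ℝ) : ℝ :=
  stirlingConst a * ∫ y, Real.exp (c * y ^ (2 * m) + b * y)


theorem LaplaceData.integrable_pow_mul_exp
    (H : LaplaceData m (freeEnergy p β h) (energy p β' h') D a c b κ C ε) (l : ℕ) :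
    Integrable fun y : ℝ => (1 + |y|) ^ l * Real.exp (c * y ^ (2 * m) + b * y) := by
  obtain ⟨K, hK, hle⟩ := H.limit_le
  refine ((integrable_one_add_abs_pow_mul_exp l).const_mul K).mono'
    (Continuous.aestronglyMeasurable (by fun_prop)) (Eventually.of_forall fun y => ?_)
  rw [Real.norm_of_nonneg (by positivity)]
  have h1 : Real.exp (-2 * |y|) ≤ Real.exp (-|y|) :=
    Real.exp_le_exp.2 (by linarith [abs_nonneg y])
  calc (1 + |y|) ^ l * Real.exp (c * y ^ (2 * m) + b * y)
      ≤ (1 + |y|) ^ l * (K * Real.exp (-|y|)) := by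
        have := (hle y).trans (mul_le_mul_of_nonneg_left h1 hK.le)
        gcongr
    _ = K * ((1 + |y|) ^ l * Real.exp (-|y|)) := by ring

theorem LaplaceData.integrable_exp
    (H : LaplaceData m (freeEnergy p β h) (energy p β' h') D a c b κ C ε) :
    Integrable fun y : ℝ => Real.exp (c * y ^ (2 * m) + b * y) := by
  simpa using H.integrable_pow_mul_exp 0

theorem LaplaceData.stirlingConst_pos
    (H : LaplaceData m (freeEnergy p β h) (energy p β' h') D a c b κ C ε) : 0 < stirlingConst a := by
  have h1 : 0 < a := by linarith [H.lower, H.eps_pos]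
  have h2 : 0 < 1 - a := by linarith [H.upper, H.eps_pos]
  unfold stirlingConst
  positivity

theorem LaplaceData.laplaceMass_pos
    (H : LaplaceData m (freeEnergy p β h) (energy p β' h') D a c b κ C ε) : 0 < laplaceMass m a c b :=
  mul_pos H.stirlingConst_pos (integral_exp_pos H.integrable_exp)

/-- The mass of the window, with a rate. -/
theorem LaplaceData.exists_abs_mass_sub_le
    (H : LaplaceData m (freeEnergy p β h) (energy p β' h') D a c b κ C ε) {τ : ℕ → ℝ} (hτ : IsRootScale m τ) :
    ∃ K : ℝ, 0 ≤ K ∧ ∀ n : ℕ, 1 ≤ n →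
      |latticeFactor p β h β' h' a n (τ n)
          * spinSum n (gibbsExponent p β h β' h' n (τ n)) (D.indicator 1) - laplaceMass m a c b|
        ≤ K / τ n := by
  obtain ⟨K, hK, hle⟩ := H.abs_latticeSum_sub_le
  refine ⟨K, hK, fun n hn => ?_⟩
  have := hle n (τ n) (fun _ => 1) 1 hn (hτ n hn).1 (hτ n hn).2 (fun y => by simp) (fun y z => by simp)
  simp only [one_mul] at this
  rw [← latticeSum_eq]
  exact this

theorem LaplaceData.tendsto_mass
    (H : LaplaceData m (freeEnergy p β h) (energy p β' h') D a c b κ C ε) {τ : ℕ → ℝ} (hτ : IsRootScale m τ) :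
    Tendsto (fun n => latticeFactor p β h β' h' a n (τ n)
          * spinSum n (gibbsExponent p β h β' h' n (τ n)) (D.indicator 1)) atTop
      (𝓝 (laplaceMass m a c b)) := by
  obtain ⟨K, hK, hle⟩ := H.exists_abs_mass_sub_le hτ
  rw [tendsto_iff_norm_sub_tendsto_zero]
  refine squeeze_zero' (Eventually.of_forall fun n => norm_nonneg _)
    (eventually_atTop.2 ⟨1, fun n hn => hle n hn⟩) ?_
  exact tendsto_const_nhds.div_atTop (hτ.tendsto H.one_le)

theorem LaplaceData.exists_mass_lower_bound
    (H : LaplaceData m (freeEnergy p β h) (energy p β' h') D a c b κ C ε) {τ : ℕ → ℝ} (hτ : IsRootScale m τ) :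
    ∃ z : ℝ, 0 < z ∧ ∀ n : ℕ, 1 ≤ n →
      0 < spinSum n (gibbsExponent p β h β' h' n (τ n)) (D.indicator 1) →
      z ≤ latticeFactor p β h β' h' a n (τ n)
          * spinSum n (gibbsExponent p β h β' h' n (τ n)) (D.indicator 1) := by
  have hpos := H.laplaceMass_pos
  have hev := (H.tendsto_mass hτ).eventually_const_le (half_lt_self hpos)
  obtain ⟨z, hz, h1⟩ := exists_pos_lower_bound (half_pos hpos) hev
  exact ⟨z, hz, fun n hn h2 =>
    h1 n (mul_pos (latticeFactor_pos p β h β' h' a hn (hτ n hn).1) h2)⟩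

theorem LaplaceData.eventually_spinSum_pos
    (H : LaplaceData m (freeEnergy p β h) (energy p β' h') D a c b κ C ε) {τ : ℕ → ℝ} (hτ : IsRootScale m τ) :
    ∀ᶠ n in atTop, 0 < spinSum n (gibbsExponent p β h β' h' n (τ n)) (D.indicator 1) := by
  filter_upwards [(H.tendsto_mass hτ).eventually_const_lt H.laplaceMass_pos,
    eventually_ge_atTop 1] with n h1 hn
  exact pos_of_mul_pos_right h1 (latticeFactor_pos p β h β' h' a hn (hτ n hn).1).le

/-- Moment bounds under the conditional Gibbs measure. -/
theorem LaplaceData.exists_moment_le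
    (H : LaplaceData m (freeEnergy p β h) (energy p β' h') D a c b κ C ε) {τ : ℕ → ℝ} (hτ : IsRootScale m τ) (l : ℕ) :
    ∃ K : ℝ, 0 ≤ K ∧ ∀ n : ℕ, 1 ≤ n →
      0 < spinSum n (gibbsExponent p β h β' h' n (τ n)) (D.indicator 1) →
      spinSum n (gibbsExponent p β h β' h' n (τ n)) (D.indicator fun x => |τ n * (x - a)| ^ l)
        / spinSum n (gibbsExponent p β h β' h' n (τ n)) (D.indicator 1) ≤ K := by
  obtain ⟨K, hK, hle⟩ := H.latticeSum_abs_pow_le l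
  obtain ⟨z, hz, hz'⟩ := H.exists_mass_lower_bound hτ
  refine ⟨K / z, by positivity, fun n hn hpos => ?_⟩
  have hf := latticeFactor_pos p β h β' h' a hn (hτ n hn).1
  have h1 := hle n (τ n) hn (hτ n hn).1 (hτ n hn).2
  rw [latticeSum_eq] at h1
  rw [← mul_div_mul_left _ _ hf.ne']
  exact div_le_div₀ hK h1 hz (hz' n hn hpos)

/-- The substitution `x = 2 * y` reflects the slope of `x ↦ 2 x - 1`: the magnetization fluctuates
twice as much as the fraction of plus spins. -/
theorem LaplaceData.integral_tilted
    (H : LaplaceData m (freeEnergy p β h) (energy p β' h') D a c b κ C ε) (g : ℝ → ℝ) :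
    ∫ x, g x ∂(volume.tilted fun x : ℝ => c * (x / 2) ^ (2 * m) + b * (x / 2))
      = (stirlingConst a * ∫ y, g (2 * y) * Real.exp (c * y ^ (2 * m) + b * y))
        / laplaceMass m a c b := by
  have hG := H.stirlingConst_pos
  have h1 := Measure.integral_comp_mul_left
    (fun x : ℝ => Real.exp (c * (x / 2) ^ (2 * m) + b * (x / 2))) 2
  have h2 := Measure.integral_comp_mul_left
    (fun x : ℝ => g x * Real.exp (c * (x / 2) ^ (2 * m) + b * (x / 2))) 2
  simp only [mul_div_cancel_left₀ _ (two_ne_zero' ℝ)] at h1 h2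
  rw [MeasureTheory.integral_tilted, laplaceMass, mul_div_mul_left _ _ hG.ne', h1, h2]
  simp only [smul_eq_mul]
  rw [mul_div_mul_left _ _ (by norm_num), ← integral_div]
  exact integral_congr_ae (Eventually.of_forall fun x => by ring)

/-- The Wasserstein rate for the conditional Gibbs measure. -/
theorem LaplaceData.exists_wasserstein_le
    (H : LaplaceData m (freeEnergy p β h) (energy p β' h') D a c b κ C ε) {τ : ℕ → ℝ} (hτ : IsRootScale m τ) :
    ∃ K : ℝ, ∀ n : ℕ, 1 ≤ n →
      0 < spinSum n (gibbsExponent p β h β' h' n (τ n)) (D.indicator 1) →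
      wassersteinDist
        (((gibbs fun ω : Config n => gibbsExponent p β h β' h' n (τ n) (plusFraction ω))[|
          {ω | plusFraction ω ∈ D}]).map fun ω => 2 * (τ n * (plusFraction ω - a)))
        (volume.tilted fun x : ℝ => c * (x / 2) ^ (2 * m) + b * (x / 2))
        ≤ ENNReal.ofReal (K / τ n) := by
  obtain ⟨K, hK, hle⟩ := H.abs_latticeSum_sub_le
  obtain ⟨K₁, hK₁, hle₁⟩ := H.exists_abs_mass_sub_le hτ
  obtain ⟨z, hz, hz'⟩ := H.exists_mass_lower_bound hτ
  have hG := H.stirlingConst_pos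
  have hZ := H.laplaceMass_pos
  set Z := laplaceMass m a c b with hZdef
  set φ : ℝ → ℝ := fun y => Real.exp (c * y ^ (2 * m) + b * y) with hφ
  set J := stirlingConst a * ∫ y, 2 * ((1 + |y|) ^ 1 * φ y) with hJ
  have hJ0 : 0 ≤ J := mul_nonneg hG.le (integral_nonneg fun y => by positivity)
  refine ⟨2 * K / z + J * K₁ / (z * Z), fun n hn hpos => ?_⟩
  have ht0 : 0 < τ n := by linarith [(hτ n hn).1]
  set U := gibbsExponent p β h β' h' n (τ n) with hU
  refine iSup₂_le fun g hg => ENNReal.ofReal_le_ofReal ?_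
  have hgl : ∀ x y, |g x - g y| ≤ |x - y| := fun x y => by
    have := hg.dist_le_mul x y
    simpa [Real.dist_eq] using this
  -- Subtracting `g 0` leaves the difference of expectations unchanged, and `g₀` has growth and
  -- Lipschitz constant `2` whatever `g` is; hence one bound for the whole supremum.
  set g₀ : ℝ → ℝ := fun y => g (2 * y) - g 0 with hg₀
  have hg₀1 : ∀ y, |g₀ y| ≤ 2 * (1 + |y|) := fun y => by
    have := hgl (2 * y) 0
    rw [sub_zero, abs_mul, abs_two] at this
    have h2 := abs_nonneg y
    linarith
  have hg₀2 : ∀ y w, |g₀ y - g₀ w| ≤ 2 * |y - w| := fun y w => by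
    have := hgl (2 * y) (2 * w)
    rw [← mul_sub, abs_mul, abs_two] at this
    simpa [hg₀] using this
  have hmap : ∫ x, g x ∂(((gibbs fun ω : Config n => U (plusFraction ω))[|
          {ω | plusFraction ω ∈ D}]).map fun ω => 2 * (τ n * (plusFraction ω - a)))
      = spinSum n U (D.indicator fun x => g (2 * (τ n * (x - a))))
        / spinSum n U (D.indicator 1) := by
    rw [integral_map (measurable_of_finite _).aemeasurable hg.continuous.aestronglyMeasurable]
    exact integral_cond_gibbs_plusFraction U (fun x => g (2 * (τ n * (x - a)))) D
  have hsplit : spinSum n U (D.indicator fun x => g (2 * (τ n * (x - a))))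
      = spinSum n U (D.indicator fun x => g₀ (τ n * (x - a)))
        + g 0 * spinSum n U (D.indicator 1) := by
    rw [← spinSum_add_const_mul]
    congr 1
    ext x
    by_cases hx : x ∈ D <;> simp [hx, hg₀]
  have hint₀ : Integrable fun y => g₀ y * φ y := by
    refine ((H.integrable_pow_mul_exp 1).const_mul 2).mono'
      (Continuous.aestronglyMeasurable ?_) (Eventually.of_forall fun y => ?_)
    · have := hg.continuous
      fun_prop
    · rw [norm_mul, Real.norm_eq_abs, Real.norm_of_nonneg (Real.exp_pos _).le, ← mul_assoc, pow_one]
      exact mul_le_mul_of_nonneg_right (hg₀1 y) (Real.exp_pos _).le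
  have htilt : ∫ x, g x ∂(volume.tilted fun x : ℝ => c * (x / 2) ^ (2 * m) + b * (x / 2))
      = (stirlingConst a * ∫ y, g₀ y * φ y) / Z + g 0 := by
    rw [H.integral_tilted, ← hZdef, div_add' _ _ _ hZ.ne']
    congr 1
    rw [hZdef, laplaceMass, mul_left_comm (g 0), ← mul_add, ← integral_const_mul (g 0),
      ← integral_add hint₀ (H.integrable_exp.const_mul _)]
    congr 1
    refine integral_congr_ae (Eventually.of_forall fun y => ?_)
    simp only [hg₀, hφ]
    ring
  rw [hmap, hsplit, htilt, add_div, mul_div_cancel_right₀ _ hpos.ne', add_sub_add_right_eq_sub]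
  have hf := latticeFactor_pos p β h β' h' a hn (hτ n hn).1
  rw [← mul_div_mul_left _ _ hf.ne', ← latticeSum_eq]
  have e₁ := hle n (τ n) g₀ 2 hn (hτ n hn).1 (hτ n hn).2 hg₀1 hg₀2
  have e₂ := hle₁ n hn
  have e₃ := hz' n hn hpos
  set Nn := latticeSum (freeEnergy p β h) (energy p β' h') a n (τ n)
    (D.indicator fun x => g₀ (τ n * (x - a)))
  set Zn := latticeFactor p β h β' h' a n (τ n) * spinSum n U (D.indicator 1)
  set N := stirlingConst a * ∫ y, g₀ y * φ y with hN
  have hNJ : |N| ≤ J := by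
    rw [hN, hJ, abs_mul, abs_of_pos hG]
    refine mul_le_mul_of_nonneg_left (abs_integral_le_integral_abs.trans ?_) hG.le
    refine integral_mono hint₀.abs ((H.integrable_pow_mul_exp 1).const_mul 2) fun y => ?_
    change |g₀ y * φ y| ≤ 2 * ((1 + |y|) ^ 1 * φ y)
    rw [abs_mul, abs_of_pos (Real.exp_pos _), ← mul_assoc, pow_one]
    exact mul_le_mul_of_nonneg_right (hg₀1 y) (Real.exp_pos _).le
  have hZn : 0 < Zn := hz.trans_le e₃
  -- The numerators differ by `O(1 / τ n)`; so do the normalizations, and they act on a numerator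
  -- bounded by `J` uniformly in `g`.
  have e : Nn / Zn - N / Z = (Nn - N) / Zn - N * (Zn - Z) / (Zn * Z) := by
    field_simp
    ring
  rw [e]
  calc |(Nn - N) / Zn - N * (Zn - Z) / (Zn * Z)|
      ≤ |Nn - N| / Zn + |N| * |Zn - Z| / (Zn * Z) := by
        refine (abs_sub _ _).trans (le_of_eq ?_)
        rw [abs_div, abs_div, abs_mul N, abs_of_pos hZn, abs_of_pos (mul_pos hZn hZ)]
    _ ≤ 2 * K / τ n / z + J * (K₁ / τ n) / (z * Z) := by
        gcongr
    _ = (2 * K / z + J * K₁ / (z * Z)) / τ n := by field_simp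

end PSpin

/-! ### Several maximizers: windows, masses and limiting probabilities -/

namespace PSpin

variable {p m : ℕ} {β h β' h' a : ℝ}

theorem freeEnergy_eq_of_mem_maximizers {b : ℝ} (ha : a ∈ maximizers p β h)
    (hb : b ∈ maximizers p β h) : freeEnergy p β h a = freeEnergy p β h b :=
  le_antisymm (hb.2 ha.1) (ha.2 hb.1)

/-- Laplace's method applies at a regular maximizer, in any window that separates it from the other
maximizers. -/
theorem exists_laplaceData (hm : 1 ≤ m)
    (hr : ∀ b ∈ maximizers p β h, IsRegular (freeEnergy p β h) m b) (ha : a ∈ maximizers p β h)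
    (β' h' : ℝ) {D : Set ℝ} {ε r : ℝ} (hε : 0 < ε)
    (hεD : ∀ x ∈ Set.Icc (0 : ℝ) 1, |x - a| ≤ ε → x ∈ D) (hrpos : 0 < r)
    (hsep : ∀ x ∈ Set.Icc (0 : ℝ) 1, x ∈ D → ∀ b ∈ maximizers p β h, r * |x - a| ≤ |x - b|) :
    ∃ κ C ε : ℝ, LaplaceData m (freeEnergy p β h) (energy p β' h') D a
      (iteratedDeriv (2 * m) (freeEnergy p β h) a / (2 * m).factorial)
      (deriv (energy p β' h') a) κ C ε := by
  have hI := maximizers_subset_Ioo p β h ha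
  obtain ⟨CA, hCA, hA⟩ := (hr a ha).taylor hm hI
  obtain ⟨CB, hCB, hB⟩ := energy_taylor p β' h' hI
  obtain ⟨κ, hκ, hdrop⟩ := exists_freeEnergy_le hm rfl hr
  set c := iteratedDeriv (2 * m) (freeEnergy p β h) a / (2 * m).factorial with hc
  have hc0 : c < 0 := div_neg_of_neg_of_pos (hr a ha).2 (by positivity)
  -- The global drop is measured from some maximizer `b`; separation replaces `|x - b|` by `r * |x -
  -- a|`, hence `κ * r ^ (2 * m)`. The entry `-c` secures `le_neg_kappa`, and the last witness keeps
  -- the neighbourhood of `a` inside `(0, 1)`.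
  refine ⟨min (κ * r ^ (2 * m)) (-c), max CA CB, min ε (min (a / 2) ((1 - a) / 2)),
    ⟨hm, ?_, ?_, ?_, ?_, ?_, ?_, ?_, ?_, ?_, ?_⟩⟩
  · have := min_le_right ε (min (a / 2) ((1 - a) / 2))
    have := min_le_left (a / 2) ((1 - a) / 2)
    linarith [hI.1]
  · have := min_le_right ε (min (a / 2) ((1 - a) / 2))
    have := min_le_right (a / 2) ((1 - a) / 2)
    linarith [hI.2]
  · exact lt_min hε (lt_min (by linarith [hI.1]) (by linarith [hI.2]))
  · exact lt_min (by positivity) (by linarith)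
  · have := min_le_right (κ * r ^ (2 * m)) (-c)
    linarith
  · exact le_max_of_le_left hCA
  · exact fun x hx => (hA x hx).trans
      (mul_le_mul_of_nonneg_right (le_max_left _ _) (by positivity))
  · exact fun x hx => (hB x hx).trans
      (mul_le_mul_of_nonneg_right (le_max_right _ _) (by positivity))
  · intro x hx hxD
    obtain ⟨b, hb, hle⟩ := hdrop x hx
    rw [← freeEnergy_eq_of_mem_maximizers ha hb] at hle
    refine hle.trans ?_
    have h1 := pow_le_pow_left₀ (by positivity) (hsep x hx hxD b hb) (2 * m)
    rw [mul_pow, (even_two_mul m).pow_abs, (even_two_mul m).pow_abs] at h1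
    have h2 : min (κ * r ^ (2 * m)) (-c) * (x - a) ^ (2 * m)
        ≤ κ * r ^ (2 * m) * (x - a) ^ (2 * m) :=
      mul_le_mul_of_nonneg_right (min_le_left _ _) ((even_two_mul m).pow_nonneg _)
    have h3 := mul_le_mul_of_nonneg_left h1 hκ.le
    linarith
  · exact fun x hx hxa => hεD x hx (hxa.trans (min_le_left _ _))

theorem isRootScale_sqrt : IsRootScale 1 fun n => √(n : ℝ) := by
  intro n hn
  have : (1 : ℝ) ≤ n := by exact_mod_cast hn
  exact ⟨Real.one_le_sqrt.2 this, by simp⟩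

theorem exp_neg_mul_le_div {η t : ℝ} (hη : 0 < η) (ht : 0 < t) :
    Real.exp (-η * t) ≤ 1 / η / t := by
  have h := Real.add_one_le_exp (η * t)
  rw [neg_mul, Real.exp_neg, div_div, one_div]
  exact inv_anti₀ (by positivity) (by linarith)

/-- Applied to the maximizers, the fibers of `ν` cut the line into one window for each of them; ties
are broken by choice. -/
theorem exists_nearest {s : Finset ℝ} (hs : s.Nonempty) :
    ∃ ν : ℝ → ℝ, ∀ x, ν x ∈ s ∧ ∀ b ∈ s, |x - ν x| ≤ |x - b| := by
  choose ν hν using fun x : ℝ => s.exists_min_image (fun b => |x - b|) hs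
  exact ⟨ν, hν⟩

theorem exists_pos_lt_of_finset (s : Finset ℝ) (a : ℝ) {d : ℝ → ℝ} (hd : ∀ b ∈ s, b ≠ a → 0 < d b) :
    ∃ r : ℝ, 0 < r ∧ ∀ b ∈ s, b ≠ a → r < d b := by
  have h1 : ∀ᶠ r : ℝ in 𝓝[>] 0, ∀ b ∈ s, b ≠ a → r < d b := by
    rw [Filter.eventually_all_finset]
    intro b hb
    by_cases hba : b = a
    · simp [hba]
    · filter_upwards [nhdsWithin_le_nhds (Iio_mem_nhds (hd b hb hba))] with r hr _ using hr
  obtain ⟨r, hr, hr0⟩ := (h1.and self_mem_nhdsWithin).exists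
  exact ⟨r, hr0, hr⟩

/-- The factor `1 / √(2π)` is common to all maximizers and cancels in the limiting probabilities. -/
theorem laplaceMass_one_eq_weight (p : ℕ) (β h β' h' : ℝ) (ha : a ∈ Set.Ioo (0 : ℝ) 1) :
    laplaceMass 1 a (iteratedDeriv (2 * 1) (freeEnergy p β h) a / (2 * 1).factorial)
      (deriv (energy p β' h') a) = (√(2 * Real.pi))⁻¹ * weight p β h β' h' a := by
  have h1 : 0 < 1 - a := by linarith [ha.2]
  rw [laplaceMass, stirlingConst, weight, Real.sqrt_mul (by positivity), mul_inv, mul_assoc]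
  simp

section FiniteMaximizers

variable {s : Finset ℝ}

theorem exists_mem_dominant (B : ℝ → ℝ) (hs : s.Nonempty) : ∃ a, a ∈ dominant B s := by
  obtain ⟨a, ha, hmax⟩ := s.exists_max_image B hs
  exact ⟨a, by classical exact Finset.mem_filter.2 ⟨ha, hmax⟩⟩

theorem mem_dominant {B : ℝ → ℝ} : a ∈ dominant B s ↔ a ∈ s ∧ ∀ b ∈ s, B b ≤ B a := by
  classical
  simp [dominant]

/-- Maximizers share the value of `A`, so a change of reference point shows only the gap in `B`.
This is the mechanism that selects the dominant ones. -/
theorem latticeFactor_eq_mul {a₀ : ℝ} (ha : a ∈ maximizers p β h) (ha₀ : a₀ ∈ maximizers p β h)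
    (n : ℕ) (t : ℝ) :
    latticeFactor p β h β' h' a₀ n t = latticeFactor p β h β' h' a n t
      * Real.exp (-(energy p β' h' a₀ - energy p β' h' a) * t) := by
  unfold latticeFactor
  rw [freeEnergy_eq_of_mem_maximizers ha ha₀, mul_assoc, mul_assoc, mul_assoc, ← Real.exp_add]
  congr 4
  ring

/-- The mass limits of windows around dominant and non-dominant maximizers. -/
theorem LaplaceData.dominant_mass {D : Set ℝ} {c b κ C ε a₀ : ℝ}
    (H : LaplaceData 1 (freeEnergy p β h) (energy p β' h') D a c b κ C ε)
    (hs : (s : Set ℝ) = maximizers p β h) (ha : a ∈ dominant (energy p β' h') s)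
    (ha₀ : a₀ ∈ dominant (energy p β' h') s) :
    ∃ K : ℝ, 0 ≤ K ∧ ∀ n : ℕ, 1 ≤ n →
      |latticeFactor p β h β' h' a₀ n √(n : ℝ)
          * spinSum n (gibbsExponent p β h β' h' n √(n : ℝ)) (D.indicator 1) - laplaceMass 1 a c b|
        ≤ K / √(n : ℝ) := by
  obtain ⟨K, hK, hle⟩ := H.exists_abs_mass_sub_le isRootScale_sqrt
  refine ⟨K, hK, fun n hn => ?_⟩
  rw [mem_dominant] at ha ha₀
  have h1 : energy p β' h' a₀ - energy p β' h' a = 0 :=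
    sub_eq_zero.2 (le_antisymm (ha.2 _ ha₀.1) (ha₀.2 _ ha.1))
  rw [latticeFactor_eq_mul (hs ▸ Finset.mem_coe.2 ha.1) (hs ▸ Finset.mem_coe.2 ha₀.1), h1]
  simpa using hle n hn

/-- Normalized at `a`, the mass is bounded; renormalized at a dominant `a₀`, it picks up `exp (-η
√n)` with `η` the positive gap in `B`. -/
theorem LaplaceData.nondominant_mass {D : Set ℝ} {c b κ C ε a₀ : ℝ}
    (H : LaplaceData 1 (freeEnergy p β h) (energy p β' h') D a c b κ C ε)
    (hs : (s : Set ℝ) = maximizers p β h) (has : a ∈ s) (ha : a ∉ dominant (energy p β' h') s)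
    (ha₀ : a₀ ∈ dominant (energy p β' h') s) :
    ∃ K η : ℝ, 0 ≤ K ∧ 0 < η ∧ ∀ n : ℕ, 1 ≤ n →
      latticeFactor p β h β' h' a₀ n √(n : ℝ)
          * spinSum n (gibbsExponent p β h β' h' n √(n : ℝ)) (D.indicator 1)
        ≤ K * Real.exp (-η * √(n : ℝ)) := by
  obtain ⟨K, hK, hle⟩ := H.exists_abs_mass_sub_le isRootScale_sqrt
  have hL := H.laplaceMass_pos
  have hη : 0 < energy p β' h' a₀ - energy p β' h' a := by
    rw [mem_dominant] at ha ha₀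
    refine sub_pos.2 (lt_of_le_of_ne (ha₀.2 a has) fun heq => ha ⟨has, fun b hb => ?_⟩)
    rw [heq]
    exact ha₀.2 b hb
  refine ⟨laplaceMass 1 a c b + K, _, by positivity, hη, fun n hn => ?_⟩
  rw [latticeFactor_eq_mul (hs ▸ Finset.mem_coe.2 has)
    (hs ▸ Finset.mem_coe.2 (mem_dominant.1 ha₀).1), mul_right_comm]
  refine mul_le_mul_of_nonneg_right ?_ (Real.exp_pos _).le
  have h1 := (abs_le.1 (hle n hn)).2
  have h2 : K / √(n : ℝ) ≤ K := div_le_self hK (isRootScale_sqrt n hn).1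
  linarith

theorem spinSum_finset_sum {ι : Type*} (n : ℕ) (U : ℝ → ℝ) (T : Finset ι) (F : ι → ℝ → ℝ) :
    spinSum n U (fun x => ∑ i ∈ T, F i x) = ∑ i ∈ T, spinSum n U (F i) := by
  unfold spinSum
  rw [Finset.sum_comm]
  refine Finset.sum_congr rfl fun k _ => ?_
  rw [Finset.sum_mul]

theorem spinSum_const_mul (n : ℕ) (U F : ℝ → ℝ) (r : ℝ) :
    spinSum n U (fun x => r * F x) = r * spinSum n U F := by
  unfold spinSum
  rw [Finset.mul_sum]
  refine Finset.sum_congr rfl fun k _ => ?_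
  ring

/-- Decomposition of a sum along the fibers of a map into `s`. -/
theorem spinSum_fiber {ν : ℝ → ℝ} (hν : ∀ x, ν x ∈ s) (n : ℕ) (U F : ℝ → ℝ) :
    spinSum n U (fun x => F (ν x)) = ∑ b ∈ s, F b * spinSum n U ({x | ν x = b}.indicator 1) := by
  have h1 : (fun x => F (ν x)) = fun x => ∑ b ∈ s, F b * ({x | ν x = b}.indicator 1 x) := by
    ext x
    rw [Finset.sum_eq_single (ν x)]
    · simp
    · intro b _ hb
      simp [Ne.symm hb]
    · exact fun h => absurd (hν x) h
  rw [h1, spinSum_finset_sum]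
  exact Finset.sum_congr rfl fun b _ => spinSum_const_mul n U _ _

/-- No maximizer is nearer than `a` to a point of its fiber, so the separation constant is `1`.
Points within `r / 2` of `a` belong to the fiber because the other maximizers are farther than `r`
from `a`. -/
theorem exists_laplaceData_fiber (hs : (s : Set ℝ) = maximizers p β h)
    (hr : ∀ a ∈ s, IsRegular (freeEnergy p β h) 1 a) (β' h' : ℝ) (ha : a ∈ s) {ν : ℝ → ℝ}
    (hν : ∀ x, ν x ∈ s ∧ ∀ b ∈ s, |x - ν x| ≤ |x - b|) :
    ∃ κ C ε : ℝ, LaplaceData 1 (freeEnergy p β h) (energy p β' h') {x | ν x = a} a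
      (iteratedDeriv (2 * 1) (freeEnergy p β h) a / (2 * 1).factorial)
      (deriv (energy p β' h') a) κ C ε := by
  obtain ⟨r, hr0, hrlt⟩ := exists_pos_lt_of_finset s a (d := fun b => |b - a|)
    fun b _ hb => abs_pos.2 (sub_ne_zero.2 hb)
  refine exists_laplaceData le_rfl (fun b hb => hr b (by rw [← hs] at hb; exact hb)) (hs ▸ ha) β' h'
    (half_pos hr0) ?_ one_pos ?_
  · intro x _ hx
    by_contra hne
    have h1 := hrlt (ν x) (hν x).1 hne
    have h2 := (hν x).2 a ha
    have h3 := abs_sub_le (ν x) x a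
    rw [abs_sub_comm (ν x) x] at h3
    linarith
  · intro x _ hx b hb
    rw [← hs] at hb
    rw [one_mul]
    have := (hν x).2 b hb
    rwa [hx] at this

/-- In the window every other maximizer `b` has `|x - b| ≥ |b - a| - δ / 2 > r`, while `|x - a| ≤
1`; so `min 1 r` is a separation constant. -/
theorem exists_laplaceData_window (hs : (s : Set ℝ) = maximizers p β h)
    (hr : ∀ a ∈ s, IsRegular (freeEnergy p β h) 1 a) (β' h' : ℝ) (ha : a ∈ s) {δ : ℝ} (hδ : 0 < δ)
    (hsep : ∀ b ∈ s, b ≠ a → δ < |(2 * b - 1) - (2 * a - 1)|) :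
    ∃ κ C ε : ℝ, LaplaceData 1 (freeEnergy p β h) (energy p β' h')
      {x | |2 * x - 1 - (2 * a - 1)| ≤ δ} a
      (iteratedDeriv (2 * 1) (freeEnergy p β h) a / (2 * 1).factorial)
      (deriv (energy p β' h') a) κ C ε := by
  have h2 : ∀ x y : ℝ, |2 * x - 1 - (2 * y - 1)| = 2 * |x - y| := fun x y => by
    rw [show 2 * x - 1 - (2 * y - 1) = 2 * (x - y) by ring, abs_mul, abs_two]
  obtain ⟨r, hr0, hrlt⟩ := exists_pos_lt_of_finset s a (d := fun b => |b - a| - δ / 2)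
    fun b hb hba => by
      have := hsep b hb hba
      rw [h2] at this
      linarith
  have hIa := maximizers_subset_Ioo p β h (hs ▸ Finset.mem_coe.2 ha)
  refine exists_laplaceData le_rfl (fun b hb => hr b (by rw [← hs] at hb; exact hb)) (hs ▸ ha) β' h'
    (half_pos hδ) ?_ (lt_min one_pos hr0) ?_
  · intro x _ hx
    change |2 * x - 1 - (2 * a - 1)| ≤ δ
    rw [h2]
    linarith
  · intro x hx hxD b hb
    rw [← hs] at hb
    change |2 * x - 1 - (2 * a - 1)| ≤ δ at hxD
    rw [h2] at hxD
    have hxa : |x - a| ≤ 1 := by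
      rw [abs_le]; constructor <;> linarith [hx.1, hx.2, hIa.1, hIa.2]
    by_cases hba : b = a
    · rw [hba]
      exact mul_le_of_le_one_left (abs_nonneg _) (min_le_left _ _)
    · have h3 := hrlt b hb hba
      have h4 := abs_sub_le b x a
      rw [abs_sub_comm b x] at h4
      calc min 1 r * |x - a| ≤ r * 1 :=
            mul_le_mul (min_le_right _ _) hxa (abs_nonneg _) hr0.le
        _ ≤ |x - b| := by linarith

/-- The total limiting mass of the dominant maximizers. -/
noncomputable def totalMass (p : ℕ) (β h β' h' : ℝ) (s : Finset ℝ) : ℝ :=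
  ∑ a ∈ dominant (energy p β' h') s,
    laplaceMass 1 a (iteratedDeriv (2 * 1) (freeEnergy p β h) a / (2 * 1).factorial)
      (deriv (energy p β' h') a)

/-- Summed over fibers: a dominant one contributes its Laplace mass up to `O(1 / √n)`, and a
nondominant one is exponentially small in `√n`, hence also `O(1 / √n)`. -/
theorem exists_abs_totalMass_sub_le (hs : (s : Set ℝ) = maximizers p β h)
    (hr : ∀ a ∈ s, IsRegular (freeEnergy p β h) 1 a) {a₀ : ℝ}
    (ha₀ : a₀ ∈ dominant (energy p β' h') s) :
    ∃ K : ℝ, 0 ≤ K ∧ ∀ n : ℕ, 1 ≤ n →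
      |latticeFactor p β h β' h' a₀ n √(n : ℝ)
          * spinSum n (gibbsExponent p β h β' h' n √(n : ℝ)) 1 - totalMass p β h β' h' s|
        ≤ K / √(n : ℝ) := by
  classical
  obtain ⟨ν, hν⟩ := exists_nearest ⟨a₀, (mem_dominant.1 ha₀).1⟩
  set L : ℝ → ℝ := fun a => laplaceMass 1 a
    (iteratedDeriv (2 * 1) (freeEnergy p β h) a / (2 * 1).factorial) (deriv (energy p β' h') a)
  have key : ∀ b, ∃ K : ℝ, b ∈ s → 0 ≤ K ∧ ∀ n : ℕ, 1 ≤ n →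
      |latticeFactor p β h β' h' a₀ n √(n : ℝ)
          * spinSum n (gibbsExponent p β h β' h' n √(n : ℝ)) ({x | ν x = b}.indicator 1)
          - (if b ∈ dominant (energy p β' h') s then L b else 0)| ≤ K / √(n : ℝ) := by
    intro b
    by_cases hb : b ∈ s
    · obtain ⟨κ, C, ε, H⟩ := exists_laplaceData_fiber hs hr β' h' hb hν
      by_cases hbd : b ∈ dominant (energy p β' h') s
      · obtain ⟨K, hK, hle⟩ := H.dominant_mass hs hbd ha₀
        refine ⟨K, fun _ => ⟨hK, fun n hn => ?_⟩⟩
        rw [if_pos hbd]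
        exact hle n hn
      · obtain ⟨K, η, hK, hη, hle⟩ := H.nondominant_mass hs hb hbd ha₀
        refine ⟨K * (1 / η), fun _ => ⟨by positivity, fun n hn => ?_⟩⟩
        have ht := (isRootScale_sqrt n hn).1
        have hpos : 0 ≤ spinSum n (gibbsExponent p β h β' h' n √(n : ℝ))
            ({x | ν x = b}.indicator 1) := by
          refine Finset.sum_nonneg fun k _ => mul_nonneg ?_ (by positivity)
          exact Set.indicator_nonneg (fun _ _ => zero_le_one) _
        rw [if_neg hbd, sub_zero, abs_of_nonneg (mul_nonneg
          (latticeFactor_pos p β h β' h' a₀ hn ht).le hpos)]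
        refine (hle n hn).trans ?_
        rw [mul_div_assoc]
        exact mul_le_mul_of_nonneg_left (exp_neg_mul_le_div hη (by linarith)) hK
    · exact ⟨0, fun h => absurd h hb⟩
  choose K hK using key
  refine ⟨∑ b ∈ s, K b, Finset.sum_nonneg fun b hb => (hK b hb).1, fun n hn => ?_⟩
  have h1 := spinSum_fiber (fun x => (hν x).1) n (gibbsExponent p β h β' h' n √(n : ℝ)) 1
  have h2 : totalMass p β h β' h' s
      = ∑ b ∈ s, if b ∈ dominant (energy p β' h') s then L b else 0 := by
    rw [totalMass, ← Finset.sum_filter]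
    refine Finset.sum_congr ?_ fun _ _ => rfl
    ext b
    simp only [Finset.mem_filter, mem_dominant]
    tauto
  have h3 : spinSum n (gibbsExponent p β h β' h' n √(n : ℝ)) 1 = ∑ b ∈ s,
      spinSum n (gibbsExponent p β h β' h' n √(n : ℝ)) ({x | ν x = b}.indicator 1) := by
    simp only [Pi.one_apply, one_mul] at h1
    exact h1
  rw [h3, h2, Finset.mul_sum, ← Finset.sum_sub_distrib, Finset.sum_div]
  exact (Finset.abs_sum_le_sum_abs _ _).trans (Finset.sum_le_sum fun b hb => (hK b hb).2 n hn)

theorem totalMass_pos (hs : (s : Set ℝ) = maximizers p β h)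
    (hr : ∀ a ∈ s, IsRegular (freeEnergy p β h) 1 a) {a₀ : ℝ}
    (ha₀ : a₀ ∈ dominant (energy p β' h') s) : 0 < totalMass p β h β' h' s := by
  obtain ⟨ν, hν⟩ := exists_nearest ⟨a₀, (mem_dominant.1 ha₀).1⟩
  refine Finset.sum_pos (fun b hb => ?_) ⟨a₀, ha₀⟩
  obtain ⟨κ, C, ε, H⟩ := exists_laplaceData_fiber hs hr β' h' (mem_dominant.1 hb).1 hν
  exact H.laplaceMass_pos

theorem exists_total_lower_bound (hs : (s : Set ℝ) = maximizers p β h)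
    (hr : ∀ a ∈ s, IsRegular (freeEnergy p β h) 1 a) {a₀ : ℝ}
    (ha₀ : a₀ ∈ dominant (energy p β' h') s) :
    ∃ z : ℝ, 0 < z ∧ ∀ n : ℕ, 1 ≤ n → z ≤ latticeFactor p β h β' h' a₀ n √(n : ℝ)
          * spinSum n (gibbsExponent p β h β' h' n √(n : ℝ)) 1 := by
  obtain ⟨K, hK, hle⟩ := exists_abs_totalMass_sub_le hs hr ha₀
  have hpos := totalMass_pos hs hr ha₀
  have hlim : Tendsto (fun n : ℕ => K / √(n : ℝ)) atTop (𝓝 0) :=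
    tendsto_const_nhds.div_atTop (isRootScale_sqrt.tendsto le_rfl)
  have hev : ∀ᶠ n : ℕ in atTop, totalMass p β h β' h' s / 2 ≤ latticeFactor p β h β' h' a₀ n √(n : ℝ)
          * spinSum n (gibbsExponent p β h β' h' n √(n : ℝ)) 1 := by
    filter_upwards [hlim.eventually_le_const (half_pos hpos), eventually_ge_atTop 1] with n h1 hn
    have := (abs_le.1 (hle n hn)).1
    linarith
  obtain ⟨z, hz, hle'⟩ := exists_pos_lower_bound (half_pos hpos) hev
  exact ⟨z, hz, fun n hn => hle' n (mul_pos
    (latticeFactor_pos p β h β' h' a₀ hn (isRootScale_sqrt n hn).1) (spinSum_one_pos _ _))⟩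

theorem prob_eq (hs : (s : Set ℝ) = maximizers p β h) (ha : a ∈ dominant (energy p β' h') s) :
    prob p β h β' h' (dominant (energy p β' h') s) a
      = laplaceMass 1 a (iteratedDeriv (2 * 1) (freeEnergy p β h) a / (2 * 1).factorial)
      (deriv (energy p β' h') a) / totalMass p β h β' h' s := by
  have hmem : ∀ b ∈ dominant (energy p β' h') s, b ∈ Set.Ioo (0 : ℝ) 1 := fun b hb =>
    maximizers_subset_Ioo p β h (hs ▸ Finset.mem_coe.2 (mem_dominant.1 hb).1)
  rw [prob, totalMass, Finset.sum_congr rfl fun b hb =>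
    laplaceMass_one_eq_weight p β h β' h' (hmem b hb), ← Finset.mul_sum,
    laplaceMass_one_eq_weight p β h β' h' (hmem a ha), mul_div_mul_left _ _ (by positivity)]

/-- The probability of a window around a dominant maximizer, with a rate. -/
theorem LaplaceData.exists_abs_prob_sub_le {D : Set ℝ} {κ C ε : ℝ}
    (H : LaplaceData 1 (freeEnergy p β h) (energy p β' h') D a
      (iteratedDeriv (2 * 1) (freeEnergy p β h) a / (2 * 1).factorial)
      (deriv (energy p β' h') a) κ C ε)
    (hs : (s : Set ℝ) = maximizers p β h)
    (hr : ∀ a ∈ s, IsRegular (freeEnergy p β h) 1 a) (ha : a ∈ dominant (energy p β' h') s) :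
    ∃ K : ℝ, 0 ≤ K ∧ ∀ n : ℕ, 1 ≤ n →
      |spinSum n (gibbsExponent p β h β' h' n √(n : ℝ)) (D.indicator 1)
          / spinSum n (gibbsExponent p β h β' h' n √(n : ℝ)) 1
        - prob p β h β' h' (dominant (energy p β' h') s) a| ≤ K / √(n : ℝ) := by
  obtain ⟨K₁, hK₁, h₁⟩ := H.dominant_mass hs ha ha
  obtain ⟨K₂, hK₂, h₂⟩ := exists_abs_totalMass_sub_le hs hr ha
  obtain ⟨z, hz, hz'⟩ := exists_total_lower_bound hs hr ha
  have hT := totalMass_pos hs hr ha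
  have hL := H.laplaceMass_pos
  rw [prob_eq hs ha]
  set T := totalMass p β h β' h' s
  set L := laplaceMass 1 a (iteratedDeriv (2 * 1) (freeEnergy p β h) a / (2 * 1).factorial)
      (deriv (energy p β' h') a)
  refine ⟨K₁ / z + L * K₂ / (z * T), by positivity, fun n hn => ?_⟩
  have ht := (isRootScale_sqrt n hn).1
  have ht0 : 0 < √(n : ℝ) := by linarith
  have hf := latticeFactor_pos p β h β' h' a hn ht
  rw [← mul_div_mul_left _ _ hf.ne']
  have e₁ := h₁ n hn
  have e₂ := h₂ n hn
  have e₃ := hz' n hn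
  generalize latticeFactor p β h β' h' a n √(n : ℝ)
    * spinSum n (gibbsExponent p β h β' h' n √(n : ℝ)) (D.indicator 1) = x at *
  generalize latticeFactor p β h β' h' a n √(n : ℝ)
    * spinSum n (gibbsExponent p β h β' h' n √(n : ℝ)) 1 = y at *
  have hy : 0 < y := hz.trans_le e₃
  have e : x / y - L / T = (x - L) / y - L * (y - T) / (y * T) := by
    field_simp
    ring
  rw [e]
  calc |(x - L) / y - L * (y - T) / (y * T)|
      ≤ |x - L| / y + L * |y - T| / (y * T) := by
        refine (abs_sub _ _).trans (le_of_eq ?_)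
        rw [abs_div, abs_div, abs_mul L, abs_of_pos hy, abs_of_pos (mul_pos hy hT), abs_of_pos hL]
    _ ≤ K₁ / √(n : ℝ) / z + L * (K₂ / √(n : ℝ)) / (z * T) := by gcongr
    _ = (K₁ / z + L * K₂ / (z * T)) / √(n : ℝ) := by field_simp

end FiniteMaximizers

end PSpin

/-! ### Exponential concentration and the law of large numbers -/

namespace PSpin

variable {p : ℕ} {β h β' h' a a₀ : ℝ} {s : Finset ℝ}

/-- The fractions of plus spins at distance more than `δ / 2` from `s`. -/
def awayFrom (s : Finset ℝ) (δ : ℝ) : Set ℝ := {x | ∀ a ∈ s, δ < |2 * x - 1 - (2 * a - 1)|}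

theorem abs_two_mul_sub (x y : ℝ) : |2 * x - 1 - (2 * y - 1)| = 2 * |x - y| := by
  rw [show 2 * x - 1 - (2 * y - 1) = 2 * (x - y) by ring, abs_mul, abs_two]

/-- Farther than `δ / 2` from every maximizer, `A` has lost at least `κ (δ / 2) ^ 2`. The entropy
bound handles each of the `n + 1` terms without Stirling's formula, the polynomial part of
`latticeFactor` is `1` at scale `√n`, and `B` costs at most `L √n`. -/
theorem exists_latticeFactor_mul_awayFrom_le (hs : (s : Set ℝ) = maximizers p β h)
    (hr : ∀ a ∈ s, IsRegular (freeEnergy p β h) 1 a) (β' h' : ℝ) (ha₀ : a₀ ∈ s)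
    {δ : ℝ} (hδ : 0 < δ) :
    ∃ η L : ℝ, 0 < η ∧ 0 ≤ L ∧ ∀ n : ℕ, 1 ≤ n →
      latticeFactor p β h β' h' a₀ n √(n : ℝ)
          * spinSum n (gibbsExponent p β h β' h' n √(n : ℝ)) ((awayFrom s δ).indicator 1)
        ≤ (n + 1) * Real.exp (-η * n + L * √(n : ℝ)) := by
  have hr' : ∀ b ∈ maximizers p β h, IsRegular (freeEnergy p β h) 1 b := fun b hb =>
    hr b (by rw [← hs] at hb; exact hb)
  have ha₀m : a₀ ∈ maximizers p β h := hs ▸ Finset.mem_coe.2 ha₀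
  obtain ⟨κ, hκ, hdrop⟩ := exists_freeEnergy_le le_rfl rfl hr'
  obtain ⟨L, hL⟩ := isCompact_Icc.exists_bound_of_continuousOn (s := Set.Icc (0 : ℝ) 1)
    (((contDiff_energy p β' h' (n := 0)).continuous.sub
      (continuous_const (y := energy p β' h' a₀))).continuousOn)
  have hL0 : 0 ≤ L := (norm_nonneg _).trans (hL a₀ ha₀m.1)
  refine ⟨κ * (δ / 2) ^ 2, L, by positivity, hL0, fun n hn => ?_⟩
  have hn0 : (0 : ℝ) < n := by exact_mod_cast hn
  set t := √(n : ℝ) with ht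
  have ht0 : 0 < t := Real.sqrt_pos.2 hn0
  have htt : t * t = n := Real.mul_self_sqrt hn0.le
  set W := Real.exp (-(κ * (δ / 2) ^ 2) * n + L * t) with hW
  have hsum : latticeFactor p β h β' h' a₀ n t
      * spinSum n (gibbsExponent p β h β' h' n t) ((awayFrom s δ).indicator 1)
      ≤ ∑ k ∈ Finset.range (n + 1), W := by
    unfold spinSum
    rw [Finset.mul_sum]
    refine Finset.sum_le_sum fun k hk => ?_
    have hkn : k ≤ n := Nat.lt_succ_iff.1 (Finset.mem_range.1 hk)
    set x : ℝ := (k : ℝ) / n with hx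
    by_cases hxE : x ∈ awayFrom s δ
    · rw [Set.indicator_of_mem hxE, Pi.one_apply, one_mul]
      have hxI : x ∈ Set.Icc (0 : ℝ) 1 :=
        ⟨by positivity, (div_le_one hn0).2 (by exact_mod_cast hkn)⟩
      obtain ⟨b, hb, hle⟩ := hdrop x hxI
      rw [freeEnergy_eq_of_mem_maximizers hb ha₀m, mul_one] at hle
      have hfar : (δ / 2) ^ 2 ≤ (x - b) ^ 2 := by
        rw [← hs] at hb
        have := hxE b hb
        rw [abs_two_mul_sub] at this
        rw [← sq_abs (x - b)]
        exact pow_le_pow_left₀ (by positivity) (by linarith) 2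
      have h1 : freeEnergy p β h x - freeEnergy p β h a₀ ≤ -(κ * (δ / 2) ^ 2) := by
        have := mul_le_mul_of_nonneg_left hfar hκ.le
        linarith
      have h2 : energy p β' h' x - energy p β' h' a₀ ≤ L := (le_abs_self _).trans (hL x hxI)
      have hfac : latticeFactor p β h β' h' a₀ n t
          = Real.exp (-(n * freeEnergy p β h a₀ + t * energy p β' h' a₀)) := by
        rw [latticeFactor, ← ht, div_mul_eq_mul_div, htt, div_self hn0.ne', one_mul]
      have e : latticeFactor p β h β' h' a₀ n t
          * ((n.choose k : ℝ) * Real.exp (gibbsExponent p β h β' h' n t x))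
          = ((n.choose k : ℝ) * Real.exp (-(n * Real.binEntropy x)))
            * Real.exp (n * (freeEnergy p β h x - freeEnergy p β h a₀)
              + t * (energy p β' h' x - energy p β' h' a₀)) := by
        rw [hfac, mul_left_comm, ← Real.exp_add, mul_assoc, ← Real.exp_add]
        congr 2
        simp only [gibbsExponent, freeEnergy]
        ring
      rw [e]
      refine (mul_le_of_le_one_left (Real.exp_pos _).le
        (choose_mul_exp_neg_binEntropy_le_one hn hkn)).trans (Real.exp_le_exp.2 ?_)
      have := mul_le_mul_of_nonneg_left h1 hn0.le
      have := mul_le_mul_of_nonneg_left h2 ht0.le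
      linarith
    · rw [Set.indicator_of_notMem hxE, zero_mul, mul_zero]
      exact (Real.exp_pos _).le
  refine hsum.trans (le_of_eq ?_)
  rw [Finset.sum_const, Finset.card_range, nsmul_eq_mul]
  push_cast
  rfl

/-- As `n + 1 ≤ 4 exp √n`, all factors other than `exp (-η n)` fit in `exp (Q √n)`, and `Q √n ≤ η n
/ 2` once `√n ≥ 2 Q / η`. -/
theorem eventually_mul_exp_le {η L z : ℝ} (hη : 0 < η) (hz : 0 < z) :
    ∀ᶠ n : ℕ in atTop,
      ((n : ℝ) + 1) * Real.exp (-η * n + L * √(n : ℝ)) / z ≤ Real.exp (-(η / 2) * n) := by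
  set Q := |L| + 1 + |Real.log (4 / z)| with hQ
  have hsq := (isRootScale_sqrt.tendsto le_rfl).eventually_ge_atTop (2 / η * Q)
  filter_upwards [hsq, eventually_ge_atTop 1] with n h1 hn
  have hn1 : (1 : ℝ) ≤ n := by exact_mod_cast hn
  set t := √(n : ℝ) with ht
  have ht1 : 1 ≤ t := Real.one_le_sqrt.2 hn1
  have htt : t ^ 2 = n := Real.sq_sqrt (by linarith)
  have h2 : (n : ℝ) + 1 ≤ 4 * Real.exp t := by
    have := Real.quadratic_le_exp_of_nonneg (by linarith : 0 ≤ t)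
    linarith
  have h3 : (4 : ℝ) / z = Real.exp (Real.log (4 / z)) := (Real.exp_log (by positivity)).symm
  have h4 : Q * t ≤ η / 2 * n := by
    have h5 : Q ≤ η / 2 * t := by
      have := mul_le_mul_of_nonneg_left h1 (by positivity : 0 ≤ η / 2)
      have e : η / 2 * (2 / η * Q) = Q := by field_simp
      linarith
    rw [← htt]
    nlinarith
  calc ((n : ℝ) + 1) * Real.exp (-η * n + L * t) / z
      ≤ 4 * Real.exp t * Real.exp (-η * n + L * t) / z := by gcongr
    _ = 4 / z * (Real.exp t * Real.exp (-η * n + L * t)) := by ring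
    _ = Real.exp (Real.log (4 / z) + (t + (-η * n + L * t))) := by
      rw [h3, ← Real.exp_add, ← Real.exp_add, Real.exp_log (by positivity)]
    _ ≤ Real.exp (-(η / 2) * n) := by
      refine Real.exp_le_exp.2 ?_
      have f1 : L * t ≤ |L| * t := mul_le_mul_of_nonneg_right (le_abs_self L) (by linarith)
      have f2 : Real.log (4 / z) ≤ |Real.log (4 / z)| * t :=
        (le_abs_self _).trans (le_mul_of_one_le_right (abs_nonneg _) ht1)
      have e : Q * t = |L| * t + t + |Real.log (4 / z)| * t := by rw [hQ]; ring
      linarith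

/-- Exponential concentration around the maximizers. -/
theorem exists_awayFrom_le_exp (hs : (s : Set ℝ) = maximizers p β h)
    (hr : ∀ a ∈ s, IsRegular (freeEnergy p β h) 1 a) (hne : s.Nonempty) (β' h' : ℝ)
    {δ : ℝ} (hδ : 0 < δ) :
    ∃ c : ℝ, 0 < c ∧ ∀ᶠ n : ℕ in atTop,
      spinSum n (gibbsExponent p β h β' h' n √(n : ℝ)) ((awayFrom s δ).indicator 1)
        / spinSum n (gibbsExponent p β h β' h' n √(n : ℝ)) 1 ≤ Real.exp (-c * n) := by
  obtain ⟨a₀, ha₀⟩ := exists_mem_dominant (energy p β' h') hne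
  obtain ⟨η, L, hη, hL, hle⟩ :=
    exists_latticeFactor_mul_awayFrom_le hs hr β' h' (mem_dominant.1 ha₀).1 hδ
  obtain ⟨z, hz, hz'⟩ := exists_total_lower_bound hs hr ha₀
  refine ⟨η / 2, half_pos hη, ?_⟩
  filter_upwards [eventually_mul_exp_le (L := L) hη hz, eventually_ge_atTop 1] with n h1 hn
  have hf := latticeFactor_pos p β h β' h' a₀ hn (isRootScale_sqrt n hn).1
  refine le_trans ?_ h1
  rw [← mul_div_mul_left _ _ hf.ne']
  exact div_le_div₀ (by positivity) (hle n hn) hz (hz' n hn)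

/-- Concentration around the dominant maximizers. -/
theorem exists_awayFrom_dominant_le_exp (hs : (s : Set ℝ) = maximizers p β h)
    (hr : ∀ a ∈ s, IsRegular (freeEnergy p β h) 1 a) (hne : s.Nonempty) (β' h' : ℝ)
    {δ : ℝ} (hδ : 0 < δ) :
    ∃ c : ℝ, 0 < c ∧ ∀ᶠ n : ℕ in atTop,
      spinSum n (gibbsExponent p β h β' h' n √(n : ℝ))
          ((awayFrom (dominant (energy p β' h') s) δ).indicator 1)
        / spinSum n (gibbsExponent p β h β' h' n √(n : ℝ)) 1 ≤ Real.exp (-c * √(n : ℝ)) := by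
  classical
  obtain ⟨a₀, ha₀⟩ := exists_mem_dominant (energy p β' h') hne
  obtain ⟨c, hc, hconc⟩ := exists_awayFrom_le_exp hs hr hne β' h' hδ
  obtain ⟨z, hz, hz'⟩ := exists_total_lower_bound hs hr ha₀
  obtain ⟨ν, hν⟩ := exists_nearest hne
  set T := s.filter fun b => b ∉ dominant (energy p β' h') s with hT
  have key : ∀ b, ∃ K η : ℝ, b ∈ T → 0 ≤ K ∧ 0 < η ∧ ∀ n : ℕ, 1 ≤ n →
      latticeFactor p β h β' h' a₀ n √(n : ℝ)
          * spinSum n (gibbsExponent p β h β' h' n √(n : ℝ)) ({x | ν x = b}.indicator 1)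
        ≤ K * Real.exp (-η * √(n : ℝ)) := by
    intro b
    by_cases hb : b ∈ T
    · obtain ⟨hbs, hbd⟩ := Finset.mem_filter.1 hb
      obtain ⟨κ, C, ε, H⟩ := exists_laplaceData_fiber hs hr β' h' hbs hν
      obtain ⟨K, η, h1, h2, h3⟩ := H.nondominant_mass hs hbs hbd ha₀
      exact ⟨K, η, fun _ => ⟨h1, h2, h3⟩⟩
    · exact ⟨0, 0, fun h => absurd h hb⟩
  choose K η hK using key
  -- The point `a₀` exempted by `exists_pos_lt_of_finset` is dominant, hence not in `T`; so the rate
  -- `η₀` serves all of `T`.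
  obtain ⟨η₀, hη₀, hη₀le⟩ : ∃ η₀ : ℝ, 0 < η₀ ∧ ∀ b ∈ T, η₀ ≤ η b := by
    obtain ⟨r, hr0, hrlt⟩ := exists_pos_lt_of_finset T a₀ (d := η) fun b hb _ => (hK b hb).2.1
    refine ⟨r, hr0, fun b hb => (hrlt b hb ?_).le⟩
    rintro rfl
    exact (Finset.mem_filter.1 hb).2 ha₀
  set S := ∑ b ∈ T, K b with hS
  have hS0 : 0 ≤ S := Finset.sum_nonneg fun b hb => (hK b hb).1
  set c₀ := min c η₀ with hc₀
  have hc₀0 : 0 < c₀ := lt_min hc hη₀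
  refine ⟨c₀ / 2, half_pos hc₀0, ?_⟩
  have hlarge := (isRootScale_sqrt.tendsto le_rfl).eventually_ge_atTop
    (2 / c₀ * Real.log (1 + S / z))
  filter_upwards [hconc, hlarge, eventually_ge_atTop 1] with n h1 h2 hn
  have hn1 : (1 : ℝ) ≤ n := by exact_mod_cast hn
  set t := √(n : ℝ) with ht
  have ht1 : 1 ≤ t := (isRootScale_sqrt n hn).1
  have htn : t ≤ n := le_natCast_of_pow_eq le_rfl ht1 (isRootScale_sqrt n hn).2
  set U := gibbsExponent p β h β' h' n t with hU
  have hZ := spinSum_one_pos n U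
  have hf := latticeFactor_pos p β h β' h' a₀ hn ht1
  -- If the maximizer nearest to `x` is dominant, being away from it means being away from all of
  -- them; otherwise `x` lies in the fiber of a point of `T`.
  have hsplit : spinSum n U ((awayFrom (dominant (energy p β' h') s) δ).indicator 1)
      ≤ spinSum n U ((awayFrom s δ).indicator 1)
        + ∑ b ∈ T, spinSum n U ({x | ν x = b}.indicator 1) := by
    have := spinSum_add_const_mul n U ((awayFrom s δ).indicator 1)
      (fun x => ∑ b ∈ T, {x | ν x = b}.indicator 1 x) 1
    rw [one_mul, spinSum_finset_sum] at this
    rw [← this]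
    refine spinSum_mono fun k _ => ?_
    set x : ℝ := (k : ℝ) / n
    have hnn : ∀ b ∈ T, (0 : ℝ) ≤ {x | ν x = b}.indicator 1 x := fun b _ =>
      Set.indicator_nonneg (fun _ _ => zero_le_one) _
    by_cases hx : x ∈ awayFrom (dominant (energy p β' h') s) δ
    · rw [Set.indicator_of_mem hx, Pi.one_apply, one_mul]
      by_cases hd : ν x ∈ dominant (energy p β' h') s
      · have hxs : x ∈ awayFrom s δ := by
          intro b hb
          have := hx _ hd
          rw [abs_two_mul_sub] at this ⊢
          linarith [(hν x).2 b hb]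
        rw [Set.indicator_of_mem hxs, Pi.one_apply]
        exact le_add_of_nonneg_right (Finset.sum_nonneg hnn)
      · have hm : ν x ∈ T := Finset.mem_filter.2 ⟨(hν x).1, hd⟩
        have h3 := Finset.single_le_sum hnn hm
        have h4 : ({y | ν y = ν x}.indicator 1 x : ℝ) = 1 := by simp
        rw [h4] at h3
        exact h3.trans (le_add_of_nonneg_left (Set.indicator_nonneg (fun _ _ => zero_le_one) _))
    · rw [Set.indicator_of_notMem hx, one_mul]
      exact add_nonneg (Set.indicator_nonneg (fun _ _ => zero_le_one) _) (Finset.sum_nonneg hnn)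
  have hnon : (∑ b ∈ T, spinSum n U ({x | ν x = b}.indicator 1)) / spinSum n U 1
      ≤ S / z * Real.exp (-c₀ * t) := by
    rw [← mul_div_mul_left _ _ hf.ne', Finset.mul_sum, div_mul_eq_mul_div]
    refine div_le_div₀ (by positivity) ?_ hz (hz' n hn)
    rw [hS, Finset.sum_mul]
    refine Finset.sum_le_sum fun b hb => ((hK b hb).2.2 n hn).trans ?_
    refine mul_le_mul_of_nonneg_left (Real.exp_le_exp.2 ?_) (hK b hb).1
    have : c₀ ≤ η b := (min_le_right _ _).trans (hη₀le b hb)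
    rw [neg_mul, neg_mul]
    exact neg_le_neg (mul_le_mul_of_nonneg_right this (by linarith))
  have hexp : Real.exp (-c * n) ≤ Real.exp (-c₀ * t) := by
    refine Real.exp_le_exp.2 ?_
    rw [neg_mul, neg_mul]
    exact neg_le_neg (mul_le_mul (min_le_left _ _) htn (by linarith) hc.le)
  -- Half of the rate `c₀` is spent on the constant `1 + S / z`.
  have h3 : 1 + S / z ≤ Real.exp (c₀ / 2 * t) := by
    have h4 := mul_le_mul_of_nonneg_left h2 (half_pos hc₀0).le
    have e : c₀ / 2 * (2 / c₀ * Real.log (1 + S / z)) = Real.log (1 + S / z) := by field_simp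
    rw [e] at h4
    exact (Real.log_le_iff_le_exp (by positivity)).1 h4
  calc spinSum n U ((awayFrom (dominant (energy p β' h') s) δ).indicator 1) / spinSum n U 1
      ≤ (spinSum n U ((awayFrom s δ).indicator 1)
        + ∑ b ∈ T, spinSum n U ({x | ν x = b}.indicator 1)) / spinSum n U 1 := by gcongr
    _ ≤ Real.exp (-c₀ * t) + S / z * Real.exp (-c₀ * t) := by
      rw [add_div]
      exact add_le_add (h1.trans hexp) hnon
    _ = (1 + S / z) * Real.exp (-c₀ * t) := by ring
    _ ≤ Real.exp (c₀ / 2 * t) * Real.exp (-c₀ * t) := by gcongr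
    _ = Real.exp (-(c₀ / 2) * t) := by rw [← Real.exp_add]; congr 1; ring

/-- The limiting probabilities of the fibers of the nearest-maximizer map. -/
theorem tendsto_fiber_prob (hs : (s : Set ℝ) = maximizers p β h)
    (hr : ∀ a ∈ s, IsRegular (freeEnergy p β h) 1 a) (β' h' : ℝ) {ν : ℝ → ℝ}
    (hν : ∀ x, ν x ∈ s ∧ ∀ b ∈ s, |x - ν x| ≤ |x - b|) (ha : a ∈ s)
    [Decidable (a ∈ dominant (energy p β' h') s)] :
    Tendsto (fun n : ℕ => spinSum n (gibbsExponent p β h β' h' n √(n : ℝ))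
        ({x | ν x = a}.indicator 1) / spinSum n (gibbsExponent p β h β' h' n √(n : ℝ)) 1) atTop
      (𝓝 (if a ∈ dominant (energy p β' h') s
        then prob p β h β' h' (dominant (energy p β' h') s) a else 0)) := by
  obtain ⟨κ, C, ε, H⟩ := exists_laplaceData_fiber hs hr β' h' ha hν
  by_cases hd : a ∈ dominant (energy p β' h') s
  · rw [if_pos hd]
    obtain ⟨K, hK, hle⟩ := H.exists_abs_prob_sub_le hs hr hd
    rw [tendsto_iff_norm_sub_tendsto_zero]
    refine squeeze_zero' (Eventually.of_forall fun n => norm_nonneg _)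
      (eventually_atTop.2 ⟨1, fun n hn => hle n hn⟩) ?_
    exact tendsto_const_nhds.div_atTop (isRootScale_sqrt.tendsto le_rfl)
  · rw [if_neg hd]
    obtain ⟨a₀, ha₀⟩ := exists_mem_dominant (energy p β' h') ⟨a, ha⟩
    obtain ⟨K, η, hK, hη, hle⟩ := H.nondominant_mass hs ha hd ha₀
    obtain ⟨z, hz, hz'⟩ := exists_total_lower_bound hs hr ha₀
    have hlim : Tendsto (fun n : ℕ => K * (1 / η) / z / √(n : ℝ)) atTop (𝓝 0) :=
      tendsto_const_nhds.div_atTop (isRootScale_sqrt.tendsto le_rfl)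
    refine squeeze_zero' (Eventually.of_forall fun n => ?_)
      (eventually_atTop.2 ⟨1, fun n hn => ?_⟩) hlim
    · refine div_nonneg (Finset.sum_nonneg fun k _ => mul_nonneg ?_ (by positivity))
        (spinSum_one_pos _ _).le
      exact Set.indicator_nonneg (fun _ _ => zero_le_one) _
    · have ht : 1 ≤ √(n : ℝ) := (isRootScale_sqrt n hn).1
      have hf := latticeFactor_pos p β h β' h' a₀ hn ht
      have e : K * (1 / η) / z / √(n : ℝ) = K * (1 / η / √(n : ℝ)) / z := by ring
      rw [← mul_div_mul_left _ _ hf.ne', e]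
      refine div_le_div₀ (by positivity) ((hle n hn).trans ?_) hz (hz' n hn)
      exact mul_le_mul_of_nonneg_left (exp_neg_mul_le_div hη (by linarith)) hK

/-- The law of large numbers: convergence to the mixture over the dominant maximizers. -/
theorem tendsto_spinSum_boundedContinuous (hs : (s : Set ℝ) = maximizers p β h)
    (hr : ∀ a ∈ s, IsRegular (freeEnergy p β h) 1 a) (hne : s.Nonempty) (β' h' : ℝ)
    (f : BoundedContinuousFunction ℝ ℝ) :
    Tendsto (fun n : ℕ => spinSum n (gibbsExponent p β h β' h' n √(n : ℝ))
        (fun x => f (2 * x - 1)) / spinSum n (gibbsExponent p β h β' h' n √(n : ℝ)) 1) atTop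
      (𝓝 (∑ a ∈ dominant (energy p β' h') s,
        prob p β h β' h' (dominant (energy p β' h') s) a * f (2 * a - 1))) := by
  classical
  obtain ⟨ν, hν⟩ := exists_nearest hne
  -- With `f` frozen at the nearest maximizer only the fiber probabilities matter. The replacement
  -- costs at most `ε / 2` near the maximizers, and at most `2 * ‖f‖` on a set of exponentially
  -- small probability.
  have hlim : Tendsto (fun n : ℕ => spinSum n (gibbsExponent p β h β' h' n √(n : ℝ))
        (fun x => f (2 * ν x - 1)) / spinSum n (gibbsExponent p β h β' h' n √(n : ℝ)) 1) atTop
      (𝓝 (∑ a ∈ dominant (energy p β' h') s,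
        prob p β h β' h' (dominant (energy p β' h') s) a * f (2 * a - 1))) := by
    have e : ∑ a ∈ dominant (energy p β' h') s,
        prob p β h β' h' (dominant (energy p β' h') s) a * f (2 * a - 1)
        = ∑ a ∈ s, f (2 * a - 1) * (if a ∈ dominant (energy p β' h') s
          then prob p β h β' h' (dominant (energy p β' h') s) a else 0) := by
      simp_rw [mul_ite, mul_zero]
      rw [← Finset.sum_filter]
      refine Finset.sum_congr ?_ fun _ _ => mul_comm _ _
      ext b
      simp only [Finset.mem_filter, mem_dominant]
      tauto
    rw [e]
    refine (tendsto_finsetSum s fun a ha =>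
      (tendsto_fiber_prob hs hr β' h' hν ha).const_mul (f (2 * a - 1))).congr fun n => ?_
    have := spinSum_fiber (fun x => (hν x).1) n (gibbsExponent p β h β' h' n √(n : ℝ))
      fun x => f (2 * x - 1)
    rw [this, Finset.sum_div]
    exact Finset.sum_congr rfl fun b _ => (mul_div_assoc _ _ _).symm
  refine hlim.congr_dist ?_
  rw [Metric.tendsto_atTop]
  intro ε hε
  obtain ⟨δ, hδ, hδf⟩ : ∃ δ : ℝ, 0 < δ ∧ ∀ b ∈ s, ∀ y : ℝ, |y - (2 * b - 1)| ≤ δ →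
      |f y - f (2 * b - 1)| ≤ ε / 2 := by
    have h1 : ∀ᶠ δ : ℝ in 𝓝[>] 0, ∀ b ∈ s, ∀ y : ℝ, |y - (2 * b - 1)| ≤ δ →
        |f y - f (2 * b - 1)| ≤ ε / 2 := by
      rw [Filter.eventually_all_finset]
      intro b _
      obtain ⟨δ, hδ, hfδ⟩ := Metric.continuous_iff.1 f.continuous (2 * b - 1) (ε / 2) (half_pos hε)
      filter_upwards [nhdsWithin_le_nhds (Iio_mem_nhds hδ)] with r hr y hy
      exact (hfδ y (lt_of_le_of_lt hy hr)).le
    obtain ⟨δ, h, hδ⟩ := (h1.and self_mem_nhdsWithin).exists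
    exact ⟨δ, hδ, h⟩
  obtain ⟨c, hc, hconc⟩ := exists_awayFrom_le_exp hs hr hne β' h' hδ
  have hexp : Tendsto (fun n : ℕ => ε / 2 + 2 * ‖f‖ * Real.exp (-c * n)) atTop
      (𝓝 (ε / 2 + 2 * ‖f‖ * 0)) := by
    refine (((Real.tendsto_exp_atBot.comp ?_)).const_mul _).const_add _
    exact tendsto_natCast_atTop_atTop.const_mul_atTop_of_neg (by linarith)
  rw [mul_zero, add_zero] at hexp
  have hsmall := hexp.eventually_lt_const (half_lt_self hε)
  obtain ⟨N, hN⟩ := eventually_atTop.1 (hconc.and hsmall)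
  refine ⟨N, fun n hn => ?_⟩
  obtain ⟨h1, h2⟩ := hN n hn
  set U := gibbsExponent p β h β' h' n √(n : ℝ) with hU
  have hZ := spinSum_one_pos n U
  rw [dist_zero_right, Real.norm_of_nonneg dist_nonneg, Real.dist_eq, ← sub_div]
  have hpt : ∀ x : ℝ, |f (2 * ν x - 1) - f (2 * x - 1)|
      ≤ ε / 2 * 1 + 2 * ‖f‖ * (awayFrom s δ).indicator 1 x := by
    intro x
    by_cases hx : x ∈ awayFrom s δ
    · rw [Set.indicator_of_mem hx, Pi.one_apply, mul_one]
      have := f.dist_le_two_norm (2 * ν x - 1) (2 * x - 1)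
      rw [Real.dist_eq] at this
      linarith
    · rw [Set.indicator_of_notMem hx, mul_zero, add_zero, mul_one, abs_sub_comm]
      simp only [awayFrom, Set.mem_ofPred_eq, not_forall, not_lt] at hx
      obtain ⟨b, hb, hle⟩ := hx
      refine hδf (ν x) (hν x).1 _ ?_
      rw [abs_two_mul_sub] at hle ⊢
      linarith [(hν x).2 b hb]
  have hdiff : |spinSum n U (fun x => f (2 * ν x - 1)) - spinSum n U fun x => f (2 * x - 1)|
      ≤ ε / 2 * spinSum n U 1 + 2 * ‖f‖ * spinSum n U ((awayFrom s δ).indicator 1) := by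
    have e1 := spinSum_add_const_mul n U (fun x => f (2 * ν x - 1)) (fun x => f (2 * x - 1)) (-1)
    have e2 := spinSum_add_const_mul n U (fun x => ε / 2 * (1 : ℝ → ℝ) x)
      ((awayFrom s δ).indicator 1) (2 * ‖f‖)
    rw [spinSum_const_mul] at e2
    rw [neg_one_mul, ← sub_eq_add_neg] at e1
    rw [← e1, ← e2]
    unfold spinSum
    refine (Finset.abs_sum_le_sum_abs _ _).trans (Finset.sum_le_sum fun k _ => ?_)
    rw [abs_mul, abs_of_nonneg (by positivity : (0 : ℝ) ≤ (n.choose k : ℝ) * Real.exp _)]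
    refine mul_le_mul_of_nonneg_right ?_ (by positivity)
    beta_reduce
    rw [neg_one_mul, ← sub_eq_add_neg]
    exact hpt _
  rw [abs_div, abs_of_pos hZ]
  calc _ ≤ (ε / 2 * spinSum n U 1 + 2 * ‖f‖ * spinSum n U ((awayFrom s δ).indicator 1))
        / spinSum n U 1 := by gcongr
    _ = ε / 2 + 2 * ‖f‖ * (spinSum n U ((awayFrom s δ).indicator 1) / spinSum n U 1) := by
      field_simp
    _ ≤ ε / 2 + 2 * ‖f‖ * Real.exp (-c * n) := by gcongr
    _ < ε := h2

end PSpin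

/-! ### Limit theorems for the magnetization -/

namespace PSpin

variable {p : ℕ} {β h β' h' a : ℝ}

theorem magnetization_div {n : ℕ} (hn : 1 ≤ n) (ω : Config n) :
    magnetization ω / n = 2 * plusFraction ω - 1 := by
  have hn0 : (n : ℝ) ≠ 0 := by positivity
  rw [magnetization_eq hn, mul_div_cancel_left₀ _ hn0]

theorem gibbsR_real_setOf {n : ℕ} (hn : 1 ≤ n) (P : ℝ → Prop) :
    (gibbsR p β h β' h' n).real {ω | P (magnetization ω / n)}
      = spinSum n (gibbsExponent p β h β' h' n √(n : ℝ)) ({x | P (2 * x - 1)}.indicator 1)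
        / spinSum n (gibbsExponent p β h β' h' n √(n : ℝ)) 1 := by
  rw [← gibbs_real_plusFraction]
  have : {ω : Config n | P (magnetization ω / n)}
      = {ω | plusFraction ω ∈ {x : ℝ | P (2 * x - 1)}} := by
    ext ω
    change P (magnetization ω / n) ↔ P (2 * plusFraction ω - 1)
    rw [magnetization_div hn]
  rw [this]
  rfl

/-- The Gaussian limit law as an exponentially tilted Lebesgue measure. -/
theorem cltLaw_eq_tilted (hA : iteratedDeriv 2 (freeEnergy p β h) a < 0) :
    cltLaw p β h β' h' a = volume.tilted fun x : ℝ =>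
      iteratedDeriv (2 * 1) (freeEnergy p β h) a / (2 * 1).factorial * (x / 2) ^ (2 * 1)
        + deriv (energy p β' h') a * (x / 2) := by
  rw [cltLaw]
  simp only [mul_one, Nat.factorial_two, Nat.cast_ofNat]
  set A := iteratedDeriv 2 (freeEnergy p β h) a with hAdef
  set b := deriv (energy p β' h') a
  have hv : 0 < -4 / A := div_pos_of_neg_of_neg (by norm_num) hA
  set v := Real.toNNReal (-4 / A) with hvdef
  have hv0 : v ≠ 0 := (Real.toNNReal_pos.2 hv).ne'
  have hvc : (v : ℝ) = -4 / A := Real.coe_toNNReal _ hv.le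
  set μ := -2 * b / A with hμ
  -- Completing the square: `A x ^ 2 / 8 + b x / 2 = -(x - μ) ^ 2 / (2 v) - b ^ 2 / (2 A)`, so `K`
  -- is the normalizing constant of the tilted measure.
  set K := √(2 * Real.pi * v) * Real.exp (-b ^ 2 / (2 * A)) with hK
  have hvpos : (0 : ℝ) < v := by rw [hvc]; exact hv
  have hKpos : 0 < K := by positivity
  have hexp : ∀ x : ℝ, Real.exp (A / 2 * (x / 2) ^ 2 + b * (x / 2)) = K * gaussianPDFReal μ v x := by
    intro x
    rw [gaussianPDFReal, hK]
    have hs : √(2 * Real.pi * v) ≠ 0 := by positivity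
    have e : A / 2 * (x / 2) ^ 2 + b * (x / 2)
        = -b ^ 2 / (2 * A) + -(x - μ) ^ 2 / (2 * v) := by
      rw [hvc, hμ]
      have : A ≠ 0 := hA.ne
      field_simp
      ring
    rw [e, Real.exp_add]
    field_simp
  have hint : ∫ x : ℝ, Real.exp (A / 2 * (x / 2) ^ 2 + b * (x / 2)) = K := by
    simp_rw [hexp]
    rw [integral_const_mul, integral_gaussianPDFReal_eq_one _ hv0, mul_one]
  rw [gaussianReal_of_var_ne_zero _ hv0, Measure.tilted]
  congr 1
  ext x
  rw [hint, hexp, mul_div_cancel_left₀ _ hKpos.ne', gaussianPDF]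

theorem rpow_neg_div_two (n l : ℕ) : (n : ℝ) ^ (-(l : ℝ) / 2) = (√(n : ℝ) ^ l)⁻¹ := by
  rw [Real.sqrt_eq_rpow, ← Real.rpow_natCast, ← Real.rpow_mul (by positivity),
    ← Real.rpow_neg (by positivity)]
  congr 1
  ring

/-- Conditional moments. -/
theorem LaplaceData.exists_cond_moment_le {D : Set ℝ} {c b κ C ε : ℝ}
    (H : LaplaceData 1 (freeEnergy p β h) (energy p β' h') D a c b κ C ε) (l : ℕ) :
    ∃ K : ℝ, ∀ n : ℕ, 1 ≤ n →
      0 < spinSum n (gibbsExponent p β h β' h' n √(n : ℝ)) (D.indicator 1) →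
      ∫ ω, |magnetization ω / n - (2 * a - 1)| ^ l
          ∂((gibbsR p β h β' h' n)[|{ω | plusFraction ω ∈ D}])
        ≤ K * (n : ℝ) ^ (-(l : ℝ) / 2) := by
  obtain ⟨K, hK, hle⟩ := H.exists_moment_le isRootScale_sqrt l
  refine ⟨2 ^ l * K, fun n hn hpos => ?_⟩
  have hn0 : (0 : ℝ) < n := by exact_mod_cast hn
  have ht0 : 0 < √(n : ℝ) := Real.sqrt_pos.2 hn0
  have h1 := hle n hn hpos
  have h2 := integral_cond_gibbs_plusFraction (n := n) (gibbsExponent p β h β' h' n √(n : ℝ))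
    (fun x => |2 * x - 1 - (2 * a - 1)| ^ l) D
  have h3 : ∀ ω : Config n, |magnetization ω / n - (2 * a - 1)| ^ l
      = |2 * plusFraction ω - 1 - (2 * a - 1)| ^ l := fun ω => by rw [magnetization_div hn]
  have h4 : (D.indicator fun x => |2 * x - 1 - (2 * a - 1)| ^ l)
      = fun x => 2 ^ l * (√(n : ℝ) ^ l)⁻¹ * D.indicator (fun x => |√(n : ℝ) * (x - a)| ^ l) x := by
    ext x
    by_cases hx : x ∈ D
    · rw [Set.indicator_of_mem hx, Set.indicator_of_mem hx, abs_two_mul_sub, abs_mul,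
        abs_of_pos ht0, mul_pow, mul_pow]
      field_simp
    · rw [Set.indicator_of_notMem hx, Set.indicator_of_notMem hx, mul_zero]
  simp_rw [h3]
  refine (le_of_eq h2).trans ?_
  rw [h4, spinSum_const_mul, mul_div_assoc, rpow_neg_div_two]
  calc _ ≤ 2 ^ l * (√(n : ℝ) ^ l)⁻¹ * K := by gcongr
    _ = 2 ^ l * K * (√(n : ℝ) ^ l)⁻¹ := by ring

/-- The conditional central limit theorem with a rate. -/
theorem LaplaceData.exists_cond_clt {D : Set ℝ} {κ C ε : ℝ}
    (H : LaplaceData 1 (freeEnergy p β h) (energy p β' h') D a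
      (iteratedDeriv (2 * 1) (freeEnergy p β h) a / (2 * 1).factorial)
      (deriv (energy p β' h') a) κ C ε)
    (hA : iteratedDeriv 2 (freeEnergy p β h) a < 0) :
    ∃ K : ℝ, ∀ n : ℕ, 1 ≤ n →
      0 < spinSum n (gibbsExponent p β h β' h' n √(n : ℝ)) (D.indicator 1) →
      wassersteinDist (((gibbsR p β h β' h' n)[|{ω | plusFraction ω ∈ D}]).map
          fun ω => (magnetization ω - n * (2 * a - 1)) / √(n : ℝ))
        (cltLaw p β h β' h' a) ≤ ENNReal.ofReal (K / √(n : ℝ)) := by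
  obtain ⟨K, hK⟩ := H.exists_wasserstein_le isRootScale_sqrt
  refine ⟨K, fun n hn hpos => ?_⟩
  have hn0 : (0 : ℝ) < n := by exact_mod_cast hn
  have ht0 : 0 < √(n : ℝ) := Real.sqrt_pos.2 hn0
  have hX : (fun ω : Config n => (magnetization ω - n * (2 * a - 1)) / √(n : ℝ))
      = fun ω => 2 * (√(n : ℝ) * (plusFraction ω - a)) := by
    ext ω
    rw [magnetization_eq hn, div_eq_iff ht0.ne']
    linear_combination -2 * (plusFraction ω - a) * Real.mul_self_sqrt hn0.le
  rw [cltLaw_eq_tilted hA, hX]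
  exact hK n hn hpos

/-- With the whole line as window the conditional results become unconditional; both regimes with a
unique maximizer use this. -/
theorem cond_plusFraction_univ {n : ℕ} (μ : Measure (Config n)) [IsProbabilityMeasure μ] :
    μ[|{ω | plusFraction ω ∈ Set.univ}] = μ := by
  have : {ω : Config n | plusFraction ω ∈ Set.univ} = Set.univ := by ext; simp
  rw [this, cond_univ]

instance isProbabilityMeasure_gibbsR (n : ℕ) : IsProbabilityMeasure (gibbsR p β h β' h' n) :=
  isProbabilityMeasure_gibbs _

instance isProbabilityMeasure_gibbsS (n : ℕ) : IsProbabilityMeasure (gibbsS p β h β' h' n) :=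
  isProbabilityMeasure_gibbs _

theorem isRootScale_rpow : IsRootScale 2 fun n => (n : ℝ) ^ (1 / 4 : ℝ) := by
  intro n hn
  have h1 : (1 : ℝ) ≤ n := by exact_mod_cast hn
  refine ⟨Real.one_le_rpow h1 (by norm_num), ?_⟩
  rw [← Real.rpow_natCast, ← Real.rpow_mul (by linarith)]
  norm_num

theorem tendsto_integral_gibbsR {s : Finset ℝ} (hs : (s : Set ℝ) = maximizers p β h)
    (hr : ∀ a ∈ s, IsRegular (freeEnergy p β h) 1 a) (hne : s.Nonempty) (β' h' : ℝ)
    (f : BoundedContinuousFunction ℝ ℝ) :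
    Tendsto (fun n : ℕ => ∫ ω, f (magnetization ω / n) ∂(gibbsR p β h β' h' n)) atTop
      (𝓝 (∑ a ∈ dominant (energy p β' h') s,
        prob p β h β' h' (dominant (energy p β' h') s) a * f (2 * a - 1))) := by
  refine (tendsto_spinSum_boundedContinuous hs hr hne β' h' f).congr' ?_
  filter_upwards [eventually_ge_atTop 1] with n hn
  rw [← integral_gibbs_plusFraction]
  refine integral_congr_ae (Eventually.of_forall fun ω => ?_)
  exact congrArg f (magnetization_div hn ω).symm

theorem exists_gibbsR_awayFrom_le {s : Finset ℝ} (hs : (s : Set ℝ) = maximizers p β h)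
    (hr : ∀ a ∈ s, IsRegular (freeEnergy p β h) 1 a) (hne : s.Nonempty) (β' h' : ℝ)
    {δ : ℝ} (hδ : 0 < δ) :
    ∃ c : ℝ, 0 < c ∧ ∀ᶠ n : ℕ in atTop, (gibbsR p β h β' h' n).real
      {ω | ∀ a ∈ s, δ < |magnetization ω / n - (2 * a - 1)|} ≤ Real.exp (-c * n) := by
  obtain ⟨c, hc, hev⟩ := exists_awayFrom_le_exp hs hr hne β' h' hδ
  refine ⟨c, hc, ?_⟩
  filter_upwards [hev, eventually_ge_atTop 1] with n h1 hn
  rw [gibbsR_real_setOf hn fun y => ∀ a ∈ s, δ < |y - (2 * a - 1)|]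
  exact h1

/-- The regular region. -/
theorem regularRegion_limit (hθ : (β, h) ∈ regularRegion p) (ha : a ∈ maximizers p β h)
    (β' h' : ℝ) :
    IsRegular (freeEnergy p β h) 1 a ∧
    (∀ δ : ℝ, 0 < δ → ∃ c : ℝ, 0 < c ∧ ∀ᶠ n : ℕ in atTop,
      (gibbsR p β h β' h' n).real {ω | δ < |magnetization ω / n - (2 * a - 1)|}
        ≤ Real.exp (-c * n)) ∧
    (∀ f : BoundedContinuousFunction ℝ ℝ,
      Tendsto (fun n : ℕ => ∫ ω, f (magnetization ω / n) ∂(gibbsR p β h β' h' n))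
        atTop (𝓝 (f (2 * a - 1)))) ∧
    (∀ l : ℕ, ∃ C : ℝ, ∀ n : ℕ, 1 ≤ n →
      ∫ ω, |magnetization ω / n - (2 * a - 1)| ^ l ∂(gibbsR p β h β' h' n)
        ≤ C * (n : ℝ) ^ (-(l : ℝ) / 2)) ∧
    (∃ C : ℝ, ∀ n : ℕ, 1 ≤ n →
      wassersteinDist
        ((gibbsR p β h β' h' n).map fun ω => (magnetization ω - n * (2 * a - 1)) / √(n : ℝ))
        (cltLaw p β h β' h' a) ≤ ENNReal.ofReal (C / √(n : ℝ))) := by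
  obtain ⟨-, a', -, hmax, hne⟩ := hθ
  obtain rfl : a = a' := by
    have := ha
    rw [hmax] at this
    exact this
  have hreg := isRegular_one_of_ne_zero ha hne
  have hs : (({a} : Finset ℝ) : Set ℝ) = maximizers p β h := by rw [hmax]; simp
  have hr : ∀ b ∈ ({a} : Finset ℝ), IsRegular (freeEnergy p β h) 1 b := by
    intro b hb
    rwa [Finset.mem_singleton.1 hb]
  have hne' : ({a} : Finset ℝ).Nonempty := Finset.singleton_nonempty a
  obtain ⟨κ, C, ε, H⟩ := exists_laplaceData (D := Set.univ) le_rfl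
    (fun b hb => hr b (by rw [← hs] at hb; exact hb)) ha β' h' one_pos
    (fun _ _ _ => Set.mem_univ _) one_pos fun x _ _ b hb => by
      rw [hmax] at hb
      rw [one_mul, Set.mem_singleton_iff.1 hb]
  have hpos : ∀ n : ℕ, 0 < spinSum n (gibbsExponent p β h β' h' n √(n : ℝ))
      (Set.univ.indicator 1) := fun n => by
    rw [Set.indicator_univ]
    exact spinSum_one_pos _ _
  refine ⟨hreg, fun δ hδ => ?_, fun f => ?_, fun l => ?_, ?_⟩
  · simpa using exists_gibbsR_awayFrom_le hs hr hne' β' h' hδ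
  · have hlim := tendsto_integral_gibbsR hs hr hne' β' h' f
    have hdom : dominant (energy p β' h') {a} = {a} := by
      ext b
      rw [mem_dominant, Finset.mem_singleton]
      constructor
      · exact fun hb => hb.1
      · rintro rfl
        exact ⟨rfl, fun c hc => by rw [Finset.mem_singleton.1 hc]⟩
    have hw : weight p β h β' h' a ≠ 0 := by
      have := H.laplaceMass_pos
      rw [laplaceMass_one_eq_weight p β h β' h' (maximizers_subset_Ioo p β h ha)] at this
      exact (pos_of_mul_pos_right this (by positivity)).ne'
    rw [hdom, Finset.sum_singleton, prob, Finset.sum_singleton, div_self hw, one_mul] at hlim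
    exact hlim
  · obtain ⟨K, hK⟩ := H.exists_cond_moment_le l
    refine ⟨K, fun n hn => ?_⟩
    have := hK n hn (hpos n)
    rwa [cond_plusFraction_univ] at this
  · obtain ⟨K, hK⟩ := H.exists_cond_clt hreg.2
    refine ⟨K, fun n hn => ?_⟩
    have := hK n hn (hpos n)
    rwa [cond_plusFraction_univ] at this

/-- The special points. -/
theorem specialPoints_limit (hθ : (β, h) ∈ specialPoints p) (ha : a ∈ maximizers p β h)
    (β' h' : ℝ) :
    IsRegular (freeEnergy p β h) 2 a ∧
    ∃ C : ℝ, ∀ n : ℕ, 1 ≤ n →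
      wassersteinDist
        ((gibbsS p β h β' h' n).map
          fun ω => (magnetization ω - n * (2 * a - 1)) / (n : ℝ) ^ (3 / 4 : ℝ))
        (volume.tilted fun x : ℝ =>
          (iteratedDeriv 4 (freeEnergy p β h) a / 24) * x ^ 4 / 16
            + deriv (energy p β' h') a * x / 2)
        ≤ ENNReal.ofReal (C * (n : ℝ) ^ (-(1 / 4) : ℝ)) := by
  obtain ⟨-, a', -, hmax, h2⟩ := hθ
  obtain rfl : a = a' := by
    have := ha
    rw [hmax] at this
    exact this
  have hreg := isRegular_two_of_eq_zero ha h2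
  obtain ⟨κ, C, ε, H⟩ := exists_laplaceData (D := Set.univ) one_le_two
    (fun b hb => by
      rw [hmax] at hb
      rwa [Set.mem_singleton_iff.1 hb]) ha β' h' one_pos
    (fun _ _ _ => Set.mem_univ _) one_pos fun x _ _ b hb => by
      rw [hmax] at hb
      rw [one_mul, Set.mem_singleton_iff.1 hb]
  obtain ⟨K, hK⟩ := H.exists_wasserstein_le isRootScale_rpow
  refine ⟨hreg, K, fun n hn => ?_⟩
  have hn0 : (0 : ℝ) < n := by exact_mod_cast hn
  have h1 := hK n hn (by rw [Set.indicator_univ]; exact spinSum_one_pos _ _)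
  rw [cond_plusFraction_univ] at h1
  have hX : (fun ω : Config n => (magnetization ω - n * (2 * a - 1)) / (n : ℝ) ^ (3 / 4 : ℝ))
      = fun ω => 2 * ((n : ℝ) ^ (1 / 4 : ℝ) * (plusFraction ω - a)) := by
    ext ω
    have hn34 : (n : ℝ) ^ (3 / 4 : ℝ) * (n : ℝ) ^ (1 / 4 : ℝ) = n := by
      rw [← Real.rpow_add hn0]
      norm_num
    have hp34 : (n : ℝ) ^ (3 / 4 : ℝ) ≠ 0 := (Real.rpow_pos_of_pos hn0 _).ne'
    rw [magnetization_eq hn, div_eq_iff hp34]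
    linear_combination -2 * (plusFraction ω - a) * hn34
  have hv : (fun x : ℝ => (iteratedDeriv 4 (freeEnergy p β h) a / 24) * x ^ 4 / 16
            + deriv (energy p β' h') a * x / 2)
      = fun x : ℝ => iteratedDeriv (2 * 2) (freeEnergy p β h) a / (2 * 2).factorial
          * (x / 2) ^ (2 * 2) + deriv (energy p β' h') a * (x / 2) := by
    ext x
    norm_num [Nat.factorial]
    ring
  rw [hX, hv, Real.rpow_neg hn0.le, ← div_eq_mul_inv]
  exact h1

/-- A degenerate maximizer would be the only one, by concavity for `β > 0`, against the existence of
two. -/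
theorem criticalCurve_isRegular (hθ : (β, h) ∈ criticalCurve p) (ha : a ∈ maximizers p β h) :
    IsRegular (freeEnergy p β h) 1 a := by
  refine isRegular_one_of_ne_zero ha fun h2 => ?_
  have := hθ.2
  rw [maximizers_eq_singleton_of_degenerate hθ.1 ha h2] at this
  exact Set.not_nontrivial_singleton this

/-- The probabilities of windows around dominant maximizers, with a rate. -/
theorem exists_abs_gibbsR_window_sub_le {s : Finset ℝ} (hs : (s : Set ℝ) = maximizers p β h)
    (hr : ∀ a ∈ s, IsRegular (freeEnergy p β h) 1 a)
    (ha : a ∈ dominant (energy p β' h') s) {δ : ℝ} (hδ : 0 < δ)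
    (hsep : ∀ b ∈ s, b ≠ a → δ < |(2 * b - 1) - (2 * a - 1)|) :
    ∃ C : ℝ, ∀ᶠ n : ℕ in atTop,
      |(gibbsR p β h β' h' n).real {ω | |magnetization ω / n - (2 * a - 1)| ≤ δ}
        - prob p β h β' h' (dominant (energy p β' h') s) a|
        ≤ C * (Real.log n ^ 3 / √(n : ℝ)) := by
  obtain ⟨κ, C, ε, H⟩ := exists_laplaceData_window hs hr β' h' (mem_dominant.1 ha).1 hδ hsep
  obtain ⟨K, hK, hle⟩ := H.exists_abs_prob_sub_le hs hr ha
  refine ⟨K, ?_⟩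
  -- The rate already obtained is `K / √n`; the factor `log n ^ 3` is at least one for large `n` and
  -- only weakens it.
  have hlog := (Real.tendsto_log_atTop.comp tendsto_natCast_atTop_atTop).eventually_ge_atTop
    (1 : ℝ)
  filter_upwards [hlog, eventually_ge_atTop 1] with n h1 hn
  rw [gibbsR_real_setOf hn fun y => |y - (2 * a - 1)| ≤ δ]
  refine (hle n hn).trans ?_
  have h3 : (1 : ℝ) ≤ Real.log n ^ 3 := one_le_pow₀ h1
  rw [div_eq_mul_one_div]
  gcongr

/-- Conditional moments and central limit theorems at every maximizer. -/
theorem window_cond_limit {s : Finset ℝ} (hs : (s : Set ℝ) = maximizers p β h)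
    (hr : ∀ a ∈ s, IsRegular (freeEnergy p β h) 1 a) (β' h' : ℝ) (ha : a ∈ s) {δ : ℝ} (hδ : 0 < δ)
    (hsep : ∀ b ∈ s, b ≠ a → δ < |(2 * b - 1) - (2 * a - 1)|) :
    (∀ l : ℕ, ∃ C : ℝ, ∀ᶠ n : ℕ in atTop,
      ∫ ω, |magnetization ω / n - (2 * a - 1)| ^ l
          ∂((gibbsR p β h β' h' n)[|{ω | |magnetization ω / n - (2 * a - 1)| ≤ δ}])
        ≤ C * (n : ℝ) ^ (-(l : ℝ) / 2)) ∧
    (∃ C : ℝ, ∀ᶠ n : ℕ in atTop,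
      wassersteinDist
        (((gibbsR p β h β' h' n)[|{ω | |magnetization ω / n - (2 * a - 1)| ≤ δ}]).map
          fun ω => (magnetization ω - n * (2 * a - 1)) / √(n : ℝ))
        (cltLaw p β h β' h' a) ≤ ENNReal.ofReal (C / √(n : ℝ))) := by
  obtain ⟨κ, C, ε, H⟩ := exists_laplaceData_window hs hr β' h' ha hδ hsep
  have hset : ∀ n : ℕ, 1 ≤ n → {ω : Config n | |magnetization ω / n - (2 * a - 1)| ≤ δ}
      = {ω | plusFraction ω ∈ {x : ℝ | |2 * x - 1 - (2 * a - 1)| ≤ δ}} := by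
    intro n hn
    ext ω
    change |magnetization ω / n - (2 * a - 1)| ≤ δ ↔ |2 * plusFraction ω - 1 - (2 * a - 1)| ≤ δ
    rw [magnetization_div hn]
  -- For small `n` the window may contain no lattice point; its mass is known to be positive only
  -- for large `n`.
  have hev := H.eventually_spinSum_pos isRootScale_sqrt
  refine ⟨fun l => ?_, ?_⟩
  · obtain ⟨K, hK⟩ := H.exists_cond_moment_le l
    refine ⟨K, ?_⟩
    filter_upwards [hev, eventually_ge_atTop 1] with n hpos hn
    rw [hset n hn]
    exact hK n hn hpos
  · obtain ⟨K, hK⟩ := H.exists_cond_clt (hr a ha).2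
    refine ⟨K, ?_⟩
    filter_upwards [hev, eventually_ge_atTop 1] with n hpos hn
    rw [hset n hn]
    exact hK n hn hpos

end PSpin

/-! ### The three regimes together -/

theorem mainTheorem9 (p : ℕ) (hp : 1 ≤ p) (β h β' h' : ℝ) :
    -- (i) the regular region
    ((β, h) ∈ PSpin.regularRegion p → ∀ a ∈ PSpin.maximizers p β h,
      PSpin.IsRegular (PSpin.freeEnergy p β h) 1 a ∧
      -- concentration at `2a - 1`
      (∀ δ : ℝ, 0 < δ → ∃ c : ℝ, 0 < c ∧ ∀ᶠ n : ℕ in atTop,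
        (PSpin.gibbsR p β h β' h' n).real
          {ω | δ < |PSpin.magnetization ω / n - (2 * a - 1)|} ≤ Real.exp (-c * n)) ∧
      (∀ f : BoundedContinuousFunction ℝ ℝ,
        Tendsto (fun n : ℕ => ∫ ω, f (PSpin.magnetization ω / n) ∂(PSpin.gibbsR p β h β' h' n))
          atTop (𝓝 (f (2 * a - 1)))) ∧
      -- moments and central limit theorem
      (∀ l : ℕ, ∃ C : ℝ, ∀ n : ℕ, 1 ≤ n →
        ∫ ω, |PSpin.magnetization ω / n - (2 * a - 1)| ^ l ∂(PSpin.gibbsR p β h β' h' n)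
          ≤ C * (n : ℝ) ^ (-(l : ℝ) / 2)) ∧
      (∃ C : ℝ, ∀ n : ℕ, 1 ≤ n →
        PSpin.wassersteinDist
          ((PSpin.gibbsR p β h β' h' n).map
            fun ω => (PSpin.magnetization ω - n * (2 * a - 1)) / √(n : ℝ))
          (PSpin.cltLaw p β h β' h' a) ≤ ENNReal.ofReal (C / √(n : ℝ)))) ∧
    -- (ii) the critical curve
    ((β, h) ∈ PSpin.criticalCurve p → ∃ s : Finset ℝ, (s : Set ℝ) = PSpin.maximizers p β h ∧
      (∀ a ∈ s, a ∈ Set.Ioo (0 : ℝ) 1 ∧ PSpin.IsRegular (PSpin.freeEnergy p β h) 1 a) ∧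
      -- concentration around the points `2a - 1`, and the limiting weights
      (∀ δ : ℝ, 0 < δ → ∃ c : ℝ, 0 < c ∧ ∀ᶠ n : ℕ in atTop,
        (PSpin.gibbsR p β h β' h' n).real
          {ω | ∀ a ∈ s, δ < |PSpin.magnetization ω / n - (2 * a - 1)|} ≤ Real.exp (-c * n)) ∧
      (∀ δ : ℝ, 0 < δ → ∃ c : ℝ, 0 < c ∧ ∀ᶠ n : ℕ in atTop,
        (PSpin.gibbsR p β h β' h' n).real
          {ω | ∀ a ∈ PSpin.dominant (PSpin.energy p β' h') s,
            δ < |PSpin.magnetization ω / n - (2 * a - 1)|} ≤ Real.exp (-c * √(n : ℝ))) ∧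
      (∀ a ∈ PSpin.dominant (PSpin.energy p β' h') s, ∀ δ : ℝ, 0 < δ →
        (∀ b ∈ s, b ≠ a → δ < |(2 * b - 1) - (2 * a - 1)|) →
        ∃ C : ℝ, ∀ᶠ n : ℕ in atTop,
          |(PSpin.gibbsR p β h β' h' n).real
              {ω | |PSpin.magnetization ω / n - (2 * a - 1)| ≤ δ}
            - PSpin.prob p β h β' h' (PSpin.dominant (PSpin.energy p β' h') s) a|
            ≤ C * (Real.log n ^ 3 / √(n : ℝ))) ∧
      (∀ f : BoundedContinuousFunction ℝ ℝ,
        Tendsto (fun n : ℕ => ∫ ω, f (PSpin.magnetization ω / n) ∂(PSpin.gibbsR p β h β' h' n))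
          atTop (𝓝 (∑ a ∈ PSpin.dominant (PSpin.energy p β' h') s,
            PSpin.prob p β h β' h' (PSpin.dominant (PSpin.energy p β' h') s) a
              * f (2 * a - 1)))) ∧
      -- conditional moments and conditional central limit theorems, at every maximizer
      (∀ a ∈ s, ∀ δ : ℝ, 0 < δ → (∀ b ∈ s, b ≠ a → δ < |(2 * b - 1) - (2 * a - 1)|) →
        (∀ l : ℕ, ∃ C : ℝ, ∀ᶠ n : ℕ in atTop,
          ∫ ω, |PSpin.magnetization ω / n - (2 * a - 1)| ^ l
              ∂((PSpin.gibbsR p β h β' h' n)[|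
                {ω | |PSpin.magnetization ω / n - (2 * a - 1)| ≤ δ}])
            ≤ C * (n : ℝ) ^ (-(l : ℝ) / 2)) ∧
        (∃ C : ℝ, ∀ᶠ n : ℕ in atTop,
          PSpin.wassersteinDist
            (((PSpin.gibbsR p β h β' h' n)[|
                {ω | |PSpin.magnetization ω / n - (2 * a - 1)| ≤ δ}]).map
              fun ω => (PSpin.magnetization ω - n * (2 * a - 1)) / √(n : ℝ))
            (PSpin.cltLaw p β h β' h' a) ≤ ENNReal.ofReal (C / √(n : ℝ))))) ∧
    -- (iii) the special points
    ((β, h) ∈ PSpin.specialPoints p → ∀ a ∈ PSpin.maximizers p β h,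
      PSpin.IsRegular (PSpin.freeEnergy p β h) 2 a ∧
      ∃ C : ℝ, ∀ n : ℕ, 1 ≤ n →
        PSpin.wassersteinDist
          ((PSpin.gibbsS p β h β' h' n).map
            fun ω => (PSpin.magnetization ω - n * (2 * a - 1)) / (n : ℝ) ^ (3 / 4 : ℝ))
          (volume.tilted fun x : ℝ =>
            (iteratedDeriv 4 (PSpin.freeEnergy p β h) a / 24) * x ^ 4 / 16
              + deriv (PSpin.energy p β' h') a * x / 2)
          ≤ ENNReal.ofReal (C * (n : ℝ) ^ (-(1 / 4) : ℝ))) := by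
  refine ⟨fun hθ a ha => PSpin.regularRegion_limit hθ ha β' h', fun hθ => ?_,
    fun hθ a ha => PSpin.specialPoints_limit hθ ha β' h'⟩
  -- Regularity precedes finiteness: two maximizers exclude degenerate ones, and nondegenerate
  -- maximizers are isolated.
  have hfin := PSpin.finite_maximizers_of_isRegular fun a ha =>
    PSpin.criticalCurve_isRegular hθ ha
  have hs : (hfin.toFinset : Set ℝ) = PSpin.maximizers p β h := hfin.coe_toFinset
  have hmem : ∀ a ∈ hfin.toFinset, a ∈ PSpin.maximizers p β h := fun a ha =>
    hfin.mem_toFinset.1 ha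
  have hr : ∀ a ∈ hfin.toFinset, PSpin.IsRegular (PSpin.freeEnergy p β h) 1 a := fun a ha =>
    PSpin.criticalCurve_isRegular hθ (hmem a ha)
  have hne : hfin.toFinset.Nonempty := hfin.toFinset_nonempty.2 hθ.2.nonempty
  refine ⟨hfin.toFinset, hs,
    fun a ha => ⟨PSpin.maximizers_subset_Ioo p β h (hmem a ha), hr a ha⟩,
    fun δ hδ => PSpin.exists_gibbsR_awayFrom_le hs hr hne β' h' hδ, fun δ hδ => ?_,
    fun a ha δ hδ hsep => PSpin.exists_abs_gibbsR_window_sub_le hs hr ha hδ hsep,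
    fun f => PSpin.tendsto_integral_gibbsR hs hr hne β' h' f,
    fun a ha δ hδ hsep => PSpin.window_cond_limit hs hr β' h' ha hδ hsep⟩
  obtain ⟨c, hc, hev⟩ := PSpin.exists_awayFrom_dominant_le_exp hs hr hne β' h' hδ
  refine ⟨c, hc, ?_⟩
  filter_upwards [hev, eventually_ge_atTop 1] with n h1 hn
  rw [PSpin.gibbsR_real_setOf hn fun y =>
    ∀ a ∈ PSpin.dominant (PSpin.energy p β' h') hfin.toFinset, δ < |y - (2 * a - 1)|]
  exact h1
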